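/- **Setting.** Let $n,m,d\ge 1$, let $\mathcal D$ be a set of data points and $\ell(z,\cdot):\mathbb R^d\to\mathbb R$, $z\in\mathcal D$, differentiable losses with $\|\nabla \ell(z,x)-\nabla \ell(z,y)\|\le L\|x-y\|$ and $\|\nabla \ell(z,x)\|\le G$ for all $z,x,y$ ($L,G>0$). Client $i\in[n]$ holds $D_i=(d_{i,1},\dots,d_{i,m})\in\mathcal D^m$; write $f_{i,j}=\ell(d_{i,j},\cdot)$, $f_i=\frac1m\sum_j f_{i,j}$, $f=\frac1n\sum_i f_i$, $f^*=\inf f$. A randomized map $\mathcal C$ of $\mathbb R^d$ is an $\omega$-compression operator ($\omega\ge 0$) if $\mathbb E\,\mathcal C(x)=x$ and $\mathbb E\|\mathcal C(x)-x\|^2\le\omega\|x\|^2$ for all $x$. **SoteriaFL-SVRG** with stepsize $\eta$, shift stepsize $\gamma$, privacy variance $\sigma_p^2$, (expected) minibatch size $b$, snapshot probability $p$ and $T$ rounds: start with $x^0=w^0$ and $s_i^0=s^0=0$. In round $t=0,\dots,T-1$ each client $i$ draws a minibatch $\mathcal I_i^t\subseteq[m]$ containing each $j$ independently with probability $b/m$,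 draws $\xi_i^t\sim\mathcal N(0,\sigma_p^2 I)$, computes $$\tilde g_i^t=\frac1b\sum_{j\in\mathcal I_i^t}\big(\nabla f_{i,j}(x^t)-\nabla f_{i,j}(w^t)\big)+\nabla f_i(w^t),$$ sends $v_i^t=\mathcal C_i^t(\tilde g_i^t+\xi_i^t-s_i^t)$ and sets $s_i^{t+1}=s_i^t+\gamma v_i^t$; then $x^{t+1}=x^t-\eta\big(s^t+\frac1n\sum_i v_i^t\big)$, $s^{t+1}=s^t+\gamma\frac1n\sum_i v_i^t$, and $w^{t+1}=x^t$ with probability $p$, $w^{t+1}=w^t$ otherwise (one coin, common to all clients). All random choices, including those of the $\omega$-compression operators $\mathcal C_i^t$, are independent. The released transcript consists of all messages $v_i^t$ and all snapshot coins. The algorithm is $(\epsilon,\delta)$-LDP if for every client $i$, all fixed datasets of the other clients, all $D_i,D_i'$ differing in at most one entry and all measurable sets $S$ of transcripts, $\Pr\{\mathrm{transcript}(D_i)\in S\}\le e^{\epsilon}\Pr\{\mathrm{transcript}(D_i')\in S\}+\delta$. **Parameters.** Put $b=\frac{m^{2/3}}{4}$, $p=\frac bm$, $\gamma=\sqrt{\frac{1+2\omega}{2(1+\omega)^3}}$,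 $\tau=\frac{(1+\omega)^{3/2}}{n^{1/2}}$, $$\bar\eta=\frac{p^{2/3}b^{1/3}\min\{1,\sqrt{n/(1+\omega)^3}\}}{2L},\qquad \beta=\frac{p^{4/3}b^{2/3}(1+\omega)^2\min\{1,n/(1+\omega)^3\}}{n},$$ $$\Phi_0=f(x^0)-f^*+\frac{\beta}{Ln}\sum_{i=1}^n\|\nabla f_i(x^0)\|^2 .$$ **Claim.** For every $\Lambda>0$ there are constants $c,c',K>0$ depending only on $\Lambda$ such that the following holds for all $n,m,d,L,G,\omega,\mathcal D,\ell,x^0,\mathcal C_i^t$ as above and all $\epsilon>0$, $\delta\in(0,1)$, $\Phi>0$, $0<\eta\le\bar\eta$. Let $$T=\left\lceil \sqrt{\Phi}\,\frac{\sqrt{nL}\,m\epsilon}{G\sqrt{(1+\omega)d\log(1/\delta)}}\max\{1,\tau\}\right\rceil,\qquad \sigma_p^2=c\,\frac{G^2T\log(1/\delta)}{m^2\epsilon^2},$$ and suppose that $\epsilon\le\Lambda\log(1/\delta)$ and $\epsilon<c'b^2T/m^2$. Then SoteriaFL-SVRG with these parameters is $(\epsilon,\delta)$-LDP, and for every dataset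 with $f^*>-\infty$ and $\Phi_0\le\Phi$, $$\frac1T\sum_{t=0}^{T-1}\mathbb E\|\nabla f(x^t)\|^2\le K\,\frac{\bar\eta}{\eta}\,\sqrt{\Phi}\;\frac{G\sqrt{(1+\omega)Ld\log(1/\delta)}}{\sqrt n\,m\epsilon}.$$ In particular, for $\eta=\bar\eta$ the utility is $O\Big(\sqrt{\Phi}\,\frac{G\sqrt{(1+\omega)Ld\log(1/\delta)}}{\sqrt n\,m\epsilon}\Big)$, without a factor $1+\sqrt\tau$. -/

import Mathlib

open MeasureTheory ProbabilityTheory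

noncomputable section

namespace Soteria

/-- The parameter space `ℝ^d` with the Euclidean norm. -/
abbrev Vec (d : ℕ) := EuclideanSpace ℝ (Fin d)

/-! ### Compression operators and local differential privacy -/

/-- A randomized map of `ℝ^d` (a Markov kernel: `C x` is the law of the random vector `C(x)`) is an
`ω`-compression operator if `E[C(x)] = x` and `E‖C(x) - x‖² ≤ ω ‖x‖²` for all `x`. -/
def IsCompressor {d : ℕ} (ω : ℝ) (C : Kernel (Vec d) (Vec d)) : Prop :=
  IsMarkovKernel C ∧
  (∀ x, Integrable (fun y => y) (C x)) ∧
  (∀ x, ∫ y, y ∂(C x) = x) ∧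
  (∀ x, ∫⁻ y, ENNReal.ofReal (‖y - x‖ ^ 2) ∂(C x) ≤ ENNReal.ofReal (ω * ‖x‖ ^ 2))

/-- Two datasets with `m` entries are neighbors if they differ in (at most) one entry. -/
def Neighbors {m : ℕ} {𝒟 : Type*} (A B : Fin m → 𝒟) : Prop :=
  ∃ j, ∀ k, k ≠ j → A k = B k

/-- A randomized mechanism, given by its output law `M A` for each local dataset `A`, is
`(ε, δ)`-locally differentially private. -/
def IsLDP {m : ℕ} {𝒟 R : Type*} [MeasurableSpace R] (ε δ : ℝ)
    (M : (Fin m → 𝒟) → Measure R) : Prop :=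
  (∀ A, IsProbabilityMeasure (M A)) ∧
  ∀ A B, Neighbors A B → ∀ S, MeasurableSet S →
    M A S ≤ ENNReal.ofReal (Real.exp ε) * M B S + ENNReal.ofReal δ

/-! ### The optimization problem -/

/-- `f_i(x) = (1/m) ∑_j ℓ(d_{i,j}, x)` for the local dataset `A = (d_{i,j})_j`. -/
def localLoss {m d : ℕ} {𝒟 : Type*} (loss : 𝒟 → Vec d → ℝ) (A : Fin m → 𝒟) (x : Vec d) : ℝ :=
  (1 / (m : ℝ)) * ∑ j, loss (A j) x

/-- `f(x) = (1/n) ∑_i f_i(x)`. -/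
def globalLoss {n m d : ℕ} {𝒟 : Type*} (loss : 𝒟 → Vec d → ℝ) (D : Fin n → Fin m → 𝒟)
    (x : Vec d) : ℝ :=
  (1 / (n : ℝ)) * ∑ i, localLoss loss (D i) x

/-! ### The algorithm SoteriaFL-SVRG -/

/-- Scalar inputs of the algorithm: stepsize `η`, shift stepsize `γ`, privacy variance `σsq`,
expected minibatch size `b`, snapshot probability `p`. -/
structure Params where
  η : ℝ
  γ : ℝ
  σsq : ℝ
  b : ℝ
  p : ℝ

/-- State before a round: iterate `x`, snapshot `w`, client references `s i`, server reference
`sBar`. -/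
structure State (n d : ℕ) where
  x : Vec d
  w : Vec d
  s : Fin n → Vec d
  sBar : Vec d

/-- What is released in one round: the messages of all clients, and the snapshot coin. -/
abbrev RoundOut (n d : ℕ) := (Fin n → Vec d) × Bool

/-- A coin that shows `true` with probability `p` (for `p ∈ [0, 1]`). -/
def coin (p : ℝ) : Measure Bool :=
  bernoulliMeasure true false (Set.projIcc 0 1 zero_le_one p)

/-- The random minibatch: each of the `m` samples is included independently with
probability `b / m`. -/
def minibatchLaw (m : ℕ) (b : ℝ) : Measure (Fin m → Bool) :=
  Measure.pi fun _ => coin (b / m)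

/-- The Gaussian law `N(0, σsq I)` on `ℝ^d`. -/
def gaussianNoise (d : ℕ) (σsq : ℝ) : Measure (Vec d) :=
  (stdGaussian (Vec d)).map fun z => Real.sqrt σsq • z

/-- The local SVRG estimator
`(1/b) ∑_{j ∈ I} (∇f_{i,j}(x) - ∇f_{i,j}(w)) + ∇f_i(w)`. -/
def svrgEstimator {m d : ℕ} {𝒟 : Type*} (loss : 𝒟 → Vec d → ℝ) (b : ℝ) (A : Fin m → 𝒟)
    (x w : Vec d) (I : Fin m → Bool) : Vec d :=
  (1 / b) • (∑ j, if I j then gradient (loss (A j)) x - gradient (loss (A j)) w else 0)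
    + gradient (localLoss loss A) w

/-- Law of the message `v = C(g̃ + ξ - s)` of one client with local dataset `A`, at iterate `x`,
snapshot `w` and reference `s`. -/
def messageLaw {m d : ℕ} {𝒟 : Type*} (loss : 𝒟 → Vec d → ℝ) (P : Params)
    (C : Kernel (Vec d) (Vec d)) (A : Fin m → 𝒟) (x w s : Vec d) : Measure (Vec d) :=
  ((minibatchLaw m P.b).prod (gaussianNoise d P.σsq)).bind fun r =>
    C (svrgEstimator loss P.b A x w r.1 + r.2 - s)

/-- Joint law of all messages (independent across clients) and of the snapshot coin of one round. -/
def roundLaw {n m d : ℕ} {𝒟 : Type*} (loss : 𝒟 → Vec d → ℝ) (P : Params)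
    (C : Fin n → Kernel (Vec d) (Vec d)) (D : Fin n → Fin m → 𝒟) (st : State n d) :
    Measure (RoundOut n d) :=
  (Measure.pi fun i => messageLaw loss P (C i) (D i) st.x st.w (st.s i)).prod (coin P.p)

/-- The state before the first round: `x = w = x0`, and all references are `0`. -/
def initState (n : ℕ) {d : ℕ} (x0 : Vec d) : State n d where
  x := x0
  w := x0
  s := fun _ => 0
  sBar := 0

/-- The update of the state by the messages and the snapshot coin of one round. -/
def nextState {n d : ℕ} (P : Params) (st : State n d) (o : RoundOut n d) : State n d where
  x := st.x - P.η • (st.sBar + (1 / (n : ℝ)) • ∑ i, o.1 i)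
  w := if o.2 then st.x else st.w
  s := fun i => st.s i + P.γ • o.1 i
  sBar := st.sBar + P.γ • ((1 / (n : ℝ)) • ∑ i, o.1 i)

/-- The state before round `t`, as a function of what was released in rounds `0, …, t - 1`. -/
def stateAfter {n d : ℕ} (P : Params) (x0 : Vec d) : (t : ℕ) → (Fin t → RoundOut n d) → State n d
  | 0, _ => initState n x0
  | t + 1, h => nextState P (stateAfter P x0 t (Fin.init h)) (h (Fin.last t))

/-- Law of the transcript of the first `t` rounds (all messages of all clients and all snapshot
coins; these determine all iterates, snapshots and references). -/
def transcriptLaw {n m d : ℕ} {𝒟 : Type*} (loss : 𝒟 → Vec d → ℝ) (P : Params)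
    (C : Fin n → ℕ → Kernel (Vec d) (Vec d)) (x0 : Vec d) (D : Fin n → Fin m → 𝒟) :
    (t : ℕ) → Measure (Fin t → RoundOut n d)
  | 0 => Measure.dirac fun k => k.elim0
  | t + 1 => (transcriptLaw loss P C x0 D t).bind fun h =>
      (roundLaw loss P (fun i => C i t) D (stateAfter P x0 t h)).map fun o =>
        Fin.snoc (α := fun _ => RoundOut n d) h o

/-- `(1/T) ∑_{t < T} E‖∇f(x^t)‖²`. -/
def utility {n m d : ℕ} {𝒟 : Type*} (loss : 𝒟 → Vec d → ℝ) (P : Params)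
    (C : Fin n → ℕ → Kernel (Vec d) (Vec d)) (x0 : Vec d) (D : Fin n → Fin m → 𝒟) (T : ℕ) : ℝ :=
  (1 / (T : ℝ)) * ∑ t ∈ Finset.range T,
    ∫ h, ‖gradient (globalLoss loss D) (stateAfter P x0 t h).x‖ ^ 2
      ∂(transcriptLaw loss P C x0 D t)

/-! ### The choice of the parameters -/

/-- `b = m^{2/3} / 4`. -/
def batch (m : ℕ) : ℝ := (m : ℝ) ^ (2 / 3 : ℝ) / 4

/-- `p = b / m`. -/
def prob (m : ℕ) : ℝ := batch m / m

/-- `γ = √((1 + 2ω) / (2 (1 + ω)³))`. -/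
def shiftStep (ω : ℝ) : ℝ := Real.sqrt ((1 + 2 * ω) / (2 * (1 + ω) ^ 3))

/-- `τ = (1 + ω)^{3/2} / n^{1/2}`. -/
def tau (n : ℕ) (ω : ℝ) : ℝ := (1 + ω) ^ (3 / 2 : ℝ) / Real.sqrt n

/-- `β = p^{4/3} b^{2/3} (1 + ω)² min{1, n / (1 + ω)³} / n`. -/
def betaCoef (n m : ℕ) (ω : ℝ) : ℝ :=
  prob m ^ (4 / 3 : ℝ) * batch m ^ (2 / 3 : ℝ) * (1 + ω) ^ 2 * min 1 (n / (1 + ω) ^ 3) / n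

/-- The largest stepsize, `p^{2/3} b^{1/3} min{1, √(n / (1 + ω)³)} / (2 L)`. -/
def maxStep (n m : ℕ) (L ω : ℝ) : ℝ :=
  prob m ^ (2 / 3 : ℝ) * batch m ^ (1 / 3 : ℝ) * min 1 (Real.sqrt (n / (1 + ω) ^ 3)) / (2 * L)

/-- The initial potential
`f(x0) - f* + (β / (L n)) ∑_i ‖∇f_i(x0) - s_i⁰‖²` (with `s_i⁰ = 0`). -/
def initPotential {n m d : ℕ} {𝒟 : Type*} (loss : 𝒟 → Vec d → ℝ) (L ω : ℝ)
    (D : Fin n → Fin m → 𝒟) (x0 : Vec d) : ℝ :=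
  globalLoss loss D x0 - (⨅ x, globalLoss loss D x)
    + betaCoef n m ω / (L * n) * ∑ i, ‖gradient (localLoss loss (D i)) x0‖ ^ 2

/-- The number of communication rounds,
`√Φ · √(nL) m ε / (G √((1 + ω) d log(1/δ))) · max{1, τ}`, rounded up. -/
def rounds (n m d : ℕ) (L G ω ε δ Φ : ℝ) : ℕ :=
  ⌈Real.sqrt Φ * (Real.sqrt (n * L) * m * ε / (G * Real.sqrt ((1 + ω) * d * Real.log (1 / δ))))
    * max 1 (tau n ω)⌉₊

/-- The parameters of SoteriaFL-SVRG for `T` rounds, with privacy variance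
`c G² T log(1/δ) / (m² ε²)`. -/
def svrgParams (m : ℕ) (G ω ε δ c η : ℝ) (T : ℕ) : Params where
  η := η
  γ := shiftStep ω
  σsq := c * (G ^ 2 * T * Real.log (1 / δ) / (m ^ 2 * ε ^ 2))
  b := batch m
  p := prob m

end Soteria

end

/-! Privacy. Write `v` for the privacy variance. Changing entry `j` of one dataset alters the
client's uncompressed message in two ways: the minibatch term `(1/b)(∇f_j(x) - ∇f_j(w))`, of norm at
most `2G/b`, is present only with probability `q = b/m`, and the full gradient at `w` moves by at
most `2G/m`. Given the other minibatch coins, the message is a two-component Gaussian mixture.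
Neighbouring mixtures are compared along mixture, Gaussian, shifted Gaussian, mixture
(`mixtureLaw_dom`). As long as `N (2G/b)² ≤ v`, subsampling reduces the cost of a mixture step to
order `N q² (2G/b)² / v = 4 N G² / (m² v)`. This is the order of the shift cost, so `b` cancels
(`mixMoment_le_exp`, `lintegral_inv_mixture_pow_le`). Rényi divergence enters in the dual form
`MomentDom`, which passes through kernels (`MomentDom.bind`). Compression and the other clients are
therefore free, and the constants multiply over adaptive rounds. An order `N` comparable to
`log(1/δ)/ε`, followed by weighted AM-GM (`MomentDom.measure_le_exp`), gives the `(ε, δ)` guarantee.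

Utility. The potential is `f(x) - f* + a‖x - w‖² + κ avg_i ‖∇f_i(x) - s_i‖²`. The server step is
`∇f(x)` plus an average of independent centred errors. Its variance is controlled by `‖x - w‖²`, the
shift errors and the noise, and the first two are absorbed by the potential because the snapshot
coin contracts one and the shift step the other (`potential_decrease`). With `μ = min{1,
√(n/(1+ω)³)} = 1/max{1, τ}` each round loses `η/4 ‖∇f‖²` in expectation and gains at most `d v (1+ω)
μ² / (10 L n)`. Because `p² b = 1/64`, the maximal stepsize is `μ/(8L)`. As `v` is proportional to
`T`, division by `ηT` leaves, at this stepsize, one term proportional to `1/(μT)` and one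
proportional to `μT`. The choice of `T` makes `μT` independent of `τ` up to rounding, so no power of
`τ` survives (`average_le_of_rounds`). -/

namespace Soteria

open scoped ENNReal

/-! ### Moment domination -/

/-- `μ` is dominated by `ν` with exponent `r` and constant `K` if
`∫ φ dμ ≤ K (∫ φ ^ r dν) ^ (1 / r)` for all measurable `φ ≥ 0`. This is the dual form of a bound on
the Rényi divergence of order `r / (r - 1)`. -/
def MomentDom {α : Type*} [MeasurableSpace α] (r : ℝ) (K : ℝ≥0∞) (μ ν : Measure α) : Prop :=
  ∀ φ : α → ℝ≥0∞, Measurable φ → ∫⁻ x, φ x ∂μ ≤ K * (∫⁻ x, φ x ^ r ∂ν) ^ (1 / r)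

section MomentDom

variable {α β : Type*} [MeasurableSpace α] [MeasurableSpace β] {r s : ℝ} {K K' : ℝ≥0∞}
  {μ ν ρ : Measure α}

/-- Jensen's inequality on a probability space, obtained from Hölder against the constant `1`. -/
theorem MomentDom.refl (μ : Measure α) [IsProbabilityMeasure μ] (hr : 1 < r) :
    MomentDom r 1 μ μ := by
  intro φ hφ
  have h := ENNReal.lintegral_mul_le_Lp_mul_Lq μ (Real.HolderConjugate.conjExponent hr)
    hφ.aemeasurable (aemeasurable_const (b := (1 : ℝ≥0∞)))
  simpa using h

theorem MomentDom.mono (h : MomentDom r K μ ν) (hK : K ≤ K') : MomentDom r K' μ ν :=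
  fun φ hφ => (h φ hφ).trans (by gcongr)

/-- A weak triangle inequality. The price of chaining is that exponents multiply, which is why three
comparisons of exponent `r` later end with `r * (r * r)`. -/
theorem MomentDom.trans (hr : 0 < r) (hs : 0 < s) (h₁ : MomentDom r K μ ρ)
    (h₂ : MomentDom s K' ρ ν) : MomentDom (r * s) (K * K' ^ (1 / r)) μ ν := by
  intro φ hφ
  calc ∫⁻ x, φ x ∂μ ≤ K * (∫⁻ x, φ x ^ r ∂ρ) ^ (1 / r) := h₁ φ hφ
    _ ≤ K * (K' * (∫⁻ x, (φ x ^ r) ^ s ∂ν) ^ (1 / s)) ^ (1 / r) := by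
        gcongr
        exact h₂ _ (hφ.pow_const r)
    _ = K * K' ^ (1 / r) * (∫⁻ x, φ x ^ (r * s) ∂ν) ^ (1 / (r * s)) := by
        rw [ENNReal.mul_rpow_of_nonneg _ _ (by positivity), ← ENNReal.rpow_mul, mul_assoc]
        simp_rw [← ENNReal.rpow_mul]
        congr 3
        field_simp

/-- Adaptive composition and post-processing in one statement. The outer bound is applied to `a ↦ (∫
φ ^ r dη_a) ^ (1 / r)`, whose `r`-th power undoes the root; this needs the same exponent at both
levels, but no densities. -/
theorem MomentDom.bind {κ η : α → Measure β} (hκ : Measurable κ) (hη : Measurable η) (hr : 0 < r)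
    (h : MomentDom r K μ ν) (h' : ∀ a, MomentDom r K' (κ a) (η a)) :
    MomentDom r (K * K') (μ.bind κ) (ν.bind η) := by
  intro φ hφ
  rw [Measure.lintegral_bind hκ.aemeasurable hφ.aemeasurable,
    Measure.lintegral_bind hη.aemeasurable (hφ.pow_const r).aemeasurable]
  have hm : Measurable fun a => ∫⁻ x, φ x ^ r ∂(η a) :=
    (Measure.measurable_lintegral (hφ.pow_const r)).comp hη
  calc ∫⁻ a, ∫⁻ x, φ x ∂κ a ∂μ ≤ ∫⁻ a, K' * (∫⁻ x, φ x ^ r ∂(η a)) ^ (1 / r) ∂μ :=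
        lintegral_mono fun a => h' a φ hφ
    _ = K' * ∫⁻ a, (∫⁻ x, φ x ^ r ∂(η a)) ^ (1 / r) ∂μ :=
        lintegral_const_mul _ (hm.pow_const _)
    _ ≤ K' * (K * (∫⁻ a, ((∫⁻ x, φ x ^ r ∂(η a)) ^ (1 / r)) ^ r ∂ν) ^ (1 / r)) := by
        gcongr
        exact h _ (hm.pow_const _)
    _ = K * K' * (∫⁻ a, ∫⁻ x, φ x ^ r ∂η a ∂ν) ^ (1 / r) := by
        simp_rw [← ENNReal.rpow_mul, one_div_mul_cancel hr.ne', ENNReal.rpow_one]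
        ring

theorem MomentDom.map (h : MomentDom r K μ ν) {f : α → β} (hf : Measurable f) :
    MomentDom r K (μ.map f) (ν.map f) := by
  intro φ hφ
  rw [lintegral_map hφ hf, lintegral_map (hφ.pow_const r) hf]
  exact h _ (hφ.comp hf)

theorem MomentDom.prod_right (h : MomentDom r K μ ν) (ρ : Measure β) [IsProbabilityMeasure ρ]
    (hr : 1 < r) : MomentDom r K (μ.prod ρ) (ν.prod ρ) := by
  have hm : Measurable fun a : α => ρ.map (Prod.mk a) := Measurable.map_prodMk_left
  have := MomentDom.bind (K' := 1) hm hm (by linarith) h fun a =>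
    (MomentDom.refl ρ hr).map measurable_prodMk_left
  simpa [Measure.prod] using this

theorem MomentDom.pi_of_eq_off {k : ℕ} {γ : Type*} [MeasurableSpace γ] {μ ν : Fin k → Measure γ}
    [∀ i, IsProbabilityMeasure (μ i)] [∀ i, IsProbabilityMeasure (ν i)] (i : Fin k) (hr : 1 < r)
    (h : MomentDom r K (μ i) (ν i)) (hoff : ∀ j, j ≠ i → μ j = ν j) :
    MomentDom r K (Measure.pi μ) (Measure.pi ν) := by
  cases k with
  | zero => exact i.elim0
  | succ k =>
    have h1 := (measurePreserving_piFinSuccAbove μ i).symm.map_eq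
    have h2 := (measurePreserving_piFinSuccAbove ν i).symm.map_eq
    rw [← h1, ← h2]
    have h3 : (fun j => μ (i.succAbove j)) = fun j => ν (i.succAbove j) :=
      funext fun j => hoff _ (Fin.succAbove_ne i j)
    rw [h3]
    exact (h.prod_right _ hr).map (MeasurableEquiv.measurable _)

theorem MomentDom.measure_le (h : MomentDom r K μ ν) (hr : 0 < r) {S : Set α}
    (hS : MeasurableSet S) : μ S ≤ K * ν S ^ (1 / r) := by
  have := h (S.indicator 1) (measurable_one.indicator hS)
  rw [lintegral_indicator_one hS] at this
  have h2 : ∀ x, S.indicator (1 : α → ℝ≥0∞) x ^ r = S.indicator 1 x := by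
    intro x
    by_cases hx : x ∈ S <;> simp [hx, hr]
  simp_rw [h2] at this
  rwa [lintegral_indicator_one hS] at this

/-- Moment domination yields approximate differential privacy. -/
theorem MomentDom.measure_le_exp [IsProbabilityMeasure ν] {k ε δ θ : ℝ} (hr : 0 < r)
    (hδ : 0 < δ) (hθ : 0 < θ) (hθ1 : θ < 1) (hrθ : 1 - θ ≤ 1 / r)
    (hk : k ≤ ε * (1 - θ) + θ * Real.log δ)
    (h : MomentDom r (ENNReal.ofReal (Real.exp k)) μ ν) {S : Set α} (hS : MeasurableSet S) :
    μ S ≤ ENNReal.ofReal (Real.exp ε) * ν S + ENNReal.ofReal δ := by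
  refine (h.measure_le hr hS).trans ?_
  -- Since `ν S ≤ 1`, a smaller exponent only enlarges the power.
  have h1 : ν S ^ (1 / r) ≤ ν S ^ (1 - θ) :=
    ENNReal.rpow_le_rpow_of_exponent_ge prob_le_one hrθ
  obtain ⟨y, hy0, hy⟩ : ∃ y : ℝ, 0 ≤ y ∧ ν S = ENNReal.ofReal y :=
    ⟨(ν S).toReal, ENNReal.toReal_nonneg, (ENNReal.ofReal_toReal (measure_ne_top _ _)).symm⟩
  calc _ ≤ ENNReal.ofReal (Real.exp (ε * (1 - θ) + θ * Real.log δ)) * ν S ^ (1 - θ) := by gcongr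
    _ ≤ _ := by
      rw [hy, ENNReal.ofReal_rpow_of_nonneg hy0 (by linarith), ← ENNReal.ofReal_mul (by positivity),
        ← ENNReal.ofReal_mul (by positivity), ← ENNReal.ofReal_add (by positivity) hδ.le]
      apply ENNReal.ofReal_le_ofReal
      -- Weighted AM-GM splits `(e^ε ν S)^(1-θ) δ^θ` into a sum; the weights, both at most `1`, are
      -- dropped afterwards.
      have h3 := Real.geom_mean_le_arith_mean2_weighted (w₁ := 1 - θ) (w₂ := θ)
        (p₁ := Real.exp ε * y) (p₂ := δ) (by linarith) hθ.le (by positivity) hδ.le (by ring)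
      have h4 : (Real.exp ε * y) ^ (1 - θ) * δ ^ θ
          = Real.exp (ε * (1 - θ) + θ * Real.log δ) * y ^ (1 - θ) := by
        rw [Real.mul_rpow (Real.exp_pos _).le hy0, Real.rpow_def_of_pos hδ, ← Real.exp_mul,
          Real.exp_add, mul_comm θ]
        ring
      rw [h4] at h3
      refine h3.trans ?_
      have h5 : 0 ≤ Real.exp ε * y := by positivity
      nlinarith
end MomentDom

/-! ### The Cameron–Martin formula and moments of mixtures of Gaussians -/

/-- The density of the standard Gaussian shifted by `a`. -/
noncomputable def shiftDensity {d : ℕ} (a z : Vec d) : ℝ :=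
  Real.exp (inner ℝ a z - ‖a‖ ^ 2 / 2)

section Gaussian

variable {d : ℕ}

theorem shiftDensity_pos (a z : Vec d) : 0 < shiftDensity a z := Real.exp_pos _

theorem measurable_shiftDensity (a : Vec d) : Measurable (shiftDensity a) := by
  unfold shiftDensity; fun_prop

theorem shiftDensity_eq_prod (a : Vec d) (x : Fin d → ℝ) :
    shiftDensity a (WithLp.toLp 2 x) = ∏ j, Real.exp (a j * x j - a j ^ 2 / 2) := by
  rw [shiftDensity, ← Real.exp_sum, Finset.sum_sub_distrib, ← Finset.sum_div,
    EuclideanSpace.real_norm_sq_eq, PiLp.inner_apply]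
  congr 2
  exact Finset.sum_congr rfl fun j _ => by simp [mul_comm]

theorem integrable_shiftDensity (a : Vec d) :
    Integrable (shiftDensity a) (stdGaussian (Vec d)) := by
  rw [← map_pi_eq_stdGaussian, integrable_map_measure
    (measurable_shiftDensity a).aestronglyMeasurable (by fun_prop)]
  have : shiftDensity a ∘ WithLp.toLp 2 = fun x => ∏ j, Real.exp (a j * x j - a j ^ 2 / 2) :=
    funext fun x => shiftDensity_eq_prod a x
  rw [this]
  refine Integrable.fintype_prod (f := fun j (y : ℝ) => Real.exp (a j * y - a j ^ 2 / 2))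
    fun j => ?_
  simp_rw [Real.exp_sub]
  exact (integrable_exp_mul_gaussianReal _).div_const _

/-- Exponential tilting evaluates the complex moment generating function at `a + it`, normalized by
`exp(-a²/2)`. -/
theorem integral_cexp_shift (a t : ℝ) :
    ∫ y, Complex.exp (a * y - a ^ 2 / 2) * Complex.exp (y * t * Complex.I) ∂(gaussianReal 0 1)
      = Complex.exp (a * t * Complex.I) * Complex.exp (-t ^ 2 / 2) := by
  have h := complexMGF_id_gaussianReal (μ := 0) (v := 1) (a + t * Complex.I)
  rw [complexMGF] at h
  have h2 : ∀ y : ℝ, Complex.exp (a * y - a ^ 2 / 2) * Complex.exp (y * t * Complex.I)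
      = Complex.exp (-a ^ 2 / 2) * Complex.exp ((a + t * Complex.I) * (id y : ℝ)) := by
    intro y
    rw [← Complex.exp_add, ← Complex.exp_add]
    congr 1
    simp only [id]
    ring
  simp_rw [h2]
  rw [integral_const_mul, h, ← Complex.exp_add, ← Complex.exp_add]
  congr 1
  simp only [Complex.ofReal_zero, mul_zero, NNReal.coe_one, Complex.ofReal_one, zero_add, one_mul]
  linear_combination (t ^ 2 / 2 : ℂ) * Complex.I_sq

/-- Cameron–Martin: two finite measures with the same characteristic function agree, and the
characteristic function of the tilted one factorizes over coordinates. -/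
theorem map_add_stdGaussian (a : Vec d) :
    (stdGaussian (Vec d)).map (fun z => z + a)
      = (stdGaussian (Vec d)).withDensity fun z => ENNReal.ofReal (shiftDensity a z) := by
  have hfin : IsFiniteMeasure
      ((stdGaussian (Vec d)).withDensity fun z => ENNReal.ofReal (shiftDensity a z)) := by
    refine isFiniteMeasure_withDensity ?_
    exact (integrable_shiftDensity a).lintegral_lt_top.ne
  apply Measure.ext_of_charFun
  ext t
  rw [charFun_map_add_const, charFun_stdGaussian, charFun_apply,
    integral_withDensity_eq_integral_toReal_smul
      (measurable_shiftDensity a).ennreal_ofReal (by simp)]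
  simp_rw [ENNReal.toReal_ofReal (shiftDensity_pos a _).le]
  rw [← map_pi_eq_stdGaussian, integral_map (by fun_prop)]
  · have h : ∀ x : Fin d → ℝ, (shiftDensity a (WithLp.toLp 2 x)) •
        Complex.exp ((inner ℝ (WithLp.toLp 2 x) t : ℝ) * Complex.I)
        = ∏ j, (Complex.exp (a j * x j - a j ^ 2 / 2) * Complex.exp (x j * t j * Complex.I)) := by
      intro x
      rw [shiftDensity_eq_prod, Finset.prod_mul_distrib, ← Complex.exp_sum (f := fun j =>
        (x j * t j * Complex.I : ℂ)), Complex.real_smul]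
      congr 1
      · push_cast; rfl
      · rw [← Finset.sum_mul]
        congr 2
        rw [PiLp.inner_apply]
        push_cast
        exact Finset.sum_congr rfl fun j _ => by simp [mul_comm]
    simp_rw [h]
    rw [integral_fintype_prod_eq_prod (fun j (y : ℝ) =>
      (Complex.exp (a j * y - a j ^ 2 / 2) * Complex.exp (y * t j * Complex.I) : ℂ))]
    simp_rw [integral_cexp_shift]
    rw [Finset.prod_mul_distrib, ← Complex.exp_sum, ← Complex.exp_sum, mul_comm]
    congr 2
    · rw [← Finset.sum_mul, PiLp.inner_apply]
      push_cast
      congr 1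
      exact Finset.sum_congr rfl fun j _ => by simp [mul_comm]
    · rw [← Finset.sum_div, ← Complex.ofReal_pow, EuclideanSpace.real_norm_sq_eq]
      push_cast
      rw [Finset.sum_neg_distrib]
  · have := (measurable_shiftDensity a)
    exact Measurable.aestronglyMeasurable (by fun_prop)

theorem lintegral_add_stdGaussian (a : Vec d) {φ : Vec d → ℝ≥0∞} (hφ : Measurable φ) :
    ∫⁻ z, φ (z + a) ∂(stdGaussian (Vec d))
      = ∫⁻ z, ENNReal.ofReal (shiftDensity a z) * φ z ∂(stdGaussian (Vec d)) := by
  rw [← lintegral_map hφ (by fun_prop), map_add_stdGaussian,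
    lintegral_withDensity_eq_lintegral_mul _ (measurable_shiftDensity a).ennreal_ofReal hφ]
  rfl

theorem lintegral_neg_stdGaussian {φ : Vec d → ℝ≥0∞} (hφ : Measurable φ) :
    ∫⁻ z, φ (-z) ∂(stdGaussian (Vec d)) = ∫⁻ z, φ z ∂(stdGaussian (Vec d)) := by
  have h := stdGaussian_map (LinearIsometryEquiv.neg ℝ (E := Vec d))
  conv_rhs => rw [← h]
  rw [lintegral_map hφ (LinearIsometryEquiv.continuous _).measurable]
  rfl

theorem shiftDensity_add (a z : Vec d) :
    shiftDensity a (z + a) = Real.exp (‖a‖ ^ 2) * shiftDensity a z := by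
  rw [shiftDensity, shiftDensity, ← Real.exp_add, inner_add_right, real_inner_self_eq_norm_sq]
  congr 1; ring

theorem inv_shiftDensity_add (a z : Vec d) :
    (shiftDensity a (z + a))⁻¹ = shiftDensity a (-z) := by
  rw [shiftDensity, shiftDensity, ← Real.exp_neg, inner_add_right, real_inner_self_eq_norm_sq,
    inner_neg_right]
  congr 1; ring

/-- The likelihood ratio of a Gaussian and its shift is symmetric under exchange of the two. -/
theorem lintegral_shiftDensity_symm (a : Vec d) {f : ℝ → ℝ≥0∞} (hf : Measurable f) :
    ∫⁻ z, f (shiftDensity a z) ∂(stdGaussian (Vec d))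
      = ∫⁻ z, ENNReal.ofReal (shiftDensity a z) * f (shiftDensity a z)⁻¹
          ∂(stdGaussian (Vec d)) := by
  have hm := measurable_shiftDensity a
  rw [← lintegral_add_stdGaussian a (φ := fun z => f (shiftDensity a z)⁻¹)
    (hf.comp hm.inv)]
  simp_rw [inv_shiftDensity_add]
  rw [lintegral_neg_stdGaussian (φ := fun z => f (shiftDensity a z)) (hf.comp hm)]

/-- A factor `shiftDensity a` is traded for the translation `z ↦ z + a`, which scales the density by
`exp(‖a‖²)`. This drives the recursion for the mixture moments. -/
theorem lintegral_shiftDensity_mul (a : Vec d) {f : ℝ → ℝ≥0∞} (hf : Measurable f) :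
    ∫⁻ z, ENNReal.ofReal (shiftDensity a z) * f (shiftDensity a z) ∂(stdGaussian (Vec d))
      = ∫⁻ z, f (Real.exp (‖a‖ ^ 2) * shiftDensity a z) ∂(stdGaussian (Vec d)) := by
  have hm := measurable_shiftDensity a
  rw [← lintegral_add_stdGaussian a (φ := fun z => f (shiftDensity a z)) (hf.comp hm)]
  simp_rw [shiftDensity_add]

theorem lintegral_shiftDensity (a : Vec d) :
    ∫⁻ z, ENNReal.ofReal (shiftDensity a z) ∂(stdGaussian (Vec d)) = 1 := by
  have := lintegral_add_stdGaussian a (φ := fun _ => 1) measurable_const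
  simpa using this.symm

theorem lintegral_shiftDensity_pow (a : Vec d) (N : ℕ) :
    ∫⁻ z, ENNReal.ofReal (shiftDensity a z ^ N) ∂(stdGaussian (Vec d))
      = ENNReal.ofReal (Real.exp (N * (N - 1) * ‖a‖ ^ 2 / 2)) := by
  have h : ∀ z, shiftDensity a z ^ N
      = Real.exp (N * (N - 1) * ‖a‖ ^ 2 / 2) * shiftDensity ((N : ℝ) • a) z := by
    intro z
    rw [shiftDensity, shiftDensity, ← Real.exp_add, ← Real.exp_nat_mul, norm_smul,
      real_inner_smul_left]
    congr 1
    simp only [Real.norm_natCast]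
    ring
  simp_rw [h, ENNReal.ofReal_mul (Real.exp_pos _).le]
  rw [lintegral_const_mul _ (measurable_shiftDensity _).ennreal_ofReal, lintegral_shiftDensity,
    mul_one]

/-- Pointwise comparison behind the reversal of the Rényi divergence of a Gaussian mixture. -/
theorem inv_pow_add_le_pow_add {q y : ℝ} (hq : 0 ≤ q) (hq1 : q ≤ 1) (hy : 0 < y) (k : ℕ) :
    ((1 - q + q * y) ^ k)⁻¹ + y * ((1 - q + q * y⁻¹) ^ k)⁻¹
      ≤ (1 - q + q * y) ^ (k + 1) + y * (1 - q + q * y⁻¹) ^ (k + 1) := by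
  have hyi : 0 < y⁻¹ := inv_pos.2 hy
  set A := 1 - q + q * y with hA
  set B := 1 - q + q * y⁻¹ with hB
  have hA0 : 0 < A := by
    rcases eq_or_lt_of_le hq with h | h
    · rw [hA, ← h]; norm_num
    · have : 0 < q * y := by positivity
      linarith
  have hB0 : 0 < B := by
    rcases eq_or_lt_of_le hq with h | h
    · rw [hB, ← h]; norm_num
    · have : 0 < q * y⁻¹ := by positivity
      linarith
  -- This identity makes `k = 0` an equality and lets both halves of the inductive increment share
  -- the factor `A - 1`.
  have hyB : y * (1 - B) = A - 1 := by
    rw [hA, hB]; field_simp; ring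
  have hAB : 1 ≤ A * B := by
    have : A * B = 1 + q * (1 - q) * ((y - 1) ^ 2 * y⁻¹) := by
      rw [hA, hB]; field_simp; ring
    rw [this]
    have : 0 ≤ q * (1 - q) * ((y - 1) ^ 2 * y⁻¹) :=
      mul_nonneg (mul_nonneg hq (by linarith)) (by positivity)
    linarith
  induction k with
  | zero => simp; linarith
  | succ k ih =>
    set u := A ^ (k + 1) with hu
    set v := B ^ (k + 1) with hv
    have hu0 : 0 < u := by positivity
    have hv0 : 0 < v := by positivity
    have huv : 1 ≤ u * v := by
      rw [hu, hv, ← mul_pow]; exact one_le_pow₀ hAB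
    -- The second factor equals `(uv - 1)(u - v)/(uv)`, where `uv ≥ 1`. The signs of `A - 1` and `u
    -- - v` agree, both being decided by whether `y ≥ 1`.
    have key : 0 ≤ (A - 1) * (u + u⁻¹ - v - v⁻¹) := by
      have e : u + u⁻¹ - v - v⁻¹ = (u * v - 1) * (u - v) / (u * v) := by
        field_simp; ring
      have : 0 ≤ (A - 1) * (u - v) := by
        rcases le_total 1 y with h | h
        · have h1 : y⁻¹ ≤ 1 := inv_le_one_of_one_le₀ h
          have hBA : B ≤ A := by
            rw [hA, hB]; have := mul_le_mul_of_nonneg_left (h1.trans h) hq; linarith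
          have : v ≤ u := pow_le_pow_left₀ hB0.le hBA _
          apply mul_nonneg _ (by linarith)
          rw [hA]; nlinarith
        · have h1 : 1 ≤ y⁻¹ := (one_le_inv₀ hy).2 h
          have hBA : A ≤ B := by
            rw [hA, hB]; have := mul_le_mul_of_nonneg_left (h.trans h1) hq; linarith
          have : u ≤ v := pow_le_pow_left₀ hA0.le hBA _
          apply mul_nonneg_of_nonpos_of_nonpos _ (by linarith)
          rw [hA]; nlinarith
      rw [e, mul_div_assoc', mul_comm (u * v - 1), ← mul_assoc]
      exact div_nonneg (mul_nonneg this (by linarith)) (by positivity)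
    have e1 : (A ^ k)⁻¹ = A * u⁻¹ := by rw [hu, pow_succ]; field_simp
    have e2 : (B ^ k)⁻¹ = B * v⁻¹ := by rw [hv, pow_succ]; field_simp
    rw [e1, e2] at ih
    have e3 : A ^ (k + 1 + 1) = A * u := by rw [hu]; ring
    have e4 : B ^ (k + 1 + 1) = B * v := by rw [hv]; ring
    rw [e3, e4]
    have e5 : (A - 1) * (u + u⁻¹ - v - v⁻¹)
        = (A - 1) * (u + u⁻¹) - y * (1 - B) * (v + v⁻¹) := by rw [hyB]; ring
    rw [e5] at key
    linarith

/-- The mean value bound with the derivative at the right endpoint. For `N = 0` the truncated `N -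
1` is harmless because of the factor `N`. -/
theorem add_pow_le_pow_add_mul {x h : ℝ} (hx : 0 ≤ x) (hh : 0 ≤ h) (N : ℕ) :
    (x + h) ^ N ≤ x ^ N + N * h * (x + h) ^ (N - 1) := by
  induction N with
  | zero => simp
  | succ N ih =>
    have h1 : (x + h) ^ N = (x + h) * (x + h) ^ (N - 1) ∨ N = 0 := by
      rcases N with _ | N
      · right; rfl
      · left; rw [Nat.add_sub_cancel, pow_succ']
    have h2 : x ^ N ≤ (x + h) ^ N := pow_le_pow_left₀ hx (by linarith) _
    rw [Nat.add_sub_cancel]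
    push_cast
    rcases h1 with h1 | h1
    · calc (x + h) ^ (N + 1) = x * (x + h) ^ N + h * (x + h) ^ N := by ring
        _ ≤ x * (x ^ N + N * h * (x + h) ^ (N - 1)) + h * (x + h) ^ N := by gcongr
        _ = x ^ (N + 1) + N * h * (x * (x + h) ^ (N - 1)) + h * (x + h) ^ N := by ring
        _ ≤ x ^ (N + 1) + N * h * ((x + h) * (x + h) ^ (N - 1)) + h * (x + h) ^ N := by
            gcongr; linarith
        _ = _ := by rw [← h1]; ring
    · subst h1; simp

/-- Moments of the likelihood ratio of the mixture `(1 - q) N(0, I) + q N(a, I)` to `N(0, I)`. -/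
noncomputable def mixMoment (q : ℝ) (a : Vec d) (N : ℕ) : ℝ≥0∞ :=
  ∫⁻ z, ENNReal.ofReal ((1 - q + q * shiftDensity a z) ^ N) ∂(stdGaussian (Vec d))

/-! ### Growth of the mixture moments and the effect of subsampling -/

section mixMoment

variable {q : ℝ} (hq : 0 ≤ q) (hq1 : q ≤ 1) (a : Vec d)
include hq hq1

theorem mixture_pos {y : ℝ} (hy : 0 < y) : 0 < 1 - q + q * y := by
  rcases eq_or_lt_of_le hq with h | h
  · rw [← h]; norm_num
  · have : 0 < q * y := by positivity
    linarith

/-- One factor `1 - q + q y` is expanded, and its `y` is absorbed by Cameron–Martin. Successive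
moments then differ only through the scaling of `y` by `exp(‖a‖²)`, with prefactor `q`. -/
theorem mixMoment_succ (N : ℕ) :
    mixMoment q a (N + 1) = ENNReal.ofReal (1 - q) * mixMoment q a N
      + ENNReal.ofReal q * ∫⁻ z, ENNReal.ofReal
          ((1 - q + q * (Real.exp (‖a‖ ^ 2) * shiftDensity a z)) ^ N)
          ∂(stdGaussian (Vec d)) := by
  have hm := measurable_shiftDensity a
  rw [← lintegral_shiftDensity_mul a (f := fun y => ENNReal.ofReal ((1 - q + q * y) ^ N))
    (by fun_prop), mixMoment, mixMoment, ← lintegral_const_mul _ (by fun_prop),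
    ← lintegral_const_mul _ (by fun_prop), ← lintegral_add_left (by fun_prop)]
  refine lintegral_congr fun z => ?_
  have hy := shiftDensity_pos a z
  have hX := mixture_pos hq hq1 hy
  have : 0 ≤ 1 - q := by linarith
  rw [← ENNReal.ofReal_mul (by positivity), ← ENNReal.ofReal_mul (by positivity),
    ← ENNReal.ofReal_mul (by positivity), ← ENNReal.ofReal_add (by positivity) (by positivity)]
  congr 1
  ring

theorem mixMoment_le_succ (N : ℕ) : mixMoment q a N ≤ mixMoment q a (N + 1) := by
  rw [mixMoment_succ hq hq1]
  have h1 : mixMoment q a N ≤ ∫⁻ z, ENNReal.ofReal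
      ((1 - q + q * (Real.exp (‖a‖ ^ 2) * shiftDensity a z)) ^ N) ∂(stdGaussian (Vec d)) := by
    refine lintegral_mono fun z => ENNReal.ofReal_le_ofReal ?_
    have hy := shiftDensity_pos a z
    have hX := mixture_pos hq hq1 hy
    have h2 : 1 * shiftDensity a z ≤ Real.exp (‖a‖ ^ 2) * shiftDensity a z := by
      gcongr
      exact Real.one_le_exp (by positivity)
    rw [one_mul] at h2
    gcongr
  calc mixMoment q a N
      = ENNReal.ofReal (1 - q) * mixMoment q a N + ENNReal.ofReal q * mixMoment q a N := by
        rw [← add_mul, ← ENNReal.ofReal_add (by linarith) hq]; simp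
    _ ≤ _ := by gcongr

theorem lintegral_mixture_scaled_le (N : ℕ) :
    ∫⁻ z, ENNReal.ofReal ((1 - q + q * (Real.exp (‖a‖ ^ 2) * shiftDensity a z)) ^ N)
      ∂(stdGaussian (Vec d)) ≤ ENNReal.ofReal (Real.exp (N * ‖a‖ ^ 2)) * mixMoment q a N := by
  have hm := measurable_shiftDensity a
  rw [mixMoment, ← lintegral_const_mul _ (by fun_prop)]
  refine lintegral_mono fun z => ?_
  have hy := shiftDensity_pos a z
  have he : 1 ≤ Real.exp (‖a‖ ^ 2) := Real.one_le_exp (by positivity)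
  rw [← ENNReal.ofReal_mul (by positivity)]
  apply ENNReal.ofReal_le_ofReal
  rw [Real.exp_nat_mul, ← mul_pow]
  have : 0 ≤ 1 - q := by linarith
  have h3 : 0 < 1 - q + q * (Real.exp (‖a‖ ^ 2) * shiftDensity a z) :=
    mixture_pos hq hq1 (by positivity)
  gcongr
  nlinarith

/-- The gain from subsampling is the factor `q²`: one `q` comes from expanding a factor of the
power, the other because scaling `y` changes `1 - q + q y` by only `q (E - 1) y`. -/
theorem mixMoment_succ_le (N : ℕ) :
    mixMoment q a (N + 1) ≤ (1 + ENNReal.ofReal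
      (N * q ^ 2 * (Real.exp (‖a‖ ^ 2) - 1) * Real.exp (2 * N * ‖a‖ ^ 2))) * mixMoment q a N := by
  have hm := measurable_shiftDensity a
  have he : 1 ≤ Real.exp (‖a‖ ^ 2) := Real.one_le_exp (by positivity)
  set E := Real.exp (‖a‖ ^ 2) with hE
  -- The case `N = 0` is separate because the mean value bound below uses the power `N - 1`; there
  -- the moments of orders `1` and `0` coincide.
  rcases N with _ | N
  · have : mixMoment q a (0 + 1) = mixMoment q a 0 := by
      rw [mixMoment_succ hq hq1]
      simp only [mixMoment, pow_zero, ← add_mul]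
      rw [← ENNReal.ofReal_add (by linarith) hq]; simp
    rw [this]; simp
  rw [mixMoment_succ hq hq1]
  have h1 : ∫⁻ z, ENNReal.ofReal ((1 - q + q * (E * shiftDensity a z)) ^ (N + 1))
      ∂(stdGaussian (Vec d)) ≤ mixMoment q a (N + 1) + ENNReal.ofReal ((N + 1) * (q * (E - 1))) *
        ∫⁻ z, ENNReal.ofReal (shiftDensity a z) *
          ENNReal.ofReal ((1 - q + q * (E * shiftDensity a z)) ^ N) ∂(stdGaussian (Vec d)) := by
    rw [mixMoment, ← lintegral_const_mul _ (by fun_prop), ← lintegral_add_left (by fun_prop)]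
    refine lintegral_mono fun z => ?_
    have hy := shiftDensity_pos a z
    have hX := mixture_pos hq hq1 hy
    have hX' : 0 < 1 - q + q * (E * shiftDensity a z) := mixture_pos hq hq1 (by positivity)
    have hE1 : 0 ≤ E - 1 := by linarith
    rw [← ENNReal.ofReal_mul hy.le, ← ENNReal.ofReal_mul (by positivity),
      ← ENNReal.ofReal_add (by positivity) (by positivity)]
    apply ENNReal.ofReal_le_ofReal
    have := add_pow_le_pow_add_mul hX.le (h := q * (E - 1) * shiftDensity a z) (by positivity)
      (N + 1)
    rw [show 1 - q + q * shiftDensity a z + q * (E - 1) * shiftDensity a z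
      = 1 - q + q * (E * shiftDensity a z) by ring, Nat.add_sub_cancel] at this
    push_cast at this
    refine this.trans (le_of_eq ?_)
    ring
  -- The scaled mixture is at most `E` times the unscaled one. This is used twice, before and after
  -- Cameron–Martin removes the factor `y`, and produces the factor `2` in the exponent.
  have h2 : ∫⁻ z, ENNReal.ofReal (shiftDensity a z) *
      ENNReal.ofReal ((1 - q + q * (E * shiftDensity a z)) ^ N) ∂(stdGaussian (Vec d))
      ≤ ENNReal.ofReal (Real.exp (2 * (N + 1 : ℕ) * ‖a‖ ^ 2)) * mixMoment q a (N + 1) := by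
    calc _ ≤ ∫⁻ z, ENNReal.ofReal (E ^ N) * (ENNReal.ofReal (shiftDensity a z) *
          ENNReal.ofReal ((1 - q + q * shiftDensity a z) ^ N)) ∂(stdGaussian (Vec d)) := by
          refine lintegral_mono fun z => ?_
          have hy := shiftDensity_pos a z
          have hX := mixture_pos hq hq1 hy
          have hX' : 0 < 1 - q + q * (E * shiftDensity a z) := mixture_pos hq hq1 (by positivity)
          rw [← ENNReal.ofReal_mul hy.le, ← ENNReal.ofReal_mul hy.le,
            ← ENNReal.ofReal_mul (by positivity)]
          apply ENNReal.ofReal_le_ofReal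
          rw [mul_left_comm (E ^ N), ← mul_pow E]
          have : 0 ≤ 1 - q := by linarith
          gcongr
          nlinarith
      _ = ENNReal.ofReal (E ^ N) * ∫⁻ z, ENNReal.ofReal ((1 - q + q * (E * shiftDensity a z)) ^ N)
          ∂(stdGaussian (Vec d)) := by
          rw [lintegral_const_mul _ (by fun_prop), lintegral_shiftDensity_mul a
            (f := fun y => ENNReal.ofReal ((1 - q + q * y) ^ N)) (by fun_prop)]
      _ ≤ ENNReal.ofReal (E ^ N) * (ENNReal.ofReal (Real.exp (N * ‖a‖ ^ 2)) *
          mixMoment q a N) := by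
          gcongr
          exact lintegral_mixture_scaled_le hq hq1 a N
      _ ≤ _ := by
          rw [← mul_assoc, ← ENNReal.ofReal_mul (by positivity), hE, ← Real.exp_nat_mul,
            ← Real.exp_add]
          gcongr
          · push_cast
            nlinarith [sq_nonneg ‖a‖]
          · exact mixMoment_le_succ hq hq1 a N
  calc ENNReal.ofReal (1 - q) * mixMoment q a (N + 1) + ENNReal.ofReal q * _
      ≤ ENNReal.ofReal (1 - q) * mixMoment q a (N + 1) + ENNReal.ofReal q *
        (mixMoment q a (N + 1) + ENNReal.ofReal ((N + 1) * (q * (E - 1))) *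
        (ENNReal.ofReal (Real.exp (2 * (N + 1 : ℕ) * ‖a‖ ^ 2)) * mixMoment q a (N + 1))) := by
        gcongr
        exact h1.trans (by gcongr)
    _ = (ENNReal.ofReal (1 - q) + ENNReal.ofReal q) * mixMoment q a (N + 1) + ENNReal.ofReal q *
        (ENNReal.ofReal ((N + 1) * (q * (E - 1))) *
        ENNReal.ofReal (Real.exp (2 * (N + 1 : ℕ) * ‖a‖ ^ 2))) * mixMoment q a (N + 1) := by ring
    _ = _ := by
        have hE1 : 0 ≤ E - 1 := by linarith
        have key : ENNReal.ofReal q * (ENNReal.ofReal ((N + 1) * (q * (E - 1))) *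
            ENNReal.ofReal (Real.exp (2 * (N + 1 : ℕ) * ‖a‖ ^ 2))) = ENNReal.ofReal
            ((N + 1 : ℕ) * q ^ 2 * (E - 1) * Real.exp (2 * (N + 1 : ℕ) * ‖a‖ ^ 2)) := by
          rw [← ENNReal.ofReal_mul (by positivity), ← ENNReal.ofReal_mul hq]
          congr 1
          push_cast
          ring
        rw [key, ← ENNReal.ofReal_add (by linarith) hq, ← add_mul, sub_add_cancel,
          ENNReal.ofReal_one]

/-- `N` is a fixed horizon and the induction runs over `k ≤ N`. With `N‖a‖² ≤ 1`, each step costs a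
factor at most `1 + 15 N q² ‖a‖²`, where `15 = 2 · 7.5` comes from `e^x - 1 ≤ 2x` on `[0, 1]` and
`e² ≤ 7.5`. -/
theorem mixMoment_le_exp {N : ℕ} (hN : N * ‖a‖ ^ 2 ≤ 1) (k : ℕ) (hk : k ≤ N) :
    mixMoment q a k ≤ ENNReal.ofReal (Real.exp (15 * (k * N * (q ^ 2 * ‖a‖ ^ 2)))) := by
  induction k with
  | zero => simp [mixMoment]
  | succ k ih =>
    have hkN : (k : ℝ) + 1 ≤ N := by exact_mod_cast hk
    have ha0 : 0 ≤ ‖a‖ ^ 2 := sq_nonneg _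
    have ha1 : ‖a‖ ^ 2 ≤ 1 := by nlinarith [(Nat.cast_nonneg k : (0 : ℝ) ≤ k)]
    have hka : 2 * k * ‖a‖ ^ 2 ≤ 2 := by nlinarith
    have he : Real.exp (‖a‖ ^ 2) - 1 ≤ 2 * ‖a‖ ^ 2 := by
      have := Real.abs_exp_sub_one_le (x := ‖a‖ ^ 2) (by rw [abs_of_nonneg ha0]; exact ha1)
      rw [abs_of_nonneg ha0] at this
      exact (le_abs_self _).trans this
    have he0 : 0 ≤ Real.exp (‖a‖ ^ 2) - 1 := by linarith [Real.one_le_exp ha0]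
    have he2 : Real.exp (2 * k * ‖a‖ ^ 2) ≤ 7.5 := by
      refine (Real.exp_le_exp.2 hka).trans ?_
      have h1 := Real.exp_one_lt_d9
      have h2 : Real.exp 2 = Real.exp 1 * Real.exp 1 := by rw [← Real.exp_add]; norm_num
      rw [h2]
      nlinarith [Real.exp_pos 1]
    have hr : k * q ^ 2 * (Real.exp (‖a‖ ^ 2) - 1) * Real.exp (2 * k * ‖a‖ ^ 2)
        ≤ 15 * (N * (q ^ 2 * ‖a‖ ^ 2)) := by
      calc _ ≤ N * q ^ 2 * (2 * ‖a‖ ^ 2) * 7.5 := by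
            gcongr
            linarith
        _ = _ := by ring
    calc mixMoment q a (k + 1) ≤ _ := mixMoment_succ_le hq hq1 a k
      _ ≤ ENNReal.ofReal (Real.exp (15 * (N * (q ^ 2 * ‖a‖ ^ 2)))) *
          ENNReal.ofReal (Real.exp (15 * (k * N * (q ^ 2 * ‖a‖ ^ 2)))) := by
          gcongr
          · rw [← ENNReal.ofReal_one, ← ENNReal.ofReal_add zero_le_one (by positivity)]
            apply ENNReal.ofReal_le_ofReal
            have := Real.add_one_le_exp (15 * (N * (q ^ 2 * ‖a‖ ^ 2)))
            linarith
          · exact ih (by omega)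
      _ = _ := by
          rw [← ENNReal.ofReal_mul (Real.exp_pos _).le, ← Real.exp_add]
          congr 2
          push_cast
          ring

/-- Each side is averaged with its image under the exchange symmetry of the likelihood ratio; the
symmetrized integrands then compare pointwise by `inv_pow_add_le_pow_add`. The reverse comparison
therefore needs no new moment estimate. -/
theorem lintegral_inv_mixture_pow_le (k : ℕ) :
    ∫⁻ z, ENNReal.ofReal (((1 - q + q * shiftDensity a z) ^ k)⁻¹) ∂(stdGaussian (Vec d))
      ≤ mixMoment q a (k + 1) := by
  have hm := measurable_shiftDensity a
  have h1 := lintegral_shiftDensity_symm a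
    (f := fun y => ENNReal.ofReal (((1 - q + q * y) ^ k)⁻¹)) (by fun_prop)
  have h2 := lintegral_shiftDensity_symm a
    (f := fun y => ENNReal.ofReal ((1 - q + q * y) ^ (k + 1))) (by fun_prop)
  have h3 : ∫⁻ z, ENNReal.ofReal (((1 - q + q * shiftDensity a z) ^ k)⁻¹) ∂(stdGaussian (Vec d))
      + ∫⁻ z, ENNReal.ofReal (((1 - q + q * shiftDensity a z) ^ k)⁻¹) ∂(stdGaussian (Vec d))
      ≤ mixMoment q a (k + 1) + mixMoment q a (k + 1) := by
    conv_lhs => arg 2; rw [h1]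
    conv_rhs => arg 2; rw [mixMoment, h2]
    rw [mixMoment, ← lintegral_add_left (by fun_prop), ← lintegral_add_left (by fun_prop)]
    refine lintegral_mono fun z => ?_
    have hy := shiftDensity_pos a z
    have hX := mixture_pos hq hq1 hy
    have hX' := mixture_pos hq hq1 (inv_pos.2 hy)
    rw [← ENNReal.ofReal_mul hy.le, ← ENNReal.ofReal_mul hy.le,
      ← ENNReal.ofReal_add (by positivity) (by positivity),
      ← ENNReal.ofReal_add (by positivity) (by positivity)]
    exact ENNReal.ofReal_le_ofReal (inv_pow_add_le_pow_add hq hq1 hy k)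
  rw [← two_mul, ← two_mul] at h3
  exact (ENNReal.mul_le_mul_iff_right (by norm_num) (by norm_num)).1 h3

end mixMoment

end Gaussian

/-! ### Domination between Gaussian mixtures -/

section Density

variable {α : Type*} [MeasurableSpace α] {r N : ℝ} {ν : Measure α} {g : α → ℝ≥0∞}

theorem momentDom_withDensity (hr : r.HolderConjugate N) (hg : Measurable g) {K : ℝ≥0∞}
    (hK : ∫⁻ x, g x ^ N ∂ν ≤ K) : MomentDom r (K ^ (1 / N)) (ν.withDensity g) ν := by
  intro φ hφ
  rw [lintegral_withDensity_eq_lintegral_mul _ hg hφ, mul_comm g φ, mul_comm (K ^ _)]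
  refine (ENNReal.lintegral_mul_le_Lp_mul_Lq ν hr hφ.aemeasurable hg.aemeasurable).trans ?_
  have := hr.symm.nonneg
  gcongr

/-- Hölder after inserting `g ^ (1 / r)` and its inverse: the first joins `φ` to form the integral
against `ν.withDensity g`, and the second is raised to `N / r = N - 1`. -/
theorem momentDom_of_withDensity (hr : r.HolderConjugate N) (hg : Measurable g)
    (hg0 : ∀ x, g x ≠ 0) (hgt : ∀ x, g x ≠ ∞) {K : ℝ≥0∞}
    (hK : ∫⁻ x, (g x)⁻¹ ^ (N - 1) ∂ν ≤ K) : MomentDom r (K ^ (1 / N)) ν (ν.withDensity g) := by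
  intro φ hφ
  have hr0 := hr.pos
  have hN0 := hr.symm.pos
  have h1 : ∀ x, φ x = (φ x * g x ^ (1 / r)) * (g x)⁻¹ ^ (1 / r) := by
    intro x
    rw [mul_assoc, ← ENNReal.mul_rpow_of_nonneg _ _ (by positivity),
      ENNReal.mul_inv_cancel (hg0 x) (hgt x), ENNReal.one_rpow, mul_one]
  have hmeas : Measurable fun x => φ x * g x ^ (1 / r) := hφ.mul (hg.pow_const _)
  have hmeas' : Measurable fun x => (g x)⁻¹ ^ (1 / r) := hg.inv.pow_const _
  calc ∫⁻ x, φ x ∂ν = ∫⁻ x, (φ x * g x ^ (1 / r)) * (g x)⁻¹ ^ (1 / r) ∂ν :=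
        lintegral_congr h1
    _ ≤ (∫⁻ x, (φ x * g x ^ (1 / r)) ^ r ∂ν) ^ (1 / r) *
          (∫⁻ x, ((g x)⁻¹ ^ (1 / r)) ^ N ∂ν) ^ (1 / N) :=
        ENNReal.lintegral_mul_le_Lp_mul_Lq ν hr hmeas.aemeasurable hmeas'.aemeasurable
    _ ≤ (∫⁻ x, φ x ^ r ∂ν.withDensity g) ^ (1 / r) * K ^ (1 / N) := by
        rw [lintegral_withDensity_eq_lintegral_mul _ hg (hφ.pow_const r)]
        gcongr with x
        · rw [ENNReal.mul_rpow_of_nonneg _ _ hr0.le, ← ENNReal.rpow_mul,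
            one_div_mul_cancel hr0.ne', ENNReal.rpow_one, Pi.mul_apply, mul_comm]
        · refine le_trans (le_of_eq (lintegral_congr fun x => ?_)) hK
          rw [← ENNReal.rpow_mul]
          congr 1
          have := hr.symm.sub_one_mul_conj
          field_simp
          linarith
    _ = _ := mul_comm _ _

end Density

theorem lintegral_coin {q : ℝ} (hq : 0 ≤ q) (hq1 : q ≤ 1) (f : Bool → ℝ≥0∞) :
    ∫⁻ B, f B ∂(coin q) = ENNReal.ofReal q * f true + ENNReal.ofReal (1 - q) * f false := by
  have h : Set.projIcc (0 : ℝ) 1 zero_le_one q = ⟨q, hq, hq1⟩ := Set.projIcc_of_mem _ ⟨hq, hq1⟩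
  rw [coin, h, bernoulliMeasure_def]
  rw [lintegral_add_measure, lintegral_smul_measure, lintegral_smul_measure, lintegral_dirac,
    lintegral_dirac]
  have h2 : ∀ (p : unitInterval) (y : ℝ≥0∞), unitInterval.toNNReal p • y
      = ENNReal.ofReal p * y := by
    intro p y
    rw [ENNReal.ofReal, Real.toNNReal_of_nonneg p.2.1]
    rfl
  rw [h2, h2, unitInterval.coe_symm_eq]

instance (q : ℝ) : IsProbabilityMeasure (coin q) := by unfold coin; infer_instance

instance (d : ℕ) (v : ℝ) : IsProbabilityMeasure (gaussianNoise d v) :=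
  Measure.isProbabilityMeasure_map (by fun_prop)

instance (m : ℕ) (b : ℝ) : IsProbabilityMeasure (minibatchLaw m b) := by
  unfold minibatchLaw; infer_instance

/-- The law of `c + B a + ξ` with a coin `B` of bias `q` and an independent Gaussian `ξ`. -/
noncomputable def mixtureLaw {d : ℕ} (q v : ℝ) (c a : Vec d) : Measure (Vec d) :=
  ((coin q).prod (gaussianNoise d v)).map fun r => c + (if r.1 then a else 0) + r.2

section Mixture

variable {d : ℕ} {q v : ℝ}

theorem measurable_mixture_map (c a : Vec d) :
    Measurable fun r : Bool × Vec d => c + (if r.1 then a else 0) + r.2 := by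
  have : Measurable fun b : Bool => if b then a else 0 := measurable_of_finite _
  exact (measurable_const.add (this.comp measurable_fst)).add measurable_snd

/-- Recentring by `c` and rescaling by `√v` moves the mixture to a density against the standard
Gaussian, so the comparisons can be made there and pushed forward. -/
theorem mixtureLaw_eq (hq : 0 ≤ q) (hq1 : q ≤ 1) (hv : 0 < v) (c a : Vec d) :
    mixtureLaw q v c a = ((stdGaussian (Vec d)).withDensity fun z =>
      ENNReal.ofReal (1 - q + q * shiftDensity ((√v)⁻¹ • a) z)).map fun z => c + √v • z := by
  have hs : √v ≠ 0 := (Real.sqrt_pos.2 hv).ne'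
  have hm := measurable_shiftDensity ((√v)⁻¹ • a)
  refine Measure.ext_of_lintegral _ fun φ hφ => ?_
  have hφ' : Measurable fun r : Bool × Vec d => φ (c + (if r.1 then a else 0) + r.2) :=
    hφ.comp (measurable_mixture_map c a)
  rw [mixtureLaw, lintegral_map hφ (measurable_mixture_map c a),
    lintegral_prod _ hφ'.aemeasurable, lintegral_coin hq hq1, lintegral_map hφ (by fun_prop),
    lintegral_withDensity_eq_lintegral_mul _ (by fun_prop) (by fun_prop)]
  simp only [if_true, Bool.false_eq_true, if_false, add_zero, gaussianNoise]
  rw [lintegral_map (by fun_prop) (by fun_prop), lintegral_map (by fun_prop) (by fun_prop)]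
  have h1 : ∫⁻ z, φ (c + a + √v • z) ∂(stdGaussian (Vec d))
      = ∫⁻ z, ENNReal.ofReal (shiftDensity ((√v)⁻¹ • a) z) * φ (c + √v • z)
        ∂(stdGaussian (Vec d)) := by
    rw [← lintegral_add_stdGaussian _ (φ := fun z => φ (c + √v • z)) (by fun_prop)]
    refine lintegral_congr fun z => ?_
    rw [smul_add, smul_smul, mul_inv_cancel₀ hs, one_smul]
    congr 1
    abel
  rw [h1, ← lintegral_const_mul _ (by fun_prop), ← lintegral_const_mul _ (by fun_prop),
    ← lintegral_add_left (by fun_prop)]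
  refine lintegral_congr fun z => ?_
  have hy := shiftDensity_pos ((√v)⁻¹ • a) z
  have : 0 ≤ 1 - q := by linarith
  rw [Pi.mul_apply, ENNReal.ofReal_add this (by positivity), ENNReal.ofReal_mul hq]
  ring

theorem gaussian_shift_eq (hv : 0 < v) (c c' : Vec d) :
    (stdGaussian (Vec d)).map (fun z => c + √v • z)
      = ((stdGaussian (Vec d)).withDensity fun z =>
          ENNReal.ofReal (shiftDensity ((√v)⁻¹ • (c - c')) z)).map fun z => c' + √v • z := by
  have hs : √v ≠ 0 := (Real.sqrt_pos.2 hv).ne'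
  rw [← map_add_stdGaussian, Measure.map_map (by fun_prop) (by fun_prop)]
  congr 1
  ext1 z
  simp only [Function.comp_apply, smul_add, smul_smul, mul_inv_cancel₀ hs, one_smul]
  abel

theorem ofReal_exp_rpow (x y : ℝ) :
    ENNReal.ofReal (Real.exp x) ^ y = ENNReal.ofReal (Real.exp (x * y)) := by
  rw [ENNReal.ofReal_rpow_of_pos (Real.exp_pos _), Real.exp_mul]

theorem norm_inv_sqrt_smul_sq (hv : 0 < v) (a : Vec d) :
    ‖(√v)⁻¹ • a‖ ^ 2 = ‖a‖ ^ 2 / v := by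
  rw [norm_smul, mul_pow, norm_inv, Real.norm_of_nonneg (Real.sqrt_nonneg v), inv_pow,
    Real.sq_sqrt hv.le]
  field_simp

variable {N : ℕ} {r : ℝ}

theorem mixtureLaw_dom_gaussian (hq : 0 ≤ q) (hq1 : q ≤ 1) (hv : 0 < v)
    (hr : r.HolderConjugate N) (c a : Vec d) (hN : N * (‖a‖ ^ 2 / v) ≤ 1) :
    MomentDom r (ENNReal.ofReal (Real.exp (15 * (N * (q ^ 2 * (‖a‖ ^ 2 / v))))))
      (mixtureLaw q v c a) ((stdGaussian (Vec d)).map fun z => c + √v • z) := by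
  have hN0 : (0 : ℝ) < N := hr.symm.pos
  have hm := measurable_shiftDensity ((√v)⁻¹ • a)
  rw [mixtureLaw_eq hq hq1 hv, ← norm_inv_sqrt_smul_sq hv]
  rw [← norm_inv_sqrt_smul_sq hv] at hN
  refine MomentDom.map ?_ (by fun_prop)
  have h := momentDom_withDensity (ν := stdGaussian (Vec d)) hr
    (g := fun z => ENNReal.ofReal (1 - q + q * shiftDensity ((√v)⁻¹ • a) z)) (by fun_prop)
    (K := mixMoment q ((√v)⁻¹ • a) N) (le_of_eq (lintegral_congr fun z => by
      rw [ENNReal.rpow_natCast, ← ENNReal.ofReal_pow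
        (mixture_pos hq hq1 (shiftDensity_pos _ z)).le]))
  refine h.mono ?_
  calc _ ≤ _ := ENNReal.rpow_le_rpow (mixMoment_le_exp hq hq1 _ hN N le_rfl) (by positivity)
    _ = _ := by
      rw [ofReal_exp_rpow]
      congr 2
      field_simp

theorem gaussian_dom_mixtureLaw (hq : 0 ≤ q) (hq1 : q ≤ 1) (hv : 0 < v)
    (hr : r.HolderConjugate N) (c a : Vec d) (hN : N * (‖a‖ ^ 2 / v) ≤ 1) :
    MomentDom r (ENNReal.ofReal (Real.exp (15 * (N * (q ^ 2 * (‖a‖ ^ 2 / v))))))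
      ((stdGaussian (Vec d)).map fun z => c + √v • z) (mixtureLaw q v c a) := by
  have hN0 : (0 : ℝ) < N := hr.symm.pos
  have hm := measurable_shiftDensity ((√v)⁻¹ • a)
  rw [mixtureLaw_eq hq hq1 hv, ← norm_inv_sqrt_smul_sq hv]
  rw [← norm_inv_sqrt_smul_sq hv] at hN
  refine MomentDom.map ?_ (by fun_prop)
  have hN1 : 1 ≤ N := by exact_mod_cast hN0
  have h := momentDom_of_withDensity (ν := stdGaussian (Vec d)) hr
    (g := fun z => ENNReal.ofReal (1 - q + q * shiftDensity ((√v)⁻¹ • a) z)) (by fun_prop)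
    (fun z => by
      rw [Ne, ENNReal.ofReal_eq_zero, not_le]
      exact mixture_pos hq hq1 (shiftDensity_pos _ z))
    (fun z => ENNReal.ofReal_ne_top)
    (K := mixMoment q ((√v)⁻¹ • a) (N - 1 + 1)) (by
      refine le_trans (le_of_eq (lintegral_congr fun z => ?_))
        (lintegral_inv_mixture_pow_le hq hq1 _ (N - 1))
      have hX := mixture_pos hq hq1 (shiftDensity_pos ((√v)⁻¹ • a) z)
      rw [show (N : ℝ) - 1 = ((N - 1 : ℕ) : ℝ) by rw [Nat.cast_sub hN1]; simp,
        ENNReal.rpow_natCast, ← ENNReal.ofReal_inv_of_pos hX,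
        ← ENNReal.ofReal_pow (inv_pos.2 hX).le, inv_pow])
  rw [Nat.sub_add_cancel hN1] at h
  refine h.mono ?_
  calc _ ≤ _ := ENNReal.rpow_le_rpow (mixMoment_le_exp hq hq1 _ hN N le_rfl) (by positivity)
    _ = _ := by
      rw [ofReal_exp_rpow]
      congr 2
      field_simp

theorem gaussian_dom_gaussian (hv : 0 < v) (hr : r.HolderConjugate N) (c c' : Vec d) :
    MomentDom r (ENNReal.ofReal (Real.exp (N * (‖c - c'‖ ^ 2 / v) / 2)))
      ((stdGaussian (Vec d)).map fun z => c + √v • z)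
      ((stdGaussian (Vec d)).map fun z => c' + √v • z) := by
  have hN0 : (0 : ℝ) < N := hr.symm.pos
  have hm := measurable_shiftDensity ((√v)⁻¹ • (c - c'))
  rw [gaussian_shift_eq hv c c', ← norm_inv_sqrt_smul_sq hv]
  refine MomentDom.map ?_ (by fun_prop)
  have h := momentDom_withDensity (ν := stdGaussian (Vec d)) hr
    (g := fun z => ENNReal.ofReal (shiftDensity ((√v)⁻¹ • (c - c')) z)) (by fun_prop)
    (le_of_eq ((lintegral_congr fun z => by
      rw [ENNReal.rpow_natCast, ← ENNReal.ofReal_pow (shiftDensity_pos _ z).le]).trans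
      (lintegral_shiftDensity_pow _ N)))
  refine h.mono ?_
  rw [ofReal_exp_rpow]
  apply ENNReal.ofReal_le_ofReal
  rw [Real.exp_le_exp]
  have h2 : (N : ℝ) * (N - 1) * ‖(√v)⁻¹ • (c - c')‖ ^ 2 / 2 * (1 / N)
      = (N - 1) * ‖(√v)⁻¹ • (c - c')‖ ^ 2 / 2 := by field_simp
  rw [h2]
  gcongr
  linarith

/-- The chain mixture, Gaussian at `c`, Gaussian at `c'`, mixture. The two mixture steps contribute
`15 + 15` and the Gaussian shift `1/2`; the powers `1 / r ≤ 1` that chaining puts on the later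
constants are discarded. -/
theorem mixtureLaw_dom {u w : ℝ} (hq : 0 ≤ q) (hq1 : q ≤ 1) (hv : 0 < v)
    (hr : r.HolderConjugate N) {c c' a a' : Vec d} (ha : ‖a‖ ≤ u) (ha' : ‖a'‖ ≤ u)
    (hc : ‖c - c'‖ ≤ w) (hN : N * (u ^ 2 / v) ≤ 1) :
    MomentDom (r * (r * r))
      (ENNReal.ofReal (Real.exp (N * (30 * (q ^ 2 * (u ^ 2 / v)) + w ^ 2 / v / 2))))
      (mixtureLaw q v c a) (mixtureLaw q v c' a') := by
  have hN0 : (0 : ℝ) < N := hr.symm.pos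
  have hr1 : 1 ≤ r := hr.lt.le
  have hle : ∀ x : Vec d, ‖x‖ ≤ u → ‖x‖ ^ 2 / v ≤ u ^ 2 / v := fun x hx => by gcongr
  have hX : ∀ x : Vec d, ‖x‖ ≤ u → N * (‖x‖ ^ 2 / v) ≤ 1 := fun x hx =>
    (mul_le_mul_of_nonneg_left (hle x hx) hN0.le).trans hN
  have h1 := mixtureLaw_dom_gaussian hq hq1 hv hr c a (hX a ha)
  have h2 := gaussian_dom_gaussian hv hr c c'
  have h3 := gaussian_dom_mixtureLaw hq hq1 hv hr c' a' (hX a' ha')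
  refine (h1.trans (by linarith) (by nlinarith) (h2.trans (by linarith) (by linarith) h3)).mono ?_
  rw [ofReal_exp_rpow, ← ENNReal.ofReal_mul (Real.exp_pos _).le, ← Real.exp_add, ofReal_exp_rpow,
    ← ENNReal.ofReal_mul (Real.exp_pos _).le, ← Real.exp_add]
  apply ENNReal.ofReal_le_ofReal
  rw [Real.exp_le_exp]
  have hri : 1 / r ≤ 1 := (div_le_one (by linarith)).2 hr1
  have hs : ∀ x : ℝ, 0 ≤ x → x * (1 / r) ≤ x := fun x hx => mul_le_of_le_one_right hx hri
  have hc2 : ‖c - c'‖ ^ 2 / v ≤ w ^ 2 / v := by gcongr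
  have e1 : 15 * (N * (q ^ 2 * (‖a‖ ^ 2 / v))) ≤ 15 * (N * (q ^ 2 * (u ^ 2 / v))) := by
    gcongr
  have e2 : N * (‖c - c'‖ ^ 2 / v) / 2 ≤ N * (w ^ 2 / v) / 2 := by gcongr
  have e3 : 15 * (N * (q ^ 2 * (‖a'‖ ^ 2 / v))) ≤ 15 * (N * (q ^ 2 * (u ^ 2 / v))) := by
    gcongr
  have e4 := hs (15 * (N * (q ^ 2 * (‖a'‖ ^ 2 / v)))) (by positivity)
  have e5 := hs (N * (‖c - c'‖ ^ 2 / v) / 2 + 15 * (N * (q ^ 2 * (‖a'‖ ^ 2 / v))) * (1 / r))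
    (by positivity)
  have e6 : N * (30 * (q ^ 2 * (u ^ 2 / v)) + w ^ 2 / v / 2)
    = 15 * (N * (q ^ 2 * (u ^ 2 / v))) + N * (w ^ 2 / v) / 2 + 15 * (N * (q ^ 2 * (u ^ 2 / v))) := by
    ring
  rw [e6]
  linarith

end Mixture

/-! ### Measurability of the laws of the algorithm -/

/-- Rectangles form a generating π-system, and on a rectangle the product measure is a finite
product of measurable functions. -/
theorem measurable_pi_measure {α ι γ : Type*} [MeasurableSpace α] [Fintype ι] [MeasurableSpace γ]
    {μ : α → ι → Measure γ} [∀ a i, IsProbabilityMeasure (μ a i)]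
    (hμ : ∀ i, Measurable fun a => μ a i) : Measurable fun a => Measure.pi (μ a) := by
  refine Measurable.measure_of_isPiSystem_of_isProbabilityMeasure generateFrom_pi.symm
    isPiSystem_pi ?_
  rintro _ ⟨s, hs, rfl⟩
  simp_rw [Measure.pi_pi]
  exact Finset.measurable_fun_prod _ fun i _ =>
    (Measure.measurable_coe (hs i (Set.mem_univ i))).comp (hμ i)

theorem measurable_prod_measure {α β γ : Type*} [MeasurableSpace α] [MeasurableSpace β]
    [MeasurableSpace γ] {μ : α → Measure β} [∀ a, IsProbabilityMeasure (μ a)] (hμ : Measurable μ)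
    (ν : Measure γ) [IsProbabilityMeasure ν] : Measurable fun a => (μ a).prod ν := by
  refine Measurable.measure_of_isPiSystem_of_isProbabilityMeasure generateFrom_prod.symm
    isPiSystem_prod ?_
  rintro _ ⟨s, hs, t, ht, rfl⟩
  simp_rw [Measure.prod_prod]
  exact ((Measure.measurable_coe hs).comp hμ).mul_const _

section Laws

variable {n m d : ℕ} {𝒟 : Type*} {loss : 𝒟 → Vec d → ℝ}

theorem gradient_localLoss (hdiff : ∀ z, Differentiable ℝ (loss z)) (A : Fin m → 𝒟) (x : Vec d) :
    gradient (localLoss loss A) x = (1 / (m : ℝ)) • ∑ j, gradient (loss (A j)) x := by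
  apply HasGradientAt.gradient
  rw [hasGradientAt_iff_hasFDerivAt]
  have h : ∀ j, HasFDerivAt (loss (A j)) (InnerProductSpace.toDual ℝ _ (gradient (loss (A j)) x)) x :=
    fun j => ((hdiff (A j)) x).hasGradientAt.hasFDerivAt
  have h2 := (HasFDerivAt.fun_sum (u := Finset.univ) fun j _ => h j).const_mul (1 / (m : ℝ))
  simp only [map_smul, map_sum]
  exact h2

theorem gradient_globalLoss (hdiff : ∀ z, Differentiable ℝ (loss z)) (D : Fin n → Fin m → 𝒟)
    (x : Vec d) :
    gradient (globalLoss loss D) x = (1 / (n : ℝ)) • ∑ i, gradient (localLoss loss (D i)) x := by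
  apply HasGradientAt.gradient
  rw [hasGradientAt_iff_hasFDerivAt]
  have hd : ∀ i, Differentiable ℝ (localLoss loss (D i)) := fun i => by
    unfold localLoss
    exact (Differentiable.fun_sum fun j _ => hdiff _).const_mul _
  have h : ∀ i, HasFDerivAt (localLoss loss (D i))
      (InnerProductSpace.toDual ℝ _ (gradient (localLoss loss (D i)) x)) x :=
    fun i => (hd i x).hasGradientAt.hasFDerivAt
  have h2 := (HasFDerivAt.fun_sum (u := Finset.univ) fun i _ => h i).const_mul (1 / (n : ℝ))
  simp only [map_smul, map_sum]
  exact h2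

theorem continuous_gradient_of_lipschitz {L : ℝ}
    (hL : ∀ z x y, ‖gradient (loss z) x - gradient (loss z) y‖ ≤ L * ‖x - y‖) (z : 𝒟) :
    Continuous (gradient (loss z)) :=
  (LipschitzWith.of_dist_le_mul (K := L.toNNReal) fun x y => by
    rw [dist_eq_norm, dist_eq_norm]
    exact (hL z x y).trans (by gcongr; exact Real.le_coe_toNNReal L)).continuous

variable (hdiff : ∀ z, Differentiable ℝ (loss z)) (hcont : ∀ z, Continuous (gradient (loss z)))
include hdiff hcont

theorem continuous_gradient_localLoss (A : Fin m → 𝒟) :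
    Continuous (gradient (localLoss loss A)) := by
  have : gradient (localLoss loss A) = fun x => (1 / (m : ℝ)) • ∑ j, gradient (loss (A j)) x :=
    funext fun x => gradient_localLoss hdiff A x
  rw [this]
  exact (continuous_finsetSum _ fun j _ => hcont _).const_smul (1 / (m : ℝ))

theorem continuous_gradient_globalLoss (D : Fin n → Fin m → 𝒟) :
    Continuous (gradient (globalLoss loss D)) := by
  have : gradient (globalLoss loss D)
      = fun x => (1 / (n : ℝ)) • ∑ i, gradient (localLoss loss (D i)) x :=
    funext fun x => gradient_globalLoss hdiff D x
  rw [this]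
  exact (continuous_finsetSum _ fun j _ =>
    continuous_gradient_localLoss hdiff hcont _).const_smul (1 / (n : ℝ))

theorem measurable_svrgEstimator {α : Type*} [MeasurableSpace α] (b : ℝ) (A : Fin m → 𝒟)
    {x w : α → Vec d} {I : α → Fin m → Bool} (hx : Measurable x) (hw : Measurable w)
    (hI : Measurable I) : Measurable fun a => svrgEstimator loss b A (x a) (w a) (I a) := by
  unfold svrgEstimator
  have h1 := (continuous_gradient_localLoss hdiff hcont A).measurable.comp hw
  refine Measurable.add (Measurable.fun_const_smul ?_ _) h1
  refine Finset.measurable_fun_sum _ fun j _ => ?_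
  refine Measurable.ite ?_ ?_ measurable_const
  · exact measurableSet_eq_fun ((measurable_pi_apply j).comp hI) measurable_const
  · exact ((hcont _).measurable.comp hx).sub ((hcont _).measurable.comp hw)

theorem measurable_messageLaw {α : Type*} [MeasurableSpace α] (P : Params)
    (C : Kernel (Vec d) (Vec d)) (A : Fin m → 𝒟) {x w s : α → Vec d}
    (hx : Measurable x) (hw : Measurable w) (hs : Measurable s) :
    Measurable fun a => messageLaw loss P C A (x a) (w a) (s a) := by
  have hg : Measurable fun q : α × ((Fin m → Bool) × Vec d) =>
      svrgEstimator loss P.b A (x q.1) (w q.1) q.2.1 + q.2.2 - s q.1 :=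
    ((measurable_svrgEstimator hdiff hcont P.b A (hx.comp measurable_fst) (hw.comp measurable_fst)
      (measurable_fst.comp measurable_snd)).add (measurable_snd.comp measurable_snd)).sub
      (hs.comp measurable_fst)
  refine Measure.measurable_of_measurable_coe _ fun S hS => ?_
  have h : ∀ a, messageLaw loss P C A (x a) (w a) (s a) S
      = ∫⁻ r, C (svrgEstimator loss P.b A (x a) (w a) r.1 + r.2 - s a) S
        ∂((minibatchLaw m P.b).prod (gaussianNoise d P.σsq)) := by
    intro a
    rw [messageLaw, Measure.bind_apply hS]
    exact (C.measurable.comp (hg.comp measurable_prodMk_left)).aemeasurable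
  simp_rw [h]
  exact Measurable.lintegral_prod_right' (((C.measurable_coe hS).comp hg))

theorem isProbabilityMeasure_messageLaw (P : Params) (C : Kernel (Vec d) (Vec d)) [IsMarkovKernel C]
    (A : Fin m → 𝒟) (x w s : Vec d) : IsProbabilityMeasure (messageLaw loss P C A x w s) := by
  have hg : Measurable fun q : (Fin m → Bool) × Vec d =>
      C (svrgEstimator loss P.b A x w q.1 + q.2 - s) :=
    C.measurable.comp (((measurable_svrgEstimator hdiff hcont P.b A measurable_const
      measurable_const measurable_fst).add measurable_snd).sub measurable_const)
  exact isProbabilityMeasure_bind hg.aemeasurable (Filter.Eventually.of_forall fun _ => inferInstance)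

variable {C : Fin n → Kernel (Vec d) (Vec d)} [∀ i, IsMarkovKernel (C i)]

theorem isProbabilityMeasure_roundLaw (P : Params) (D : Fin n → Fin m → 𝒟) (st : State n d) :
    IsProbabilityMeasure (roundLaw loss P C D st) := by
  have := fun i => isProbabilityMeasure_messageLaw hdiff hcont P (C i) (D i) st.x st.w (st.s i)
  unfold roundLaw
  infer_instance

theorem measurable_roundLaw {α : Type*} [MeasurableSpace α] (P : Params) (D : Fin n → Fin m → 𝒟)
    {st : α → State n d} (hx : Measurable fun a => (st a).x) (hw : Measurable fun a => (st a).w)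
    (hs : ∀ i, Measurable fun a => (st a).s i) :
    Measurable fun a => roundLaw loss P C D (st a) := by
  have := fun a i =>
    isProbabilityMeasure_messageLaw hdiff hcont P (C i) (D i) (st a).x (st a).w ((st a).s i)
  exact measurable_prod_measure (measurable_pi_measure fun i =>
    measurable_messageLaw hdiff hcont P (C i) (D i) hx hw (hs i)) _

end Laws

section State

variable {n d : ℕ} (P : Params) (x0 : Vec d)

theorem measurable_stateAfter (t : ℕ) :
    (Measurable fun h : Fin t → RoundOut n d => (stateAfter P x0 t h).x) ∧
    (Measurable fun h : Fin t → RoundOut n d => (stateAfter P x0 t h).w) ∧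
    (∀ i, Measurable fun h : Fin t → RoundOut n d => (stateAfter P x0 t h).s i) ∧
    (Measurable fun h : Fin t → RoundOut n d => (stateAfter P x0 t h).sBar) := by
  induction t with
  | zero => exact ⟨measurable_const, measurable_const, fun _ => measurable_const, measurable_const⟩
  | succ t ih =>
    obtain ⟨hx, hw, hs, hb⟩ := ih
    have hi : Measurable fun h : Fin (t + 1) → RoundOut n d => Fin.init h :=
      measurable_pi_lambda _ fun k => measurable_pi_apply _
    have hl : Measurable fun h : Fin (t + 1) → RoundOut n d => h (Fin.last t) :=
      measurable_pi_apply _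
    have hv : ∀ i, Measurable fun h : Fin (t + 1) → RoundOut n d => (h (Fin.last t)).1 i :=
      fun i => (measurable_pi_apply i).comp (measurable_fst.comp hl)
    have hsum : Measurable fun h : Fin (t + 1) → RoundOut n d =>
        (1 / (n : ℝ)) • ∑ i, (h (Fin.last t)).1 i :=
      (Finset.measurable_fun_sum _ fun i _ => hv i).fun_const_smul _
    refine ⟨?_, ?_, fun i => ?_, ?_⟩
    · exact (hx.comp hi).sub (((hb.comp hi).add hsum).fun_const_smul _)
    · exact Measurable.ite (measurableSet_eq_fun (measurable_snd.comp hl) measurable_const)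
        (hx.comp hi) (hw.comp hi)
    · exact ((hs i).comp hi).add ((hv i).fun_const_smul _)
    · exact (hb.comp hi).add (hsum.fun_const_smul _)

/-- The server reference stays the average of the client references, so the shifts cancel in the
mean of the server step. -/
theorem stateAfter_sBar (t : ℕ) (h : Fin t → RoundOut n d) :
    (stateAfter P x0 t h).sBar = (1 / (n : ℝ)) • ∑ i, (stateAfter P x0 t h).s i := by
  induction t with
  | zero => simp [stateAfter, initState]
  | succ t ih =>
    simp only [stateAfter, nextState]
    rw [ih, Finset.sum_add_distrib, smul_add, ← Finset.smul_sum, smul_comm]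

theorem measurable_snoc (t : ℕ) :
    Measurable fun q : (Fin t → RoundOut n d) × RoundOut n d =>
      (Fin.snoc (α := fun _ => RoundOut n d) q.1 q.2 : Fin (t + 1) → RoundOut n d) := by
  refine measurable_pi_lambda _ fun k => ?_
  refine Fin.lastCases ?_ (fun k => ?_) k
  · simp only [Fin.snoc_last]; exact measurable_snd
  · simp only [Fin.snoc_castSucc]; exact (measurable_pi_apply k).comp measurable_fst

end State

/-! ### The transcript law: integration over the last round and composition -/

section Transcript

variable {n m d : ℕ} {𝒟 : Type*} {loss : 𝒟 → Vec d → ℝ} (hdiff : ∀ z, Differentiable ℝ (loss z))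
  (hcont : ∀ z, Continuous (gradient (loss z))) {C : Fin n → ℕ → Kernel (Vec d) (Vec d)}
  [∀ i t, IsMarkovKernel (C i t)] (P : Params) (x0 : Vec d) (D : Fin n → Fin m → 𝒟)
include hdiff hcont

theorem measurable_roundLaw_stateAfter (t : ℕ) :
    Measurable fun h => roundLaw loss P (fun i => C i t) D (stateAfter P x0 t h) := by
  obtain ⟨hx, hw, hs, -⟩ := measurable_stateAfter (n := n) P x0 t
  exact measurable_roundLaw hdiff hcont P D hx hw hs

theorem measurable_transcript_step (t : ℕ) :
    Measurable fun h => (roundLaw loss P (fun i => C i t) D (stateAfter P x0 t h)).map fun o =>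
        (Fin.snoc (α := fun _ => RoundOut n d) h o : Fin (t + 1) → RoundOut n d) := by
  have hp := fun h => isProbabilityMeasure_roundLaw hdiff hcont (C := fun i => C i t) P D
    (stateAfter P x0 t h)
  let κ : Kernel (Fin t → RoundOut n d) (RoundOut n d) :=
    ⟨fun h => roundLaw loss P (fun i => C i t) D (stateAfter P x0 t h),
      measurable_roundLaw_stateAfter hdiff hcont P x0 D t⟩
  have : IsMarkovKernel κ := ⟨hp⟩
  refine Measure.measurable_of_measurable_coe _ fun S hS => ?_
  have h : ∀ h, ((roundLaw loss P (fun i => C i t) D (stateAfter P x0 t h)).map fun o =>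
        (Fin.snoc (α := fun _ => RoundOut n d) h o : Fin (t + 1) → RoundOut n d)) S
      = κ h (Prod.mk h ⁻¹' ((fun q : (Fin t → RoundOut n d) × RoundOut n d =>
        (Fin.snoc (α := fun _ => RoundOut n d) q.1 q.2 : Fin (t + 1) → RoundOut n d)) ⁻¹' S)) :=
    fun h => Measure.map_apply ((measurable_snoc t).comp measurable_prodMk_left) hS
  simp_rw [h]
  exact Kernel.measurable_kernel_prodMk_left ((measurable_snoc t) hS)

theorem isProbabilityMeasure_transcriptLaw (t : ℕ) :
    IsProbabilityMeasure (transcriptLaw loss P C x0 D t) := by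
  induction t with
  | zero => unfold transcriptLaw; infer_instance
  | succ t ih =>
    rw [transcriptLaw]
    refine isProbabilityMeasure_bind
      (measurable_transcript_step hdiff hcont P x0 D t).aemeasurable
      (Filter.Eventually.of_forall fun h => ?_)
    have hp := isProbabilityMeasure_roundLaw hdiff hcont (C := fun i => C i t) P D
      (stateAfter P x0 t h)
    exact Measure.isProbabilityMeasure_map
      ((measurable_snoc t).comp measurable_prodMk_left).aemeasurable

theorem lintegral_transcriptLaw_succ (t : ℕ) {φ : (Fin (t + 1) → RoundOut n d) → ℝ≥0∞}
    (hφ : Measurable φ) :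
    ∫⁻ h, φ h ∂(transcriptLaw loss P C x0 D (t + 1))
      = ∫⁻ h, ∫⁻ o, φ (Fin.snoc (α := fun _ => RoundOut n d) h o)
          ∂(roundLaw loss P (fun i => C i t) D (stateAfter P x0 t h))
        ∂(transcriptLaw loss P C x0 D t) := by
  rw [transcriptLaw, Measure.lintegral_bind
    (measurable_transcript_step hdiff hcont P x0 D t).aemeasurable hφ.aemeasurable]
  exact lintegral_congr fun h => lintegral_map hφ ((measurable_snoc t).comp measurable_prodMk_left)

/-- Adaptive composition over the rounds. -/
theorem momentDom_transcriptLaw {r : ℝ} (hr : 1 < r) {K : ℝ≥0∞} {D' : Fin n → Fin m → 𝒟}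
    (h : ∀ t st, MomentDom r K (roundLaw loss P (fun i => C i t) D st)
      (roundLaw loss P (fun i => C i t) D' st)) (t : ℕ) :
    MomentDom r (K ^ t) (transcriptLaw loss P C x0 D t) (transcriptLaw loss P C x0 D' t) := by
  induction t with
  | zero =>
    have := isProbabilityMeasure_transcriptLaw hdiff hcont (C := C) P x0 D 0
    rw [pow_zero]
    exact MomentDom.refl _ hr
  | succ t ih =>
    rw [pow_succ]
    exact ih.bind (measurable_transcript_step hdiff hcont P x0 D t)
      (measurable_transcript_step hdiff hcont P x0 D' t) (by linarith)
      fun a => (h t _).map ((measurable_snoc t).comp measurable_prodMk_left)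

end Transcript

/-! ### Privacy of one round -/

section MessagePrivacy

variable {k m d : ℕ} {𝒟 : Type*} {loss : 𝒟 → Vec d → ℝ}

/-- The part of the shifted estimator that does not use sample `j` in the minibatch. -/
noncomputable def restEstimator (loss : 𝒟 → Vec d → ℝ) (b : ℝ) (A : Fin (k + 1) → 𝒟)
    (x w s : Vec d) (j : Fin (k + 1)) (I : Fin k → Bool) : Vec d :=
  (1 / b) • (∑ l, if I l then gradient (loss (A (j.succAbove l))) x
      - gradient (loss (A (j.succAbove l))) w else 0) + gradient (localLoss loss A) w - s

theorem svrgEstimator_eq_rest (b : ℝ) (A : Fin (k + 1) → 𝒟) (x w s : Vec d) (j : Fin (k + 1))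
    (I : Fin (k + 1) → Bool) (ξ : Vec d) :
    svrgEstimator loss b A x w I + ξ - s
      = restEstimator loss b A x w s j (fun l => I (j.succAbove l))
        + (if I j then (1 / b) • (gradient (loss (A j)) x - gradient (loss (A j)) w) else 0)
        + ξ := by
  rw [svrgEstimator, restEstimator, Fin.sum_univ_succAbove _ j, smul_add]
  split_ifs
  · abel
  · simp only [smul_zero]; abel

variable (hdiff : ∀ z, Differentiable ℝ (loss z)) (hcont : ∀ z, Continuous (gradient (loss z)))
include hdiff hcont

/-- By independence all minibatch coins except number `j` can be drawn first. What remains is the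
coin of sample `j` and the Gaussian noise, a two-component mixture, followed by the compressor as
post-processing. -/
theorem messageLaw_eq_bind (P : Params) (C : Kernel (Vec d) (Vec d)) (A : Fin (k + 1) → 𝒟)
    (x w s : Vec d) (j : Fin (k + 1)) :
    messageLaw loss P C A x w s
      = ((Measure.pi fun _ : Fin k => coin (P.b / (k + 1 : ℕ))).bind fun I =>
          mixtureLaw (P.b / (k + 1 : ℕ)) P.σsq (restEstimator loss P.b A x w s j I)
            ((1 / P.b) • (gradient (loss (A j)) x - gradient (loss (A j)) w))).bind C := by
  refine Measure.ext_of_lintegral _ fun φ hφ => ?_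
  obtain ⟨F, hF, hFC⟩ : ∃ F : Vec d → ℝ≥0∞, Measurable F ∧ ∀ u, ∫⁻ y, φ y ∂(C u) = F u :=
    ⟨_, hφ.lintegral_kernel, fun _ => rfl⟩
  set q := P.b / (k + 1 : ℕ) with hq
  set a := (1 / P.b) • (gradient (loss (A j)) x - gradient (loss (A j)) w) with ha
  have hg : Measurable fun r : (Fin (k + 1) → Bool) × Vec d =>
      svrgEstimator loss P.b A x w r.1 + r.2 - s :=
    ((measurable_svrgEstimator hdiff hcont P.b A measurable_const
      measurable_const measurable_fst).add measurable_snd).sub measurable_const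
  have hmix : Measurable fun I : Fin k → Bool =>
      mixtureLaw q P.σsq (restEstimator loss P.b A x w s j I) a := measurable_of_finite _
  have hCg : Measurable fun r : (Fin (k + 1) → Bool) × Vec d =>
      C (svrgEstimator loss P.b A x w r.1 + r.2 - s) := C.measurable.comp hg
  rw [messageLaw, Measure.lintegral_bind hCg.aemeasurable hφ.aemeasurable,
    Measure.lintegral_bind C.measurable.aemeasurable hφ.aemeasurable]
  simp_rw [hFC]
  rw [Measure.lintegral_bind hmix.aemeasurable hF.aemeasurable]
  simp_rw [svrgEstimator_eq_rest P.b A x w s j]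
  have hmap := (measurePreserving_piFinSuccAbove (fun _ : Fin (k + 1) => coin q) j)
  have hG : Measurable fun r : Bool × (Fin k → Bool) =>
      ∫⁻ ξ, F (restEstimator loss P.b A x w s j r.2 + (if r.1 then a else 0) + ξ)
        ∂(gaussianNoise d P.σsq) := measurable_of_finite _
  have hH : Measurable fun r : (Fin (k + 1) → Bool) × Vec d =>
      F (restEstimator loss P.b A x w s j (fun l => r.1 (j.succAbove l))
        + (if r.1 j then a else 0) + r.2) := by
    have h1 : Measurable fun I : Fin (k + 1) → Bool =>
      (restEstimator loss P.b A x w s j (fun l => I (j.succAbove l))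
        + (if I j then a else 0)) := measurable_of_finite _
    exact hF.comp ((h1.comp measurable_fst).add measurable_snd)
  rw [minibatchLaw, lintegral_prod _ hH.aemeasurable]
  have e1 := hmap.lintegral_comp hG
  refine e1.trans ?_
  rw [lintegral_prod_symm' _ hG]
  refine lintegral_congr fun I => ?_
  have hm : Measurable fun r : Bool × Vec d =>
      restEstimator loss P.b A x w s j I + (if r.1 then a else 0) + r.2 :=
    measurable_mixture_map _ _
  have hFm : Measurable fun r : Bool × Vec d =>
      F (restEstimator loss P.b A x w s j I + (if r.1 then a else 0) + r.2) := hF.comp hm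
  rw [mixtureLaw, lintegral_map hF hm, lintegral_prod _ hFm.aemeasurable]

variable {G : ℝ} (hG : ∀ z x, ‖gradient (loss z) x‖ ≤ G)
include hG

theorem momentDom_messageLaw {P : Params} {C : Kernel (Vec d) (Vec d)} [IsMarkovKernel C]
    {A B : Fin m → 𝒟} (hAB : Neighbors A B) (hb : 0 < P.b) (hbm : P.b ≤ m) (hv : 0 < P.σsq)
    {N : ℕ} {r : ℝ} (hr : r.HolderConjugate N)
    (hN : N * ((2 * G / P.b) ^ 2 / P.σsq) ≤ 1) (x w s : Vec d) :
    MomentDom (r * (r * r))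
      (ENNReal.ofReal (Real.exp (122 * (N * (G ^ 2 / (m ^ 2 * P.σsq))))))
      (messageLaw loss P C A x w s) (messageLaw loss P C B x w s) := by
  obtain ⟨j, hj⟩ := hAB
  obtain _ | k := m
  · exact j.elim0
  have hm0 : (0 : ℝ) < (k + 1 : ℕ) := by positivity
  have hR : 1 < r * (r * r) := by
    have := hr.lt
    nlinarith [mul_pos (sub_pos.2 this) (sub_pos.2 this)]
  have hq : 0 ≤ P.b / (k + 1 : ℕ) := by positivity
  have hq1 : P.b / (k + 1 : ℕ) ≤ 1 := (div_le_one hm0).2 hbm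
  rw [messageLaw_eq_bind hdiff hcont P C A x w s j, messageLaw_eq_bind hdiff hcont P C B x w s j]
  have hpi : MomentDom (r * (r * r)) 1 (Measure.pi fun _ : Fin k => coin (P.b / (k + 1 : ℕ)))
    (Measure.pi fun _ : Fin k => coin (P.b / (k + 1 : ℕ))) := MomentDom.refl _ hR
  have hinc : ∀ E : Fin (k + 1) → 𝒟,
      ‖(1 / P.b) • (gradient (loss (E j)) x - gradient (loss (E j)) w)‖ ≤ 2 * G / P.b := by
    intro E
    rw [norm_smul, Real.norm_of_nonneg (by positivity)]
    have := (norm_sub_le (gradient (loss (E j)) x) (gradient (loss (E j)) w)).trans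
      (add_le_add (hG _ _) (hG _ _))
    calc _ ≤ 1 / P.b * (G + G) := by gcongr
      _ = _ := by ring
  -- Outside `j` the datasets agree, so the remaining minibatch sums cancel and only the full
  -- gradient at `w` differs, in one of its `m` terms.
  have hrest : ∀ I, ‖restEstimator loss P.b A x w s j I - restEstimator loss P.b B x w s j I‖
      ≤ 2 * G / (k + 1 : ℕ) := by
    intro I
    have e1 : restEstimator loss P.b A x w s j I - restEstimator loss P.b B x w s j I
        = gradient (localLoss loss A) w - gradient (localLoss loss B) w := by
      unfold restEstimator
      simp_rw [hj _ (Fin.succAbove_ne j _)]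
      abel
    have e2 : gradient (localLoss loss A) w - gradient (localLoss loss B) w
        = (1 / ((k + 1 : ℕ) : ℝ)) • (gradient (loss (A j)) w - gradient (loss (B j)) w) := by
      rw [gradient_localLoss hdiff, gradient_localLoss hdiff, ← smul_sub,
        Fin.sum_univ_succAbove _ j, Fin.sum_univ_succAbove _ j]
      simp_rw [hj _ (Fin.succAbove_ne j _)]
      congr 1
      abel
    rw [e1, e2, norm_smul, Real.norm_of_nonneg (by positivity)]
    have := (norm_sub_le (gradient (loss (A j)) w) (gradient (loss (B j)) w)).trans
      (add_le_add (hG _ _) (hG _ _))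
    calc _ ≤ 1 / ((k + 1 : ℕ) : ℝ) * (G + G) := by gcongr
      _ = _ := by ring
  have hstep := MomentDom.bind (measurable_of_finite _) (measurable_of_finite _)
    (by linarith) hpi fun I => mixtureLaw_dom hq hq1 hv hr (hinc A) (hinc B) (hrest I) hN
  have := hstep.bind C.measurable C.measurable (by linarith) fun u => MomentDom.refl (C u) hR
  refine this.mono ?_
  rw [one_mul, mul_one]
  apply ENNReal.ofReal_le_ofReal
  rw [Real.exp_le_exp]
  -- `122 = 30 · 4 + 4 / 2`: the batch size cancels in `q · 2G/b = 2G/m`, which is also the size of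
  -- the shift.
  apply le_of_eq
  field_simp
  ring

theorem momentDom_roundLaw {n : ℕ} {P : Params} {C : Fin n → Kernel (Vec d) (Vec d)}
    [∀ i, IsMarkovKernel (C i)] {A B : Fin m → 𝒟} (hAB : Neighbors A B) (hb : 0 < P.b)
    (hbm : P.b ≤ m) (hv : 0 < P.σsq) {N : ℕ} {r : ℝ} (hr : r.HolderConjugate N)
    (hN : N * ((2 * G / P.b) ^ 2 / P.σsq) ≤ 1) (D : Fin n → Fin m → 𝒟) (i : Fin n)
    (st : State n d) :
    MomentDom (r * (r * r))
      (ENNReal.ofReal (Real.exp (122 * (N * (G ^ 2 / (m ^ 2 * P.σsq))))))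
      (roundLaw loss P C (Function.update D i A) st)
      (roundLaw loss P C (Function.update D i B) st) := by
  have hR : 1 < r * (r * r) := by
    have := hr.lt
    nlinarith [mul_pos (sub_pos.2 this) (sub_pos.2 this)]
  have hp := fun (E : Fin m → 𝒟) l => isProbabilityMeasure_messageLaw hdiff hcont P (C l) E st.x st.w (st.s l)
  refine MomentDom.prod_right (MomentDom.pi_of_eq_off i hR ?_ fun j hj => ?_) _ hR
  · rw [Function.update_self, Function.update_self]
    exact momentDom_messageLaw hdiff hcont hG hAB hb hbm hv hr hN _ _ _
  · rw [Function.update_of_ne hj, Function.update_of_ne hj]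

/-- Privacy of SoteriaFL-SVRG for a given order `N` of the moments. -/
theorem isLDP_transcriptLaw {n : ℕ} {P : Params} {C : Fin n → ℕ → Kernel (Vec d) (Vec d)}
    [∀ i t, IsMarkovKernel (C i t)] (hb : 0 < P.b) (hbm : P.b ≤ m) (hv : 0 < P.σsq) {N : ℕ}
    (hN4 : 4 ≤ N) (hN : N * ((2 * G / P.b) ^ 2 / P.σsq) ≤ 1) (x0 : Vec d)
    (D : Fin n → Fin m → 𝒟) (i : Fin n) (T : ℕ) {ε δ : ℝ} (hδ : 0 < δ)
    (hε : T * (122 * (N * (G ^ 2 / (m ^ 2 * P.σsq))))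
      ≤ ε * (1 - 3 / N) + 3 / N * Real.log δ) :
    IsLDP ε δ fun A : Fin m → 𝒟 => transcriptLaw loss P C x0 (Function.update D i A) T := by
  have hpr := fun A => isProbabilityMeasure_transcriptLaw hdiff hcont (C := C) P x0
    (Function.update D i A) T
  refine ⟨hpr, fun A B hAB S hS => ?_⟩
  have hN4' : (4 : ℝ) ≤ N := by exact_mod_cast hN4
  have hr : ((N : ℝ).conjExponent).HolderConjugate N :=
    (Real.HolderConjugate.conjExponent (by linarith)).symm
  set r := (N : ℝ).conjExponent with hrdef
  have hri : r⁻¹ = 1 - (N : ℝ)⁻¹ := hr.symm.one_sub_inv.symm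
  have hr1 := hr.lt
  have hR : 1 < r * (r * r) := by nlinarith [mul_pos (sub_pos.2 hr1) (sub_pos.2 hr1)]
  have h := momentDom_transcriptLaw hdiff hcont P x0 (D := Function.update D i A)
    (D' := Function.update D i B) hR
    (fun t st => momentDom_roundLaw hdiff hcont hG (C := fun l => C l t) hAB hb hbm hv hr hN D i st)
    T
  rw [← ENNReal.ofReal_pow (Real.exp_pos _).le, ← Real.exp_nat_mul] at h
  refine h.measure_le_exp (θ := 3 / N) (by linarith) hδ (by positivity) ?_ ?_ hε hS
  · rw [div_lt_one (by linarith)]; linarith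
  · have hi0 : 0 < (N : ℝ)⁻¹ := by positivity
    have hi1 : (N : ℝ)⁻¹ ≤ 1 := inv_le_one_of_one_le₀ (by linarith)
    rw [one_div, mul_inv, mul_inv, hri, div_eq_mul_inv]
    -- Bernoulli's inequality gives `1 / r³ = (1 - 1/N)³ ≥ 1 - 3/N`, whence `θ = 3 / N`.
    have := one_add_mul_le_pow (a := -(N : ℝ)⁻¹) (by linarith) 3
    push_cast at this
    nlinarith

end MessagePrivacy

/-! ### Privacy for the chosen parameters -/

theorem batch_pos {m : ℕ} (hm : 0 < m) : 0 < batch m := by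
  have : (0 : ℝ) < m := by exact_mod_cast hm
  unfold batch; positivity

theorem batch_le {m : ℕ} (hm : 0 < m) : batch m ≤ m := by
  have h1 : (1 : ℝ) ≤ m := by exact_mod_cast hm
  have h2 : (m : ℝ) ^ (2 / 3 : ℝ) ≤ (m : ℝ) ^ (1 : ℝ) :=
    Real.rpow_le_rpow_of_exponent_le h1 (by norm_num)
  rw [Real.rpow_one] at h2
  unfold batch
  linarith

/-- The order `N` is of size `log(1/δ)/ε`. It is large enough for the `δ` term to cost only part of
the budget, and `ε ≤ Λ log(1/δ)` keeps the rounding and the additive constant within `N ≤ (6 + 7Λ)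
log(1/δ)/ε`. -/
theorem isLDP_svrgParams {n m d : ℕ} (hm : 0 < m) {𝒟 : Type*} {loss : 𝒟 → Vec d → ℝ}
    (hdiff : ∀ z, Differentiable ℝ (loss z)) (hcont : ∀ z, Continuous (gradient (loss z)))
    {G ω ε δ c η Λ : ℝ} (hG0 : 0 < G) (hG : ∀ z x, ‖gradient (loss z) x‖ ≤ G)
    {C : Fin n → ℕ → Kernel (Vec d) (Vec d)} [∀ i t, IsMarkovKernel (C i t)]
    (hΛ : 0 < Λ) (hε : 0 < ε) (hδ : 0 < δ) (hδ1 : δ < 1) {T : ℕ} (hT : 0 < T)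
    (hεΛ : ε ≤ Λ * Real.log (1 / δ)) (hc : c = 122 * (6 + 7 * Λ) ^ 2)
    (hεT : ε < c / (4 * (6 + 7 * Λ)) * batch m ^ 2 * T / m ^ 2)
    (x0 : Vec d) (D : Fin n → Fin m → 𝒟) (i : Fin n) :
    IsLDP ε δ fun A : Fin m → 𝒟 =>
      transcriptLaw loss (svrgParams m G ω ε δ c η T) C x0 (Function.update D i A) T := by
  have hm0 : (0 : ℝ) < m := by exact_mod_cast hm
  have hT0 : (0 : ℝ) < T := by exact_mod_cast hT
  have hb := batch_pos hm
  set l := Real.log (1 / δ) with hl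
  have hl0 : 0 < l := Real.log_pos (by rw [lt_div_iff₀ hδ]; linarith)
  have hlδ : Real.log δ = -l := by rw [hl, one_div, Real.log_inv]; ring
  set a := 6 + 7 * Λ with ha
  have ha0 : 0 < a := by positivity
  have hc0 : 0 < c := by rw [hc]; positivity
  have hv : 0 < (svrgParams m G ω ε δ c η T).σsq := by
    simp only [svrgParams]; rw [← hl]; positivity
  set N : ℕ := ⌈6 * l / ε⌉₊ + 6 with hN
  have hN1 : 6 * l / ε + 6 ≤ (N : ℝ) := by
    rw [hN]; push_cast; linarith [Nat.le_ceil (6 * l / ε)]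
  have hN2 : (N : ℝ) ≤ a * (l / ε) := by
    have h1 := Nat.ceil_lt_add_one (a := 6 * l / ε) (by positivity)
    have h2 : 1 ≤ Λ * (l / ε) := by
      rw [← mul_div_assoc, le_div_iff₀ hε]; linarith
    rw [hN, ha]; push_cast
    have : 6 * l / ε = 6 * (l / ε) := by ring
    rw [this] at h1 ⊢
    nlinarith
  have hN6 : 6 * l + 6 * ε ≤ ε * N := by
    have := mul_le_mul_of_nonneg_left hN1 hε.le
    have e : ε * (6 * l / ε + 6) = 6 * l + 6 * ε := by field_simp
    linarith
  have hN3 : N * ε ≤ a * l := by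
    have := mul_le_mul_of_nonneg_right hN2 hε.le
    have e : a * (l / ε) * ε = a * l := by field_simp
    linarith
  have hN0 : (0 : ℝ) < N := by rw [hN]; positivity
  refine isLDP_transcriptLaw hdiff hcont hG hb (batch_le hm) hv (N := N) (by omega) ?_ x0 D i T hδ ?_
  · simp only [svrgParams]
    rw [← hl]
    have e : N * ((2 * G / batch m) ^ 2 / (c * (G ^ 2 * T * l / (m ^ 2 * ε ^ 2))))
        = (N * ε) * (4 * (m ^ 2 * ε)) / (c * batch m ^ 2 * T * l) := by
      field_simp; ring
    rw [e, div_le_one (by positivity)]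
    -- The bound on `ε` by the number of rounds enters only here, to ensure that `N` times the
    -- squared jump over the variance is at most `1`.
    have h1 : 4 * (m ^ 2 * ε) * a ≤ c * batch m ^ 2 * T := by
      rw [lt_div_iff₀ (by positivity)] at hεT
      have e2 : c / (4 * a) * batch m ^ 2 * T * (4 * a) = c * batch m ^ 2 * T := by field_simp
      have := mul_le_mul_of_nonneg_right hεT.le (show 0 ≤ 4 * a by positivity)
      linarith
    calc (N * ε) * (4 * (m ^ 2 * ε)) ≤ (a * l) * (4 * (m ^ 2 * ε)) := by gcongr
      _ = 4 * (m ^ 2 * ε) * a * l := by ring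
      _ ≤ _ := by gcongr
  · simp only [svrgParams]
    rw [← hl, hlδ]
    -- With `c = 122 a²` and `N ε ≤ a l`, the cost over all rounds is at most `l / N`, while the
    -- available budget is at least `(3l + 3ε) / N`.
    have e : T * (122 * (N * (G ^ 2 / (m ^ 2 * (c * (G ^ 2 * T * l / (m ^ 2 * ε ^ 2)))))))
        = (N * ε) ^ 2 / (a ^ 2 * l) / N := by
      rw [hc]; field_simp
    have e2 : ε * (1 - 3 / N) + 3 / N * -l = (ε * N - 3 * ε - 3 * l) / N := by
      field_simp; ring
    rw [e, e2]
    gcongr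
    rw [div_le_iff₀ (by positivity)]
    have h1 : (N * ε) ^ 2 ≤ (a * l) ^ 2 := by gcongr
    have h2 : l * (a ^ 2 * l) ≤ (ε * N - 3 * ε - 3 * l) * (a ^ 2 * l) := by
      gcongr; linarith
    nlinarith

/-! ### Second moments -/

section Moments

variable {d : ℕ}

theorem integrable_norm_sq_of_memLp {Ω : Type*} [MeasurableSpace Ω] {μ : Measure Ω} {Y : Ω → Vec d}
    (h : MemLp Y 2 μ) : Integrable (fun ω => ‖Y ω‖ ^ 2) μ :=
  (memLp_two_iff_integrable_sq_norm h.1).1 h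

theorem integral_norm_sq_eq_sum {Ω : Type*} [MeasurableSpace Ω] {μ : Measure Ω} {Y : Ω → Vec d}
    (h : MemLp Y 2 μ) : ∫ ω, ‖Y ω‖ ^ 2 ∂μ = ∑ c, ∫ ω, Y ω c ^ 2 ∂μ := by
  simp_rw [EuclideanSpace.real_norm_sq_eq]
  exact integral_finsetSum _ fun c _ => (h.eval_piLp c).integrable_sq

theorem integral_apply_of_memLp {Ω : Type*} [MeasurableSpace Ω] {μ : Measure Ω}
    [IsFiniteMeasure μ] {Y : Ω → Vec d} (h : MemLp Y 2 μ) (c : Fin d) :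
    ∫ ω, Y ω c ∂μ = (∫ ω, Y ω ∂μ) c :=
  (EuclideanSpace.proj (𝕜 := ℝ) c).integral_comp_comm (h.integrable (by norm_num))

section Independent

variable {ι : Type*} [Fintype ι] {Ω : ι → Type*} [∀ i, MeasurableSpace (Ω i)]
  {μ : ∀ i, Measure (Ω i)} [∀ i, IsProbabilityMeasure (μ i)] {Y : ∀ i, Ω i → Vec d}

theorem memLp_eval_pi (h : ∀ i, MemLp (Y i) 2 (μ i)) (i : ι) :
    MemLp (fun ω : ∀ i, Ω i => Y i (ω i)) 2 (Measure.pi μ) :=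
  (h i).comp_measurePreserving (measurePreserving_eval μ i)

theorem integral_eval_pi {F : Type*} [NormedAddCommGroup F] [NormedSpace ℝ F] {i : ι}
    {f : Ω i → F} (hf : AEStronglyMeasurable f (μ i)) :
    ∫ ω, f (ω i) ∂(Measure.pi μ) = ∫ x, f x ∂(μ i) := by
  have h := (measurePreserving_eval μ i).map_eq
  rw [← h] at hf
  conv_rhs => rw [← h]
  rw [integral_map (measurable_pi_apply i).aemeasurable hf]

theorem memLp_sum_pi (h : ∀ i, MemLp (Y i) 2 (μ i)) :
    MemLp (fun ω : ∀ i, Ω i => ∑ i, Y i (ω i)) 2 (Measure.pi μ) :=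
  memLp_finsetSum _ fun i _ => memLp_eval_pi h i

theorem integral_sum_pi (h : ∀ i, MemLp (Y i) 2 (μ i)) :
    ∫ ω, ∑ i, Y i (ω i) ∂(Measure.pi μ) = ∑ i, ∫ x, Y i x ∂(μ i) := by
  rw [integral_finsetSum _ fun i _ => (memLp_eval_pi h i).integrable (by norm_num)]
  exact Finset.sum_congr rfl fun i _ => integral_eval_pi (h i).1

/-- Second moments of centered independent vectors add up. -/
theorem integral_norm_sq_sum_pi (h : ∀ i, MemLp (Y i) 2 (μ i)) (h0 : ∀ i, ∫ x, Y i x ∂(μ i) = 0) :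
    ∫ ω, ‖∑ i, Y i (ω i)‖ ^ 2 ∂(Measure.pi μ) = ∑ i, ∫ x, ‖Y i x‖ ^ 2 ∂(μ i) := by
  rw [integral_norm_sq_eq_sum (memLp_sum_pi h)]
  simp_rw [integral_norm_sq_eq_sum (h _)]
  rw [Finset.sum_comm]
  refine Finset.sum_congr rfl fun c _ => ?_
  have hc : ∀ i, MemLp (fun x => Y i x c) 2 (μ i) := fun i => (h i).eval_piLp c
  have hc0 : ∀ i, ∫ x, Y i x c ∂(μ i) = 0 := fun i => by
    rw [integral_apply_of_memLp (h i) c, h0 i]; rfl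
  have hv := variance_sum_pi hc
  have h1 : (∑ i, fun ω : ∀ i, Ω i => Y i (ω i) c) = fun ω => (∑ i, Y i (ω i)) c := by
    ext ω; simp
  rw [h1, variance_of_integral_eq_zero ((memLp_sum_pi h).eval_piLp c).aemeasurable] at hv
  · rw [hv]
    exact Finset.sum_congr rfl fun i _ =>
      variance_of_integral_eq_zero (hc i).aemeasurable (hc0 i)
  · rw [integral_apply_of_memLp (memLp_sum_pi h) c, integral_sum_pi h]
    simp [h0]

end Independent

theorem memLp_inner_integrable {Ω : Type*} [MeasurableSpace Ω] {μ : Measure Ω} {X Y : Ω → Vec d}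
    (hX : MemLp X 2 μ) (hY : MemLp Y 2 μ) : Integrable (fun ω => inner ℝ (X ω) (Y ω)) μ := by
  refine ((integrable_norm_sq_of_memLp hX).add (integrable_norm_sq_of_memLp hY)).mono'
    (hX.1.inner hY.1) (Filter.Eventually.of_forall fun ω => ?_)
  refine (norm_inner_le_norm _ _).trans ?_
  rw [Pi.add_apply]
  nlinarith [sq_nonneg (‖X ω‖ - ‖Y ω‖), sq_nonneg (‖X ω‖ + ‖Y ω‖)]

theorem integral_norm_add_sq {Ω : Type*} [MeasurableSpace Ω] {μ : Measure Ω} {X Y : Ω → Vec d}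
    (hX : MemLp X 2 μ) (hY : MemLp Y 2 μ) :
    ∫ ω, ‖X ω + Y ω‖ ^ 2 ∂μ
      = ∫ ω, ‖X ω‖ ^ 2 ∂μ + 2 * ∫ ω, inner ℝ (X ω) (Y ω) ∂μ + ∫ ω, ‖Y ω‖ ^ 2 ∂μ := by
  have hc : Integrable (fun ω => 2 * inner ℝ (X ω) (Y ω)) μ :=
    (memLp_inner_integrable hX hY).const_mul 2
  have hXi := integrable_norm_sq_of_memLp hX
  have h1 : Integrable (fun ω => ‖X ω‖ ^ 2 + 2 * inner ℝ (X ω) (Y ω)) μ := hXi.add hc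
  simp_rw [norm_add_sq_real]
  rw [integral_add h1 (integrable_norm_sq_of_memLp hY), integral_add hXi hc, integral_const_mul]

/-- Moments of the output of a compressor applied to a random vector. -/
theorem compressor_moments {ω : ℝ} (hω : 0 ≤ ω) {C : Kernel (Vec d) (Vec d)}
    (hC : IsCompressor ω C) {l : Measure (Vec d)} [IsProbabilityMeasure l] (hl : MemLp id 2 l)
    {e : Vec d} (he : ∫ x, x ∂l = e) {V : ℝ} (hV : ∫ x, ‖x - e‖ ^ 2 ∂l ≤ V) :
    MemLp id 2 (l.bind C) ∧ ∫ y, y ∂(l.bind C) = e ∧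
      ∫ y, ‖y - e‖ ^ 2 ∂(l.bind C) ≤ (1 + ω) * V + ω * ‖e‖ ^ 2 := by
  obtain ⟨hM, hint, hmean, hvar⟩ := hC
  have hsnd : (l ⊗ₘ C).map Prod.snd = l.bind C := Measure.snd_compProd l C
  have hfst : (l ⊗ₘ C).map Prod.fst = l := Measure.fst_compProd l C
  have hX : MemLp (fun q : Vec d × Vec d => q.1) 2 (l ⊗ₘ C) := by
    rw [← hfst] at hl
    exact hl.comp_of_map measurable_fst.aemeasurable
  have hxsq : Integrable (fun x => ω * ‖x‖ ^ 2) l :=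
    (integrable_norm_sq_of_memLp hl).const_mul _
  have hbound : ∫⁻ q, ENNReal.ofReal (‖q.2 - q.1‖ ^ 2) ∂(l ⊗ₘ C)
      ≤ ENNReal.ofReal (∫ x, ω * ‖x‖ ^ 2 ∂l) := by
    rw [Measure.lintegral_compProd (by fun_prop),
      ofReal_integral_eq_lintegral_ofReal hxsq
        (Filter.Eventually.of_forall fun x => by positivity)]
    exact lintegral_mono fun x => hvar x
  have hZint : Integrable (fun q : Vec d × Vec d => ‖q.2 - q.1‖ ^ 2) (l ⊗ₘ C) := by
    refine ⟨by fun_prop, ?_⟩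
    rw [hasFiniteIntegral_iff_ofReal (Filter.Eventually.of_forall fun q => by positivity)]
    exact hbound.trans_lt ENNReal.ofReal_lt_top
  have hZ : MemLp (fun q : Vec d × Vec d => q.2 - q.1) 2 (l ⊗ₘ C) :=
    (memLp_two_iff_integrable_sq_norm (by fun_prop)).2 hZint
  have hZsq : ∫ q, ‖q.2 - q.1‖ ^ 2 ∂(l ⊗ₘ C) ≤ ω * ∫ x, ‖x‖ ^ 2 ∂l := by
    rw [← integral_const_mul, ← ENNReal.ofReal_le_ofReal_iff
      (integral_nonneg fun x => by positivity),
      ofReal_integral_eq_lintegral_ofReal hZint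
        (Filter.Eventually.of_forall fun q => by positivity)]
    exact hbound
  have hY : MemLp (fun q : Vec d × Vec d => q.2) 2 (l ⊗ₘ C) := by
    have := hZ.add hX
    refine this.congr_norm (by fun_prop) (Filter.Eventually.of_forall fun q => ?_)
    simp
  have hY' : MemLp id 2 (l.bind C) := by
    rw [← hsnd]
    exact (memLp_map_measure_iff aestronglyMeasurable_id measurable_snd.aemeasurable).2 hY
  have hcond : ∀ x, ∫ y, (y - x) ∂(C x) = 0 := fun x => by
    rw [integral_sub (hint x) (integrable_const _), hmean x]; simp
  have hmean' : ∫ y, y ∂(l.bind C) = e := by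
    rw [← hsnd, integral_map measurable_snd.aemeasurable (by fun_prop),
      Measure.integral_compProd (hY.integrable (by norm_num))]
    simp_rw [hmean]
    exact he
  refine ⟨hY', hmean', ?_⟩
  have hXe : MemLp (fun q : Vec d × Vec d => q.1 - e) 2 (l ⊗ₘ C) := hX.sub (memLp_const _)
  have hcross : Integrable (fun q : Vec d × Vec d => inner ℝ (q.1 - e) (q.2 - q.1)) (l ⊗ₘ C) :=
    memLp_inner_integrable hXe hZ
  -- Given the input, the compression error is centred, so it is orthogonal to `q.1 - e`. The bound
  -- `(1 + ω) V + ω ‖e‖²` then follows from `E‖X‖² = E‖X - e‖² + ‖e‖²`.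
  have hcross0 : ∫ q, inner ℝ (q.1 - e) (q.2 - q.1) ∂(l ⊗ₘ C) = 0 := by
    rw [Measure.integral_compProd hcross]
    have : ∀ x, ∫ y, inner ℝ (x - e) (y - x) ∂(C x) = 0 := fun x => by
      have hi : Integrable (fun y => y - x) (C x) := (hint x).sub (integrable_const _)
      rw [integral_inner hi, hcond x, inner_zero_right]
    simp [this]
  have hXesq : ∫ q, ‖q.1 - e‖ ^ 2 ∂(l ⊗ₘ C) = ∫ x, ‖x - e‖ ^ 2 ∂l := by
    conv_rhs => rw [← hfst]
    rw [integral_map measurable_fst.aemeasurable (by fun_prop)]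
  have hle : MemLp (fun x => x - e) 2 l := hl.sub (memLp_const _)
  have hxnorm : ∫ x, ‖x‖ ^ 2 ∂l = ∫ x, ‖x - e‖ ^ 2 ∂l + ‖e‖ ^ 2 := by
    have h1 := integral_norm_add_sq hle (memLp_const (μ := l) e)
    have hi : Integrable (fun x : Vec d => x - e) l := hle.integrable (by norm_num)
    have h0 : ∫ x, (x - e) ∂l = 0 := by
      have hli : Integrable (fun x : Vec d => x) l := hl.integrable (by norm_num)
      rw [integral_sub hli (integrable_const _), he]
      simp
    have hc : ∫ x, inner ℝ (x - e) e ∂l = 0 := by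
      simp_rw [real_inner_comm e]
      rw [integral_inner hi, h0, inner_zero_right]
    simp only [sub_add_cancel] at h1
    rw [h1, hc]
    simp
  rw [← hsnd, integral_map measurable_snd.aemeasurable (by fun_prop)]
  have hsplit : ∀ q : Vec d × Vec d, q.2 - e = q.1 - e + (q.2 - q.1) := fun q => by abel
  simp_rw [hsplit]
  rw [integral_norm_add_sq hXe hZ, hcross0, hXesq]
  have := mul_le_mul_of_nonneg_left hV hω
  rw [hxnorm] at hZsq
  linarith

/-! ### Moments of the messages -/

theorem gaussianNoise_memLp (d : ℕ) (v : ℝ) : MemLp id 2 (gaussianNoise d v) := by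
  rw [gaussianNoise, memLp_map_measure_iff aestronglyMeasurable_id (by fun_prop)]
  exact (IsGaussian.memLp_two_id (μ := stdGaussian (Vec d))).const_smul (√v)

theorem gaussianNoise_mean (d : ℕ) (v : ℝ) : ∫ z, z ∂(gaussianNoise d v) = 0 := by
  rw [gaussianNoise, integral_map (by fun_prop) (by fun_prop), integral_smul,
    integral_id_stdGaussian, smul_zero]

theorem integral_norm_sq_stdGaussian (d : ℕ) :
    ∫ z, ‖z‖ ^ 2 ∂(stdGaussian (Vec d)) = d := by
  have h2 : MemLp id 2 (stdGaussian (Vec d)) := IsGaussian.memLp_two_id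
  have h := integral_norm_sq_eq_sum h2
  simp only [id] at h
  rw [h]
  have : ∀ c : Fin d, ∫ z : Vec d, z c ^ 2 ∂(stdGaussian (Vec d)) = 1 := by
    intro c
    rw [← map_pi_eq_stdGaussian, integral_map (by fun_prop)
      (Measurable.aestronglyMeasurable (by fun_prop))]
    simp only []
    rw [integral_eval_pi (μ := fun _ : Fin d => gaussianReal 0 1) (i := c) (f := fun y : ℝ => y ^ 2)
      (by fun_prop)]
    have hv := variance_of_integral_eq_zero (X := id) (μ := gaussianReal 0 1) aemeasurable_id
      (by simp)
    rw [variance_id_gaussianReal] at hv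
    simpa using hv.symm
  simp [this]

theorem gaussianNoise_norm_sq (d : ℕ) {v : ℝ} (hv : 0 ≤ v) :
    ∫ z, ‖z‖ ^ 2 ∂(gaussianNoise d v) = d * v := by
  rw [gaussianNoise, integral_map (by fun_prop) (by fun_prop)]
  simp_rw [norm_smul, mul_pow, Real.norm_of_nonneg (Real.sqrt_nonneg v), Real.sq_sqrt hv]
  rw [integral_const_mul, integral_norm_sq_stdGaussian, mul_comm]

theorem integral_coin {F : Type*} [NormedAddCommGroup F] [NormedSpace ℝ F] [CompleteSpace F] {q : ℝ}
    (hq : 0 ≤ q) (hq1 : q ≤ 1) (f : Bool → F) :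
    ∫ B, f B ∂(coin q) = q • f true + (1 - q) • f false := by
  have h : Set.projIcc (0 : ℝ) 1 zero_le_one q = ⟨q, hq, hq1⟩ := Set.projIcc_of_mem _ ⟨hq, hq1⟩
  rw [coin, h, integral_bernoulliMeasure]

theorem memLp_bool {Ω : Type*} [MeasurableSpace Ω] [Finite Ω] [MeasurableSingletonClass Ω]
    (μ : Measure Ω) [IsFiniteMeasure μ] (f : Ω → Vec d) : MemLp f 2 μ := by
  have := Fintype.ofFinite Ω
  exact MemLp.of_bound (measurable_of_finite f).aestronglyMeasurable (∑ x, ‖f x‖)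
    (Filter.Eventually.of_forall fun x =>
      Finset.single_le_sum (f := fun x => ‖f x‖) (fun _ _ => norm_nonneg _) (Finset.mem_univ x))

/-- The centred estimator is a sum of independent terms, one per coin, each with second moment `(1 -
b/m) ‖z_j‖² / (m b)`. -/
theorem minibatch_moments {m : ℕ} (hm : 0 < m) {b : ℝ} (hb : 0 < b) (hbm : b ≤ m)
    (z : Fin m → Vec d) {R : ℝ} (hz : ∀ j, ‖z j‖ ^ 2 ≤ R) :
    (∫ I, (1 / b) • (∑ j, if I j then z j else 0) ∂(minibatchLaw m b)
      = (1 / (m : ℝ)) • ∑ j, z j) ∧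
    ∫ I, ‖(1 / b) • (∑ j, if I j then z j else 0) - (1 / (m : ℝ)) • ∑ j, z j‖ ^ 2
      ∂(minibatchLaw m b) ≤ R / b := by
  have hm0 : (0 : ℝ) < m := by exact_mod_cast hm
  have hq : 0 ≤ b / m := by positivity
  have hq1 : b / m ≤ 1 := (div_le_one hm0).2 hbm
  set Y : Fin m → Bool → Vec d := fun j B => (1 / b) • (if B then z j else 0) - (1 / (m : ℝ)) • z j
    with hY
  have hL : ∀ j, MemLp (Y j) 2 (coin (b / m)) := fun j => memLp_bool _ _
  have h0 : ∀ j, ∫ B, Y j B ∂(coin (b / m)) = 0 := fun j => by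
    rw [integral_coin hq hq1, hY]
    simp only [if_true, Bool.false_eq_true, if_false, smul_zero, zero_sub]
    rw [smul_sub, smul_smul, smul_smul, smul_neg, smul_smul, ← sub_eq_add_neg, sub_sub, ← add_smul,
      ← sub_smul]
    convert zero_smul ℝ (z j)
    field_simp
    ring
  have hsum : ∀ I : Fin m → Bool, ∑ j, Y j (I j)
      = (1 / b) • (∑ j, if I j then z j else 0) - (1 / (m : ℝ)) • ∑ j, z j := fun I => by
    rw [hY, Finset.sum_sub_distrib, Finset.smul_sum, Finset.smul_sum]
  constructor
  · have h := integral_sum_pi hL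
    simp_rw [hsum, h0] at h
    rw [integral_sub ((memLp_bool _ _).integrable (by norm_num)) (integrable_const _),
      Finset.sum_const_zero, sub_eq_zero] at h
    rw [minibatchLaw, h]
    simp
  · have h := integral_norm_sq_sum_pi hL h0
    simp_rw [hsum] at h
    rw [minibatchLaw, h]
    have hj : ∀ j, ∫ B, ‖Y j B‖ ^ 2 ∂(coin (b / m)) ≤ R / (m * b) := fun j => by
      rw [integral_coin hq hq1, hY]
      simp only [if_true, Bool.false_eq_true, if_false, smul_zero, zero_sub]
      rw [← sub_smul, norm_neg, norm_smul, norm_smul, mul_pow, mul_pow, Real.norm_eq_abs,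
        Real.norm_eq_abs, sq_abs, sq_abs, smul_eq_mul, smul_eq_mul]
      have e : b / m * ((1 / b - 1 / m) ^ 2 * ‖z j‖ ^ 2)
          + (1 - b / m) * ((1 / (m : ℝ)) ^ 2 * ‖z j‖ ^ 2)
          = (1 - b / m) * (‖z j‖ ^ 2 / (m * b)) := by
        field_simp; ring
      rw [e]
      calc _ ≤ 1 * (‖z j‖ ^ 2 / (m * b)) := by gcongr; linarith
        _ ≤ 1 * (R / (m * b)) := by gcongr; exact hz j
        _ = _ := one_mul _
    calc _ ≤ ∑ _j : Fin m, R / (m * b) := Finset.sum_le_sum fun j _ => hj j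
      _ = _ := by simp; field_simp

end Moments

section Message

variable {m d : ℕ} {𝒟 : Type*} {loss : 𝒟 → Vec d → ℝ}
  (hdiff : ∀ z, Differentiable ℝ (loss z)) {L : ℝ}
  (hL : ∀ z x y, ‖gradient (loss z) x - gradient (loss z) y‖ ≤ L * ‖x - y‖)
include hdiff hL

/-- Sampling error and Gaussian noise are independent and centred, so their second moments add
before `compressor_moments` is applied. Smoothness bounds the sampled gradient differences by `L‖x -
w‖`. -/
theorem message_moments {ω : ℝ} (hω : 0 ≤ ω) {C : Kernel (Vec d) (Vec d)} (hC : IsCompressor ω C)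
    {P : Params} (hm : 0 < m) (hb : 0 < P.b) (hbm : P.b ≤ m) (hv : 0 ≤ P.σsq) (A : Fin m → 𝒟)
    (x w s : Vec d) :
    MemLp id 2 (messageLaw loss P C A x w s) ∧
    ∫ y, y ∂(messageLaw loss P C A x w s) = gradient (localLoss loss A) x - s ∧
    ∫ y, ‖y - (gradient (localLoss loss A) x - s)‖ ^ 2 ∂(messageLaw loss P C A x w s)
      ≤ (1 + ω) * (L ^ 2 * ‖x - w‖ ^ 2 / P.b + d * P.σsq)
        + ω * ‖gradient (localLoss loss A) x - s‖ ^ 2 := by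
  have hcont := continuous_gradient_of_lipschitz hL
  have hg : Measurable fun q : (Fin m → Bool) × Vec d =>
      svrgEstimator loss P.b A x w q.1 + q.2 - s :=
    ((measurable_svrgEstimator hdiff hcont P.b A measurable_const
      measurable_const measurable_fst).add measurable_snd).sub measurable_const
  set ν := (minibatchLaw m P.b).prod (gaussianNoise d P.σsq) with hν
  have hbind : messageLaw loss P C A x w s
      = (ν.map fun q => svrgEstimator loss P.b A x w q.1 + q.2 - s).bind C := by
    refine Measure.ext_of_lintegral _ fun φ hφ => ?_
    have hCg : Measurable fun q : (Fin m → Bool) × Vec d =>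
      C (svrgEstimator loss P.b A x w q.1 + q.2 - s) := C.measurable.comp hg
    rw [messageLaw, Measure.lintegral_bind hCg.aemeasurable hφ.aemeasurable,
      Measure.lintegral_bind C.measurable.aemeasurable hφ.aemeasurable,
      lintegral_map hφ.lintegral_kernel hg]
  set Z : (Fin m → Bool) → Vec d := fun I => (1 / P.b) •
    (∑ j, if I j then gradient (loss (A j)) x - gradient (loss (A j)) w else 0) with hZ
  set zbar := (1 / (m : ℝ)) • ∑ j, (gradient (loss (A j)) x - gradient (loss (A j)) w) with hzbar
  set gx := gradient (localLoss loss A) x with hgx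
  set gw := gradient (localLoss loss A) w with hgw
  have hzb : zbar = gx - gw := by
    rw [hgx, hgw, gradient_localLoss hdiff, gradient_localLoss hdiff, ← smul_sub,
      ← Finset.sum_sub_distrib]
  obtain ⟨hmean, hvar⟩ := minibatch_moments hm hb hbm
    (fun j => gradient (loss (A j)) x - gradient (loss (A j)) w) (R := L ^ 2 * ‖x - w‖ ^ 2)
    (fun j => by rw [← mul_pow]; gcongr; exact hL _ _ _)
  have hu : ∀ q : (Fin m → Bool) × Vec d, svrgEstimator loss P.b A x w q.1 + q.2 - s
      = (Z q.1 - zbar) + q.2 + (gx - s) := fun q => by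
    rw [hzb, svrgEstimator]; abel
  have hfst : ν.map Prod.fst = minibatchLaw m P.b := Measure.fst_prod
  have hsnd : ν.map Prod.snd = gaussianNoise d P.σsq := Measure.snd_prod
  have hZL : MemLp (fun I => Z I - zbar) 2 (minibatchLaw m P.b) := memLp_bool _ _
  have hZ1 : MemLp (fun q : (Fin m → Bool) × Vec d => Z q.1 - zbar) 2 ν := by
    rw [← hfst] at hZL
    exact hZL.comp_of_map measurable_fst.aemeasurable
  have hξ1 : MemLp (fun q : (Fin m → Bool) × Vec d => q.2) 2 ν := by
    have h := gaussianNoise_memLp d P.σsq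
    rw [← hsnd] at h
    exact h.comp_of_map measurable_snd.aemeasurable
  have hZ0 : ∫ I, (Z I - zbar) ∂(minibatchLaw m P.b) = 0 := by
    rw [integral_sub ((memLp_bool _ _).integrable (by norm_num)) (integrable_const _), hmean]
    simp [hzbar]
  have hZ1i : Integrable (fun q : (Fin m → Bool) × Vec d => Z q.1 - zbar) ν :=
    hZ1.integrable (by norm_num)
  have hξ1i : Integrable (fun q : (Fin m → Bool) × Vec d => q.2) ν := hξ1.integrable (by norm_num)
  have hZ1mean : ∫ q, (Z q.1 - zbar) ∂ν = 0 := by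
    rw [hν, integral_prod _ hZ1i]
    simp [hZ0]
  have hξ1mean : ∫ q, q.2 ∂ν = 0 := by
    rw [hν, integral_prod _ hξ1i]
    simp [gaussianNoise_mean]
  have hZ1sq : ∫ q, ‖Z q.1 - zbar‖ ^ 2 ∂ν ≤ L ^ 2 * ‖x - w‖ ^ 2 / P.b := by
    rw [hν, integral_prod _ (integrable_norm_sq_of_memLp hZ1)]
    simp only [integral_const, probReal_univ, one_smul]
    exact hvar
  have hξ1sq : ∫ q, ‖q.2‖ ^ 2 ∂ν = d * P.σsq := by
    rw [hν, integral_prod _ (integrable_norm_sq_of_memLp hξ1)]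
    simp [gaussianNoise_norm_sq d hv]
  have hcross : ∫ q, inner ℝ (Z q.1 - zbar) q.2 ∂ν = 0 := by
    rw [hν, integral_prod _ (memLp_inner_integrable hZ1 hξ1)]
    have : ∀ I, ∫ ξ, inner ℝ (Z I - zbar) ξ ∂(gaussianNoise d P.σsq) = 0 := fun I => by
      have hi : Integrable (fun ξ : Vec d => ξ) (gaussianNoise d P.σsq) :=
        (gaussianNoise_memLp d P.σsq).integrable (by norm_num)
      rw [integral_inner hi, gaussianNoise_mean, inner_zero_right]
    simp [this]
  have hsum : MemLp (fun q : (Fin m → Bool) × Vec d => (Z q.1 - zbar) + q.2 + (gx - s)) 2 ν :=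
    (hZ1.add hξ1).add (memLp_const _)
  have hprob : IsProbabilityMeasure
      (ν.map fun q => svrgEstimator loss P.b A x w q.1 + q.2 - s) :=
    Measure.isProbabilityMeasure_map hg.aemeasurable
  rw [hbind]
  refine compressor_moments hω hC ?_ ?_ ?_
  · rw [memLp_map_measure_iff aestronglyMeasurable_id hg.aemeasurable]
    exact hsum.congr_norm hg.aestronglyMeasurable
      (Filter.Eventually.of_forall fun q => by simp only [Function.comp, id]; rw [hu])
  · rw [integral_map hg.aemeasurable (by fun_prop)]
    simp_rw [hu]
    have hs : Integrable (fun q : (Fin m → Bool) × Vec d => Z q.1 - zbar + q.2) ν :=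
      hZ1i.add hξ1i
    rw [integral_add hs (integrable_const _), integral_add hZ1i hξ1i, hZ1mean, hξ1mean]
    simp
  · rw [integral_map hg.aemeasurable (by fun_prop)]
    simp_rw [hu, add_sub_cancel_right]
    rw [integral_norm_add_sq hZ1 hξ1, hcross, hξ1sq]
    linarith

end Message

/-! ### Smoothness -/

section Smooth

variable {d : ℕ}

/-- Along the segment, `f` minus its quadratic upper model has nonpositive derivative. -/
theorem descent_le {f : Vec d → ℝ} (hf : Differentiable ℝ f) {L : ℝ}
    (hL : ∀ x y, ‖gradient f x - gradient f y‖ ≤ L * ‖x - y‖) (x v : Vec d) :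
    f (x + v) ≤ f x + inner ℝ (gradient f x) v + L / 2 * ‖v‖ ^ 2 := by
  set ψ : ℝ → ℝ := fun t => f (x + t • v) - t * inner ℝ (gradient f x) v - L / 2 * ‖v‖ ^ 2 * t ^ 2
    with hψ
  have hd : ∀ t, HasDerivAt ψ (inner ℝ (gradient f (x + t • v)) v - inner ℝ (gradient f x) v
      - L * ‖v‖ ^ 2 * t) t := by
    intro t
    have h1 : HasDerivAt (fun t : ℝ => x + t • v) v t := by
      simpa using ((hasDerivAt_id t).smul_const v).const_add x
    have h2 := (hf (x + t • v)).hasGradientAt.hasFDerivAt.comp_hasDerivAt t h1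
    have h3 : HasDerivAt (fun t : ℝ => t * inner ℝ (gradient f x) v) (inner ℝ (gradient f x) v) t := by
      simpa using (hasDerivAt_id t).mul_const (inner ℝ (gradient f x) v)
    have h4 : HasDerivAt (fun t : ℝ => L / 2 * ‖v‖ ^ 2 * t ^ 2) (L * ‖v‖ ^ 2 * t) t := by
      have := ((hasDerivAt_pow 2 t).const_mul (L / 2 * ‖v‖ ^ 2))
      exact this.congr_deriv (by push_cast; ring)
    exact (h2.sub h3).sub h4
  have hanti : AntitoneOn ψ (Set.Icc 0 1) := by
    refine antitoneOn_of_deriv_nonpos (convex_Icc 0 1)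
      (fun t _ => (hd t).continuousAt.continuousWithinAt)
      (fun t _ => (hd t).differentiableAt.differentiableWithinAt) fun t ht => ?_
    rw [interior_Icc] at ht
    rw [(hd t).deriv, ← inner_sub_left]
    have h1 := real_inner_le_norm (gradient f (x + t • v) - gradient f x) v
    have h2 := hL (x + t • v) x
    rw [add_sub_cancel_left, norm_smul, Real.norm_of_nonneg ht.1.le] at h2
    have h3 := mul_le_mul_of_nonneg_right h2 (norm_nonneg v)
    nlinarith
  have := hanti (Set.left_mem_Icc.2 zero_le_one) (Set.right_mem_Icc.2 zero_le_one) zero_le_one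
  simp only [hψ, one_smul, zero_smul, add_zero] at this
  linarith

/-- A gradient step of length `1 / L` cannot go below the lower bound `fs`. -/
theorem norm_gradient_sq_le {f : Vec d → ℝ} (hf : Differentiable ℝ f) {L : ℝ} (hL0 : 0 < L)
    (hL : ∀ x y, ‖gradient f x - gradient f y‖ ≤ L * ‖x - y‖) {fs : ℝ} (hfs : ∀ x, fs ≤ f x)
    (x : Vec d) : ‖gradient f x‖ ^ 2 ≤ 2 * L * (f x - fs) := by
  have h := (hfs _).trans (descent_le hf hL x (-(1 / L) • gradient f x))
  rw [inner_smul_right, real_inner_self_eq_norm_sq, norm_smul, mul_pow, norm_neg, norm_div, norm_one,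
    Real.norm_of_nonneg hL0.le] at h
  have e : L / 2 * ((1 / L) ^ 2 * ‖gradient f x‖ ^ 2) = 1 / (2 * L) * ‖gradient f x‖ ^ 2 := by
    field_simp
  have e2 : -(1 / L) * ‖gradient f x‖ ^ 2 = -2 * (1 / (2 * L) * ‖gradient f x‖ ^ 2) := by
    field_simp
  rw [e, e2] at h
  have h2 : 1 / (2 * L) * ‖gradient f x‖ ^ 2 ≤ f x - fs := by linarith
  rw [one_div, inv_mul_le_iff₀ (by positivity)] at h2
  exact h2

theorem norm_avg_le {k : ℕ} (hk : 0 < k) (z : Fin k → Vec d) {R : ℝ} (hz : ∀ j, ‖z j‖ ≤ R) :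
    ‖(1 / (k : ℝ)) • ∑ j, z j‖ ≤ R := by
  have hk0 : (0 : ℝ) < k := by exact_mod_cast hk
  rw [norm_smul, Real.norm_of_nonneg (by positivity), one_div, inv_mul_le_iff₀ hk0]
  calc _ ≤ ∑ j, ‖z j‖ := norm_sum_le _ _
    _ ≤ ∑ _j : Fin k, R := Finset.sum_le_sum fun j _ => hz j
    _ = _ := by simp

variable {n m : ℕ} {𝒟 : Type*} {loss : 𝒟 → Vec d → ℝ} (hdiff : ∀ z, Differentiable ℝ (loss z))
include hdiff

theorem differentiable_localLoss (A : Fin m → 𝒟) : Differentiable ℝ (localLoss loss A) := by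
  unfold localLoss
  exact (Differentiable.fun_sum fun j _ => hdiff _).const_mul _

theorem differentiable_globalLoss (D : Fin n → Fin m → 𝒟) :
    Differentiable ℝ (globalLoss loss D) := by
  unfold globalLoss
  exact (Differentiable.fun_sum fun i _ => differentiable_localLoss hdiff _).const_mul _

variable {L : ℝ} (hL : ∀ z x y, ‖gradient (loss z) x - gradient (loss z) y‖ ≤ L * ‖x - y‖)
include hL

theorem lipschitz_gradient_localLoss (hm : 0 < m) (A : Fin m → 𝒟) (x y : Vec d) :
    ‖gradient (localLoss loss A) x - gradient (localLoss loss A) y‖ ≤ L * ‖x - y‖ := by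
  rw [gradient_localLoss hdiff, gradient_localLoss hdiff, ← smul_sub, ← Finset.sum_sub_distrib]
  exact norm_avg_le hm _ fun j => hL _ _ _

theorem lipschitz_gradient_globalLoss (hn : 0 < n) (hm : 0 < m) (D : Fin n → Fin m → 𝒟)
    (x y : Vec d) :
    ‖gradient (globalLoss loss D) x - gradient (globalLoss loss D) y‖ ≤ L * ‖x - y‖ := by
  rw [gradient_globalLoss hdiff, gradient_globalLoss hdiff, ← smul_sub, ← Finset.sum_sub_distrib]
  exact norm_avg_le hn _ fun i => lipschitz_gradient_localLoss hdiff hL hm _ _ _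

end Smooth

/-! ### Expected progress in one round -/

/-- The potential `f(x) - f* + a ‖x - w‖² + κ (1/n) ∑_i ‖∇f_i(x) - s_i‖²`. -/
noncomputable def potential {n m d : ℕ} {𝒟 : Type*} (loss : 𝒟 → Vec d → ℝ) (D : Fin n → Fin m → 𝒟)
    (fs a κ : ℝ) (st : State n d) : ℝ :=
  globalLoss loss D st.x - fs + a * ‖st.x - st.w‖ ^ 2
    + κ * ((1 / (n : ℝ)) * ∑ i, ‖gradient (localLoss loss (D i)) st.x - st.s i‖ ^ 2)

theorem potential_nonneg {n m d : ℕ} {𝒟 : Type*} {loss : 𝒟 → Vec d → ℝ} {D : Fin n → Fin m → 𝒟}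
    {fs a κ : ℝ} (hfs : ∀ x, fs ≤ globalLoss loss D x) (ha : 0 ≤ a) (hκ : 0 ≤ κ) (st : State n d) :
    0 ≤ potential loss D fs a κ st := by
  have h1 : 0 ≤ globalLoss loss D st.x - fs := sub_nonneg.2 (hfs st.x)
  unfold potential
  positivity

theorem norm_add_sq_le_young {d : ℕ} (u v : Vec d) {ρ : ℝ} (hρ : 0 < ρ) :
    ‖u + v‖ ^ 2 ≤ (1 + 1 / ρ) * ‖u‖ ^ 2 + (1 + ρ) * ‖v‖ ^ 2 := by
  have h1 : ‖u + v‖ ^ 2 ≤ (‖u‖ + ‖v‖) ^ 2 := by gcongr; exact norm_add_le _ _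
  have h2 : 0 ≤ 1 / ρ * (‖u‖ - ρ * ‖v‖) ^ 2 := by positivity
  have h3 : 1 / ρ * (‖u‖ - ρ * ‖v‖) ^ 2 = 1 / ρ * ‖u‖ ^ 2 - 2 * ‖u‖ * ‖v‖ + ρ * ‖v‖ ^ 2 := by
    field_simp; ring
  nlinarith

/-- Expectation of a quadratic function of independent random vectors `v i` with means `e i`. -/
theorem integral_majorant_le {n d : ℕ} (hn : 0 < n) {M : Fin n → Measure (Vec d)}
    [∀ i, IsProbabilityMeasure (M i)] {e : Fin n → Vec d} {V : ℝ}
    (hML : ∀ i, MemLp id 2 (M i)) (hMe : ∀ i, ∫ y, y ∂(M i) = e i)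
    (hMV : ∑ i, ∫ y, ‖y - e i‖ ^ 2 ∂(M i) ≤ n * V) (gf u : Vec d) (F η γ W : ℝ) {c₁ : ℝ} (c₂ : ℝ)
    {c₃ : ℝ} (hc₁ : 0 ≤ c₁) (hc₃ : 0 ≤ c₃) :
    Integrable (fun v : Fin n → Vec d =>
      F - η * inner ℝ gf (gf + (1 / (n : ℝ)) • ∑ i, (v i - e i))
      + c₁ * (η ^ 2 * ‖gf + (1 / (n : ℝ)) • ∑ i, (v i - e i)‖ ^ 2)
      + c₂ * (W - 2 * η * inner ℝ u (gf + (1 / (n : ℝ)) • ∑ i, (v i - e i)))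
      + c₃ * ((1 / (n : ℝ)) * ∑ i, ‖(1 - γ) • e i + (-γ) • (v i - e i)‖ ^ 2)) (Measure.pi M) ∧
    ∫ v, (F - η * inner ℝ gf (gf + (1 / (n : ℝ)) • ∑ i, (v i - e i))
      + c₁ * (η ^ 2 * ‖gf + (1 / (n : ℝ)) • ∑ i, (v i - e i)‖ ^ 2)
      + c₂ * (W - 2 * η * inner ℝ u (gf + (1 / (n : ℝ)) • ∑ i, (v i - e i)))
      + c₃ * ((1 / (n : ℝ)) * ∑ i, ‖(1 - γ) • e i + (-γ) • (v i - e i)‖ ^ 2)) ∂(Measure.pi M)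
    ≤ F - η * ‖gf‖ ^ 2 + c₁ * (η ^ 2 * (‖gf‖ ^ 2 + V / n)) + c₂ * (W - 2 * η * inner ℝ u gf)
      + c₃ * ((1 - γ) ^ 2 * ((1 / (n : ℝ)) * ∑ i, ‖e i‖ ^ 2) + γ ^ 2 * V) := by
  have hn0 : (0 : ℝ) < n := by exact_mod_cast hn
  have hYL : ∀ i, MemLp (fun y : Vec d => y - e i) 2 (M i) := fun i =>
    MemLp.sub (g := fun _ => e i) (hML i) (memLp_const (e i))
  have hY0 : ∀ i, ∫ y, (y - e i) ∂(M i) = 0 := fun i => by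
    have hi : Integrable (fun y : Vec d => y) (M i) := (hML i).integrable (by norm_num)
    rw [integral_sub hi (integrable_const _), hMe]
    simp
  obtain ⟨ν, hν⟩ : ∃ ν, ν = Measure.pi M := ⟨_, rfl⟩
  have hνp : IsProbabilityMeasure ν := by rw [hν]; infer_instance
  obtain ⟨ζ, hζ⟩ : ∃ ζ : (Fin n → Vec d) → Vec d,
      ζ = fun v => (1 / (n : ℝ)) • ∑ i, (v i - e i) := ⟨_, rfl⟩
  have hζv : ∀ v : Fin n → Vec d, (1 / (n : ℝ)) • ∑ i, (v i - e i) = ζ v := fun v => by rw [hζ]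
  have hζL : MemLp ζ 2 ν := by
    rw [hζ, hν]; exact (memLp_sum_pi hYL).const_smul (1 / (n : ℝ))
  have hζi : Integrable ζ ν := hζL.integrable (by norm_num)
  have hζ0 : ∫ v, ζ v ∂ν = 0 := by
    rw [hζ, hν, integral_smul, integral_sum_pi hYL]
    simp [hY0]
  have hζV : ∫ v, ‖ζ v‖ ^ 2 ∂ν ≤ V / n := by
    rw [hζ, hν]
    simp_rw [norm_smul, mul_pow]
    rw [integral_const_mul, integral_norm_sq_sum_pi hYL hY0, Real.norm_of_nonneg (by positivity)]
    calc _ ≤ (1 / (n : ℝ)) ^ 2 * (n * V) := by gcongr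
      _ = _ := by field_simp
  simp only [hζv, ← hν]
  have hinner : ∀ c : Vec d, ∫ v, inner ℝ c (ζ v) ∂ν = 0 := fun c => by
    rw [integral_inner hζi, hζ0, inner_zero_right]
  have hinner' : ∀ c : Vec d, ∫ v, inner ℝ c (gf + ζ v) ∂ν = inner ℝ c gf := fun c => by
    simp_rw [inner_add_right]
    rw [integral_add (integrable_const _) (hζi.const_inner c), hinner]
    simp
  have hgζL : MemLp (fun v => gf + ζ v) 2 ν := MemLp.add (f := fun _ => gf) (memLp_const gf) hζL
  have hgζi : ∀ c : Vec d, Integrable (fun v => inner ℝ c (gf + ζ v)) ν := fun c =>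
    (hgζL.integrable (by norm_num)).const_inner c
  have hgζsq : Integrable (fun v => ‖gf + ζ v‖ ^ 2) ν := integrable_norm_sq_of_memLp hgζL
  have hEL : ∀ i, MemLp (fun v : Fin n → Vec d => (-γ) • (v i - e i)) 2 ν := fun i => by
    rw [hν]; exact (memLp_eval_pi hYL i).const_smul (-γ)
  have hEsq : ∀ i, Integrable (fun v : Fin n → Vec d =>
      ‖(1 - γ) • e i + (-γ) • (v i - e i)‖ ^ 2) ν := fun i =>
    integrable_norm_sq_of_memLp (MemLp.add (f := fun _ => (1 - γ) • e i) (memLp_const _) (hEL i))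
  have hEint : ∀ i, ∫ v, ‖(1 - γ) • e i + (-γ) • (v i - e i)‖ ^ 2 ∂ν
      = (1 - γ) ^ 2 * ‖e i‖ ^ 2 + γ ^ 2 * ∫ y, ‖y - e i‖ ^ 2 ∂(M i) := fun i => by
    rw [integral_norm_add_sq (memLp_const ((1 - γ) • e i)) (hEL i)]
    have h1 : ∫ v : Fin n → Vec d, (-γ) • (v i - e i) ∂ν = 0 := by
      rw [hν, integral_smul, integral_eval_pi (μ := M) (i := i) (f := fun y : Vec d => y - e i) (hYL i).1, hY0,
        smul_zero]
    rw [integral_inner ((hEL i).integrable (by norm_num)), h1, inner_zero_right]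
    simp_rw [norm_smul, mul_pow]
    rw [integral_const_mul, integral_const_mul, hν, integral_eval_pi (μ := M) (i := i)
      (f := fun y : Vec d => ‖y - e i‖ ^ 2) (integrable_norm_sq_of_memLp (hYL i)).1]
    simp
  have hI1 : Integrable (fun v => F - η * inner ℝ gf (gf + ζ v)) ν :=
    (integrable_const _).sub ((hgζi gf).const_mul _)
  have hI2 : Integrable (fun v => c₁ * (η ^ 2 * ‖gf + ζ v‖ ^ 2)) ν :=
    (hgζsq.const_mul _).const_mul _
  have hI3 : Integrable (fun v => c₂ * (W - 2 * η * inner ℝ u (gf + ζ v))) ν :=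
    ((integrable_const _).sub ((hgζi _).const_mul _)).const_mul _
  have hI4' : Integrable (fun v : Fin n → Vec d =>
      ∑ i, ‖(1 - γ) • e i + (-γ) • (v i - e i)‖ ^ 2) ν :=
    integrable_finsetSum _ fun i _ => hEsq i
  have hI4 : Integrable (fun v : Fin n → Vec d => c₃ * ((1 / (n : ℝ)) *
      ∑ i, ‖(1 - γ) • e i + (-γ) • (v i - e i)‖ ^ 2)) ν := (hI4'.const_mul _).const_mul _
  have hI12 : Integrable (fun v => F - η * inner ℝ gf (gf + ζ v)
      + c₁ * (η ^ 2 * ‖gf + ζ v‖ ^ 2)) ν := hI1.add hI2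
  have hI123 : Integrable (fun v => F - η * inner ℝ gf (gf + ζ v)
      + c₁ * (η ^ 2 * ‖gf + ζ v‖ ^ 2) + c₂ * (W - 2 * η * inner ℝ u (gf + ζ v))) ν := hI12.add hI3
  have hζsq' : ∫ v, ‖gf + ζ v‖ ^ 2 ∂ν ≤ ‖gf‖ ^ 2 + V / n := by
    rw [integral_norm_add_sq (memLp_const gf) hζL, hinner]
    simp only [integral_const, probReal_univ, smul_eq_mul, one_mul, mul_zero, add_zero]
    gcongr
  have e1 : ∫ v, (F - η * inner ℝ gf (gf + ζ v)) ∂ν = F - η * ‖gf‖ ^ 2 := by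
    rw [integral_sub (integrable_const _) ((hgζi gf).const_mul _), integral_const_mul, hinner',
      real_inner_self_eq_norm_sq]
    simp
  have e3 : ∫ v, (c₂ * (W - 2 * η * inner ℝ u (gf + ζ v))) ∂ν = c₂ * (W - 2 * η * inner ℝ u gf) := by
    rw [integral_const_mul, integral_sub (integrable_const _) ((hgζi _).const_mul _),
      integral_const_mul, hinner']
    simp
  refine ⟨hI123.add hI4, ?_⟩
  rw [integral_add hI123 hI4, integral_add hI12 hI3, integral_add hI1 hI2, e1, e3,
    integral_const_mul, integral_const_mul, integral_const_mul, integral_const_mul,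
    integral_finsetSum _ fun i _ => hEsq i]
  simp_rw [hEint]
  have e4 : (1 / (n : ℝ)) * ∑ i, ((1 - γ) ^ 2 * ‖e i‖ ^ 2
      + γ ^ 2 * ∫ y, ‖y - e i‖ ^ 2 ∂(M i))
      ≤ (1 - γ) ^ 2 * ((1 / (n : ℝ)) * ∑ i, ‖e i‖ ^ 2) + γ ^ 2 * V := by
    rw [Finset.sum_add_distrib, ← Finset.mul_sum, ← Finset.mul_sum]
    have := mul_le_mul_of_nonneg_left hMV (show 0 ≤ (1 / (n : ℝ)) * γ ^ 2 by positivity)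
    have e5 : (1 / (n : ℝ)) * γ ^ 2 * (n * V) = γ ^ 2 * V := by field_simp
    rw [e5] at this
    linarith
  gcongr

section Step

variable {n m d : ℕ} {𝒟 : Type*} {loss : 𝒟 → Vec d → ℝ} (hdiff : ∀ z, Differentiable ℝ (loss z))
  {L : ℝ}
  (hL : ∀ z x y, ‖gradient (loss z) x - gradient (loss z) y‖ ≤ L * ‖x - y‖)
  (hn : 0 < n) (hm : 0 < m)

/-- The aggregated direction is the exact gradient plus an average of message errors, which are
centred since a message has mean `∇f_i(x) - s_i`. -/
theorem sBar_add_avg (hdiff : ∀ z, Differentiable ℝ (loss z)) {D : Fin n → Fin m → 𝒟}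
    {st : State n d} (hst : st.sBar = (1 / (n : ℝ)) • ∑ i, st.s i) (v : Fin n → Vec d) :
    st.sBar + (1 / (n : ℝ)) • ∑ i, v i = gradient (globalLoss loss D) st.x
      + (1 / (n : ℝ)) • ∑ i, (v i - (gradient (localLoss loss (D i)) st.x - st.s i)) := by
  rw [hst, gradient_globalLoss hdiff, ← smul_add, ← smul_add]
  congr 1
  rw [← Finset.sum_add_distrib, ← Finset.sum_add_distrib]
  exact Finset.sum_congr rfl fun i _ => by abel

include hdiff hL hn hm

/-- A pathwise majorant that is quadratic in the messages, so its expectation needs only first and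
second moments. Young's parameter `ρ` separates the drift of the local gradients, with weight `1 +
1/ρ`, from the shift update, whose contraction must survive the weight `1 + ρ`. -/
theorem potential_next_le {D : Fin n → Fin m → 𝒟} {fs a κ ρ : ℝ} (hκ : 0 ≤ κ) (hρ : 0 < ρ)
    {P : Params} (st : State n d) (v : Fin n → Vec d) (B : Bool) {g : Vec d}
    (hg : g = st.sBar + (1 / (n : ℝ)) • ∑ i, v i) :
    potential loss D fs a κ (nextState P st (v, B))
      ≤ globalLoss loss D st.x - fs - P.η * inner ℝ (gradient (globalLoss loss D) st.x) g
        + (L / 2 + κ * (1 + 1 / ρ) * L ^ 2) * (P.η ^ 2 * ‖g‖ ^ 2)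
        + a * (if B then P.η ^ 2 * ‖g‖ ^ 2 else ‖st.x - st.w - P.η • g‖ ^ 2)
        + κ * ((1 + ρ) * ((1 / (n : ℝ)) * ∑ i,
          ‖gradient (localLoss loss (D i)) st.x - st.s i - P.γ • v i‖ ^ 2)) := by
  have hn0 : (0 : ℝ) < n := by exact_mod_cast hn
  have hx : (nextState P st (v, B)).x = st.x - P.η • g := by rw [hg]; rfl
  have hnorm : ‖P.η • g‖ ^ 2 = P.η ^ 2 * ‖g‖ ^ 2 := by
    rw [norm_smul, mul_pow, Real.norm_eq_abs, sq_abs]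
  have h1 := descent_le (differentiable_globalLoss hdiff D)
    (lipschitz_gradient_globalLoss hdiff hL hn hm D) st.x (-(P.η • g))
  rw [← sub_eq_add_neg, inner_neg_right, real_inner_smul_right, norm_neg, hnorm] at h1
  have h2 : a * ‖(nextState P st (v, B)).x - (nextState P st (v, B)).w‖ ^ 2
      = a * (if B then P.η ^ 2 * ‖g‖ ^ 2 else ‖st.x - st.w - P.η • g‖ ^ 2) := by
    rw [hx]
    cases B
    · simp only [nextState, Bool.false_eq_true, if_false]
      rw [sub_right_comm]
    · simp only [nextState, if_true]
      rw [show st.x - P.η • g - st.x = -(P.η • g) by abel, norm_neg, hnorm]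
  have h3 : ∀ i, ‖gradient (localLoss loss (D i)) (nextState P st (v, B)).x
      - (nextState P st (v, B)).s i‖ ^ 2
      ≤ (1 + 1 / ρ) * (L ^ 2 * (P.η ^ 2 * ‖g‖ ^ 2)) + (1 + ρ) *
        ‖gradient (localLoss loss (D i)) st.x - st.s i - P.γ • v i‖ ^ 2 := by
    intro i
    rw [hx]
    have e : gradient (localLoss loss (D i)) (st.x - P.η • g) - (nextState P st (v, B)).s i
        = (gradient (localLoss loss (D i)) (st.x - P.η • g) - gradient (localLoss loss (D i)) st.x)
          + (gradient (localLoss loss (D i)) st.x - st.s i - P.γ • v i) := by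
      simp only [nextState]; abel
    rw [e]
    refine (norm_add_sq_le_young _ _ hρ).trans ?_
    have h4 := lipschitz_gradient_localLoss hdiff hL hm (D i) (st.x - P.η • g) st.x
    rw [show st.x - P.η • g - st.x = -(P.η • g) by abel, norm_neg] at h4
    have h5 : ‖gradient (localLoss loss (D i)) (st.x - P.η • g)
        - gradient (localLoss loss (D i)) st.x‖ ^ 2 ≤ L ^ 2 * (P.η ^ 2 * ‖g‖ ^ 2) := by
      rw [← hnorm, ← mul_pow]
      gcongr
    gcongr
  have h6 : (1 / (n : ℝ)) * ∑ i, ‖gradient (localLoss loss (D i)) (nextState P st (v, B)).x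
      - (nextState P st (v, B)).s i‖ ^ 2
      ≤ (1 + 1 / ρ) * (L ^ 2 * (P.η ^ 2 * ‖g‖ ^ 2)) + (1 + ρ) * ((1 / (n : ℝ)) * ∑ i,
          ‖gradient (localLoss loss (D i)) st.x - st.s i - P.γ • v i‖ ^ 2) := by
    calc _ ≤ (1 / (n : ℝ)) * ∑ i, ((1 + 1 / ρ) * (L ^ 2 * (P.η ^ 2 * ‖g‖ ^ 2)) + (1 + ρ) *
        ‖gradient (localLoss loss (D i)) st.x - st.s i - P.γ • v i‖ ^ 2) := by
          gcongr with i
          exact h3 i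
      _ = _ := by
          rw [Finset.sum_add_distrib, Finset.sum_const, ← Finset.mul_sum, Finset.card_univ,
            Fintype.card_fin, nsmul_eq_mul]
          field_simp
  have h7 := mul_le_mul_of_nonneg_left h6 hκ
  rw [potential, h2, hx]
  rw [hx] at h7
  linarith

/-- The majorant is averaged over the coin and then over the independent messages. Only the majorant
is integrated as a real function; the potential is handled by lower integrals. -/
theorem lintegral_potential_next_le (hL0 : 0 < L) {ω : ℝ} (hω : 0 ≤ ω)
    {C : Fin n → Kernel (Vec d) (Vec d)}
    (hC : ∀ i, IsCompressor ω (C i)) {D : Fin n → Fin m → 𝒟} {fs a κ ρ : ℝ}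
    (hfs : ∀ x, fs ≤ globalLoss loss D x) (ha : 0 ≤ a) (hκ : 0 ≤ κ) (hρ : 0 < ρ) {P : Params}
    (hb : 0 < P.b) (hbm : P.b ≤ m) (hv : 0 ≤ P.σsq) (hp : 0 ≤ P.p) (hp1 : P.p ≤ 1)
    {st : State n d} (hst : st.sBar = (1 / (n : ℝ)) • ∑ i, st.s i) {N W Δ V : ℝ}
    (hN : N = ‖gradient (globalLoss loss D) st.x‖ ^ 2) (hW : W = ‖st.x - st.w‖ ^ 2)
    (hΔ : Δ = (1 / (n : ℝ)) * ∑ i, ‖gradient (localLoss loss (D i)) st.x - st.s i‖ ^ 2)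
    (hV : V = (1 + ω) * (L ^ 2 * W / P.b + d * P.σsq) + ω * Δ) :
    ∫⁻ o, ENNReal.ofReal (potential loss D fs a κ (nextState P st o)) ∂(roundLaw loss P C D st)
      ≤ ENNReal.ofReal (globalLoss loss D st.x - fs - P.η * N
        + (L / 2 + a + κ * (1 + 1 / ρ) * L ^ 2) * (P.η ^ 2 * (N + V / n))
        + a * (1 - P.p) * (W - 2 * P.η *
          inner ℝ (st.x - st.w) (gradient (globalLoss loss D) st.x))
        + κ * (1 + ρ) * ((1 - P.γ) ^ 2 * Δ + P.γ ^ 2 * V)) := by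
  have hn0 : (0 : ℝ) < n := by exact_mod_cast hn
  have hCm : ∀ i, IsMarkovKernel (C i) := fun i => (hC i).1
  have hcont := continuous_gradient_of_lipschitz hL
  have hMp : ∀ i, IsProbabilityMeasure (messageLaw loss P (C i) (D i) st.x st.w (st.s i)) :=
    fun i => isProbabilityMeasure_messageLaw hdiff hcont P (C i) (D i) st.x st.w (st.s i)
  have hmom := fun i => message_moments hdiff hL hω (hC i) (P := P) hm hb hbm hv (D i)
    st.x st.w (st.s i)
  obtain ⟨hRi, hRint⟩ := integral_majorant_le (M := fun i =>
    messageLaw loss P (C i) (D i) st.x st.w (st.s i)) hn (fun i => (hmom i).1)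
    (fun i => (hmom i).2.1) (V := V) (by
      calc _ ≤ ∑ i, ((1 + ω) * (L ^ 2 * W / P.b + d * P.σsq)
            + ω * ‖gradient (localLoss loss (D i)) st.x - st.s i‖ ^ 2) :=
          Finset.sum_le_sum fun i _ => by rw [hW]; exact (hmom i).2.2
        _ = _ := by
          rw [Finset.sum_add_distrib, Finset.sum_const, ← Finset.mul_sum, Finset.card_univ,
            Fintype.card_fin, nsmul_eq_mul, hV, hΔ]
          field_simp)
    (gradient (globalLoss loss D) st.x) (st.x - st.w) (globalLoss loss D st.x - fs) P.η
    P.γ W (c₁ := L / 2 + a + κ * (1 + 1 / ρ) * L ^ 2) (a * (1 - P.p)) (c₃ := κ * (1 + ρ))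
    (by positivity) (by positivity)
  have hg := sBar_add_avg hdiff (D := D) hst
  have hQle := fun v B => potential_next_le hdiff hL hn hm (D := D) (fs := fs) (a := a) hκ hρ
    (P := P) st v B (hg v).symm
  rw [← hΔ, ← hN] at hRint
  generalize hgf : gradient (globalLoss loss D) st.x = gf at *
  generalize hF : globalLoss loss D st.x - fs = F at *
  generalize he : (fun i => gradient (localLoss loss (D i)) st.x - st.s i) = e at *
  have hei : ∀ i, gradient (localLoss loss (D i)) st.x - st.s i = e i := fun i => congrFun he i
  simp only [hei] at hRi hRint hQle
  obtain ⟨ζ, hζ⟩ : ∃ ζ : (Fin n → Vec d) → Vec d,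
      ζ = fun v => (1 / (n : ℝ)) • ∑ i, (v i - e i) := ⟨_, rfl⟩
  have hζv : ∀ v : Fin n → Vec d, (1 / (n : ℝ)) • ∑ i, (v i - e i) = ζ v := fun v => by rw [hζ]
  simp only [hζv] at hRi hRint hQle
  obtain ⟨Q, hQ⟩ : ∃ Q : (Fin n → Vec d) → Bool → ℝ, ∀ v B, Q v B =
      F - P.η * inner ℝ gf (gf + ζ v)
      + (L / 2 + κ * (1 + 1 / ρ) * L ^ 2) * (P.η ^ 2 * ‖gf + ζ v‖ ^ 2)
      + a * (if B then P.η ^ 2 * ‖gf + ζ v‖ ^ 2 else ‖st.x - st.w - P.η • (gf + ζ v)‖ ^ 2)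
      + κ * ((1 + ρ) * ((1 / (n : ℝ)) * ∑ i, ‖e i - P.γ • v i‖ ^ 2)) := ⟨_, fun _ _ => rfl⟩
  simp only [← hQ] at hQle
  have hpot0 := fun st' => potential_nonneg (D := D) (fs := fs) hfs ha hκ st'
  have hQ0 : ∀ v B, 0 ≤ Q v B := fun v B => (hpot0 _).trans (hQle v B)
  have hζm : Measurable ζ := by
    rw [hζ]
    refine Measurable.fun_const_smul ?_ _
    exact Finset.measurable_fun_sum _ fun i _ => (measurable_pi_apply i).sub_const _
  have hQm : ∀ B, Measurable fun v => Q v B := fun B => by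
    have hsm : Measurable fun v : Fin n → Vec d => ∑ i, ‖e i - P.γ • v i‖ ^ 2 :=
      Finset.measurable_fun_sum _ fun i _ => by
        have h1 : Measurable fun v : Fin n → Vec d => v i := measurable_pi_apply i
        fun_prop
    simp only [hQ]
    cases B <;> simp only [Bool.false_eq_true, if_false, if_true] <;> fun_prop
  have hQm' : Measurable fun o : (Fin n → Vec d) × Bool => ENNReal.ofReal (Q o.1 o.2) :=
    Measurable.ennreal_ofReal (measurable_from_prod_countable_left hQm)
  obtain ⟨R, hR⟩ : ∃ R : (Fin n → Vec d) → ℝ, R = fun v =>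
    F - P.η * inner ℝ gf (gf + ζ v)
      + (L / 2 + a + κ * (1 + 1 / ρ) * L ^ 2) * (P.η ^ 2 * ‖gf + ζ v‖ ^ 2)
      + a * (1 - P.p) * (W - 2 * P.η * inner ℝ (st.x - st.w) (gf + ζ v))
      + κ * (1 + ρ) * ((1 / (n : ℝ)) * ∑ i, ‖(1 - P.γ) • e i + (-P.γ) • (v i - e i)‖ ^ 2) :=
    ⟨_, rfl⟩
  rw [← hR] at hRi hRint
  -- For either coin the snapshot term contains `a η² ‖g‖²`, so this part keeps its full weight; the
  -- old distance and the cross term keep only the weight `1 - p`.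
  have hRQ : ∀ v, P.p * Q v true + (1 - P.p) * Q v false = R v := fun v => by
    have h1 : ‖st.x - st.w - P.η • (gf + ζ v)‖ ^ 2
        = W - 2 * P.η * inner ℝ (st.x - st.w) (gf + ζ v) + P.η ^ 2 * ‖gf + ζ v‖ ^ 2 := by
      rw [norm_sub_sq_real, norm_smul, mul_pow, real_inner_smul_right, Real.norm_eq_abs, sq_abs, hW]
      ring
    have h2 : ∀ i, (1 - P.γ) • e i + (-P.γ) • (v i - e i) = e i - P.γ • v i := fun i => by
      module
    simp only [hQ, hR, if_true, Bool.false_eq_true, if_false, h1, h2]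
    ring
  calc _ ≤ ∫⁻ o, ENNReal.ofReal (Q o.1 o.2) ∂(roundLaw loss P C D st) :=
        lintegral_mono fun o => ENNReal.ofReal_le_ofReal (hQle o.1 o.2)
    _ = ∫⁻ v, ENNReal.ofReal (R v) ∂(Measure.pi fun i =>
          messageLaw loss P (C i) (D i) st.x st.w (st.s i)) := by
        rw [roundLaw, lintegral_prod _ hQm'.aemeasurable]
        refine lintegral_congr fun v => ?_
        rw [lintegral_coin hp hp1, ← ENNReal.ofReal_mul hp, ← ENNReal.ofReal_mul (by linarith),
          ← ENNReal.ofReal_add (mul_nonneg hp (hQ0 v _)) (mul_nonneg (by linarith) (hQ0 v _)), hRQ]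
    _ = ENNReal.ofReal (∫ v, R v ∂(Measure.pi fun i =>
          messageLaw loss P (C i) (D i) st.x st.w (st.s i))) := by
        rw [ofReal_integral_eq_lintegral_ofReal hRi]
        refine Filter.Eventually.of_forall fun v => ?_
        rw [Pi.zero_apply, ← hRQ]
        exact add_nonneg (mul_nonneg hp (hQ0 v _)) (mul_nonneg (by linarith) (hQ0 v _))
    _ ≤ _ := ENNReal.ofReal_le_ofReal hRint

end Step

/-! ### Contraction of the potential -/

section Scalar

variable {ω y g p h : ℝ}

/-- Here `g` stands for `γ (1 + ω)`; the choice of `γ` places `g²` in `[1/2, 1]`. -/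
theorem shift_contraction (hg0 : 0 ≤ g) (hω : 0 ≤ ω)
    (hg : g ^ 2 = (1 + 2 * ω) / (2 * (1 + ω))) : 7 / 10 ≤ g ∧ g ≤ 1 ∧ 91 / 100 ≤ 2 * g - g ^ 2 := by
  have h1 : 1 / 2 ≤ g ^ 2 := by
    rw [hg, div_le_div_iff₀ (by norm_num) (by positivity)]; linarith
  have h2 : g ^ 2 ≤ 1 := by
    rw [hg, div_le_one (by positivity)]; linarith
  have h3 : 7 / 10 ≤ g := by nlinarith
  have h4 : g ≤ 1 := by nlinarith
  exact ⟨h3, h4, by nlinarith⟩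

/-- The Young weight `1 + ρ` with `ρ = 1 / (2(1 + ω))` does not push the scaled shift step above
`1`. This keeps the message variance fed back through the shifts under control. -/
theorem one_add_mul_shift_sq_le (hω : 0 ≤ ω) (hg : g ^ 2 = (1 + 2 * ω) / (2 * (1 + ω))) :
    (1 + 1 / (2 * (1 + ω))) * g ^ 2 ≤ 1 := by
  have e : (1 + 1 / (2 * (1 + ω))) * ((1 + 2 * ω) / (2 * (1 + ω)))
      = (3 + 8 * ω + 4 * ω ^ 2) / (4 * (1 + ω) ^ 2) := by
    field_simp; ring
  rw [hg, e, div_le_one (by positivity)]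
  nlinarith

/-- The coefficient of the message variance, up to the factor `1 / L`. -/
theorem variance_coef_le {γ : ℝ} (hω : 0 ≤ ω) (hy0 : 0 ≤ y) (hp : 0 < p) (hp4 : p ≤ 1 / 4)
    (hy : y * (1 + ω) ^ 3 ≤ 1) (hγ : (γ * (1 + ω)) ^ 2 = (1 + 2 * ω) / (2 * (1 + ω))) {B : ℝ}
    (hB : B = (13 / 20 + 2 * p) * y / 64
      + ω * (1 + ω) * y / 20 * (1 + 1 / (2 * (1 + ω))) * γ ^ 2) :
    0 ≤ B ∧ B ≤ y / 10 ∧ (1 + ω) * B ≤ (1 + p) / 64 := by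
  have hr : (0 : ℝ) < 1 + ω := by linarith
  have h1 := one_add_mul_shift_sq_le hω hγ
  have h2 : ω * (1 + ω) * y / 20 * (1 + 1 / (2 * (1 + ω))) * γ ^ 2 * (1 + ω) ≤ ω * y / 20 := by
    have := mul_le_mul_of_nonneg_left h1 (show 0 ≤ ω * y / 20 by positivity)
    calc _ = ω * y / 20 * ((1 + 1 / (2 * (1 + ω))) * (γ * (1 + ω)) ^ 2) := by ring
      _ ≤ _ := by linarith
  have hB1 : (1 + ω) * B ≤ (13 / 20 + 2 * p) * y / 64 * (1 + ω) + ω * y / 20 := by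
    rw [hB]; linarith
  have hB0 : 0 ≤ B := by rw [hB]; positivity
  refine ⟨hB0, ?_, hB1.trans ?_⟩
  · refine le_of_mul_le_mul_left (hB1.trans ?_) hr
    nlinarith [mul_nonneg hω hy0, mul_nonneg hy0 hr.le]
  · have h3 : (13 / 20 + 2 * p) * (1 + ω) + 16 / 5 * ω ≤ (1 + p) * (1 + ω) ^ 3 := by
      nlinarith [sq_nonneg (ω - 1 / 10), pow_nonneg hω 3, mul_nonneg hω hp.le,
        mul_nonneg (pow_nonneg hω 3) hp.le, mul_nonneg (pow_nonneg hω 2) hp.le]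
    have h4 := mul_le_mul_of_nonneg_left h3 hy0
    have h5 := mul_le_mul_of_nonneg_left hy (show 0 ≤ 1 + p by linarith)
    nlinarith

/-- The shift contraction pays for the shift part of the message variance. After factoring out `ω
y`, the bound `2g - g² ≥ 91/100` leaves a gain of at least `41/2000`, against a cost of at most
`1.15/64`. -/
theorem shift_coef_le {γ : ℝ} (hω : 0 ≤ ω) (hy0 : 0 ≤ y) (hγ0 : 0 ≤ γ) (hp4 : p ≤ 1 / 4)
    (hγ : (γ * (1 + ω)) ^ 2 = (1 + 2 * ω) / (2 * (1 + ω))) {B : ℝ}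
    (hB : B = (13 / 20 + 2 * p) * y / 64
      + ω * (1 + ω) * y / 20 * (1 + 1 / (2 * (1 + ω))) * γ ^ 2) :
    B * ω + ω * (1 + ω) * y / 20 * (1 + 1 / (2 * (1 + ω))) * (1 - γ) ^ 2
      ≤ ω * (1 + ω) * y / 20 := by
  have hr : (0 : ℝ) < 1 + ω := by linarith
  obtain ⟨-, -, h3⟩ := shift_contraction (mul_nonneg hγ0 hr.le) hω hγ
  have hc : 2 * γ - γ ^ 2 * (1 + ω) ≥ 0 := by
    have : 0 ≤ (1 + ω) * (2 * γ - γ ^ 2 * (1 + ω)) := by nlinarith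
    exact (mul_nonneg_iff_of_pos_left hr).1 this
  have e : B * ω + ω * (1 + ω) * y / 20 * (1 + 1 / (2 * (1 + ω))) * (1 - γ) ^ 2
      - ω * (1 + ω) * y / 20 = ω * y * ((13 / 20 + 2 * p) / 64
        + (1 / 20) * ((γ * (1 + ω)) ^ 2 - 2 * (γ * (1 + ω))
          + 1 / 2 * (1 - 2 * γ + γ ^ 2 * (1 + ω)))) := by
    rw [hB]; field_simp; ring
  have h5 : (13 / 20 + 2 * p) / 64 + (1 / 20) * ((γ * (1 + ω)) ^ 2 - 2 * (γ * (1 + ω))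
          + 1 / 2 * (1 - 2 * γ + γ ^ 2 * (1 + ω))) ≤ 0 := by linarith
  have h6 := mul_nonpos_of_nonneg_of_nonpos (mul_nonneg hω hy0) h5
  linarith

-- Each quantity closes with the weights chosen: `W` by the snapshot coin, `Δ` by the shift step,
-- `N` by the small stepsize. `B / L` bounds the total coefficient of the variance `V`, so the only
-- surplus is the noise `S`, with coefficient of order `(1 + ω) y / L`.
set_option maxHeartbeats 1000000 in
theorem potential_decrease {L η n γ b N W Δ S V F I a κ ρ : ℝ} (hL : 0 < L) (hη : 0 < η)
    (hn : 0 < n) (hω : 0 ≤ ω) (hy0 : 0 ≤ y) (hy : y * (1 + ω) ^ 3 ≤ 1) (hηL : L * η ≤ 1 / 8)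
    (hηy : L ^ 2 * η ^ 2 / n ≤ y / 64) (hp : 0 < p) (hp4 : p ≤ 1 / 4) (hb : 0 < b)
    (hpb : p ^ 2 * b = 1 / 64) (hγ0 : 0 ≤ γ)
    (hγ : (γ * (1 + ω)) ^ 2 = (1 + 2 * ω) / (2 * (1 + ω)))
    (ha : a = 2 * p * L) (hκ : κ = ω * (1 + ω) * y / (20 * L)) (hρ : ρ = 1 / (2 * (1 + ω)))
    (hN : 0 ≤ N) (hW : 0 ≤ W) (hΔ : 0 ≤ Δ) (hS : 0 ≤ S)
    (hI : -(2 * η * I) ≤ p / 2 * W + 2 / p * (η ^ 2 * N))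
    (hV : V = (1 + ω) * (L ^ 2 * W / b + S) + ω * Δ) :
    F - η * N + (L / 2 + a + κ * (1 + 1 / ρ) * L ^ 2) * (η ^ 2 * (N + V / n))
        + a * (1 - p) * (W - 2 * η * I) + κ * (1 + ρ) * ((1 - γ) ^ 2 * Δ + γ ^ 2 * V)
      ≤ F + a * W + κ * Δ - η / 4 * N + S * (1 + ω) * y / (10 * L) := by
  have hr : (0 : ℝ) < 1 + ω := by linarith
  obtain ⟨B, hB⟩ : ∃ B, B = (13 / 20 + 2 * p) * y / 64
      + ω * (1 + ω) * y / 20 * (1 + 1 / (2 * (1 + ω))) * γ ^ 2 := ⟨_, rfl⟩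
  obtain ⟨hB0, hB1, hB2⟩ := variance_coef_le hω hy0 hp hp4 hy hγ hB
  have hB3 := shift_coef_le hω hy0 hγ0 hp4 hγ hB
  have hV0 : 0 ≤ V := by rw [hV]; positivity
  -- `13/20 = 1/2 + 3/20`: since `1 + 1/ρ = 3 + 2ω`, the shift term is at most `3 y (1 + ω)³ / 20 ≤
  -- 3/20`.
  have hH : L / 2 + a + κ * (1 + 1 / ρ) * L ^ 2 ≤ L * (13 / 20 + 2 * p) := by
    have e : L / 2 + a + κ * (1 + 1 / ρ) * L ^ 2
        = L * (1 / 2 + 2 * p + ω * (1 + ω) * y * (3 + 2 * ω) / 20) := by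
      rw [ha, hκ, hρ]; field_simp; ring
    have h1 : ω * (1 + ω) * (3 + 2 * ω) ≤ 3 * (1 + ω) ^ 3 := by
      nlinarith [pow_nonneg hω 3, pow_nonneg hω 2]
    have h2 := mul_le_mul_of_nonneg_left h1 hy0
    rw [e]
    refine mul_le_mul_of_nonneg_left ?_ hL.le
    nlinarith
  have hAV : (L / 2 + a + κ * (1 + 1 / ρ) * L ^ 2) * (η ^ 2 * (N + V / n))
      ≤ L * η ^ 2 * (13 / 20 + 2 * p) * N + 1 / L * ((13 / 20 + 2 * p) * y / 64) * V := by
    refine (mul_le_mul_of_nonneg_right hH (by positivity)).trans ?_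
    have e : L * (13 / 20 + 2 * p) * (η ^ 2 * (N + V / n)) = L * η ^ 2 * (13 / 20 + 2 * p) * N
        + 1 / L * ((13 / 20 + 2 * p) * (L ^ 2 * η ^ 2 / n)) * V := by
      field_simp
    rw [e]
    have : (13 / 20 + 2 * p) * (L ^ 2 * η ^ 2 / n) ≤ (13 / 20 + 2 * p) * y / 64 := by
      have := mul_le_mul_of_nonneg_left hηy (show 0 ≤ 13 / 20 + 2 * p by positivity)
      linarith
    have := mul_le_mul_of_nonneg_right (mul_le_mul_of_nonneg_left this (one_div_nonneg.2 hL.le)) hV0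
    linarith
  -- Young's inequality inflates `W` by `1 + p/2`, but `(1 - p)(1 + p/2) = 1 - p(1 + p)/2`. With `a
  -- = 2pL` this leaves the gain `L p² (1 + p) W` that pays for the sampling variance.
  have hW' : a * (1 - p) * (W - 2 * η * I)
      ≤ a * W - L * p ^ 2 * (1 + p) * W + 4 * L * η ^ 2 * N := by
    have h0 : 0 ≤ a * (1 - p) := by rw [ha]; have : 0 ≤ 1 - p := by linarith
                                    positivity
    have h1 := mul_le_mul_of_nonneg_left (show W - 2 * η * I ≤ W + p / 2 * W + 2 / p * (η ^ 2 * N)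
      by linarith) h0
    refine h1.trans ?_
    have e : a * (1 - p) * (W + p / 2 * W + 2 / p * (η ^ 2 * N))
      = a * W - L * p ^ 2 * (1 + p) * W + 4 * L * η ^ 2 * N - 4 * L * p * η ^ 2 * N := by
      rw [ha]; field_simp; ring
    rw [e]
    have : 0 ≤ 4 * L * p * η ^ 2 * N := by positivity
    linarith
  have hVB : 1 / L * ((13 / 20 + 2 * p) * y / 64) * V + κ * (1 + ρ) * ((1 - γ) ^ 2 * Δ + γ ^ 2 * V)
      = 1 / L * B * ((1 + ω) * (L ^ 2 * W / b + S)) + 1 / L * (B * ω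
        + ω * (1 + ω) * y / 20 * (1 + 1 / (2 * (1 + ω))) * (1 - γ) ^ 2) * Δ := by
    rw [hB, hκ, hρ, hV]; ring
  have hD : 1 / L * (B * ω + ω * (1 + ω) * y / 20 * (1 + 1 / (2 * (1 + ω))) * (1 - γ) ^ 2) * Δ
      ≤ κ * Δ := by
    have e : κ = 1 / L * (ω * (1 + ω) * y / 20) := by rw [hκ]; field_simp
    rw [e]
    gcongr
  have hWB : 1 / L * B * ((1 + ω) * (L ^ 2 * W / b)) ≤ L * p ^ 2 * (1 + p) * W := by
    have e : 1 / L * B * ((1 + ω) * (L ^ 2 * W / b)) = L * W / b * ((1 + ω) * B) := by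
      field_simp
    have e2 : p ^ 2 = 1 / 64 / b := by rw [eq_div_iff hb.ne', hpb]
    have e3 : L * p ^ 2 * (1 + p) * W = L * W / b * ((1 + p) / 64) := by rw [e2]; field_simp
    rw [e, e3]
    gcongr
  have hSB : 1 / L * B * ((1 + ω) * S) ≤ S * (1 + ω) * y / (10 * L) := by
    have e : S * (1 + ω) * y / (10 * L) = 1 / L * (y / 10) * ((1 + ω) * S) := by field_simp
    rw [e]
    gcongr
  -- With `Lη ≤ 1/8` and `p ≤ 1/4` the coefficient is at most `5.15/8 < 3/4`, so a quarter of the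
  -- descent term remains.
  have hNN : L * η ^ 2 * (13 / 20 + 2 * p) * N + 4 * L * η ^ 2 * N ≤ 3 / 4 * η * N := by
    have h1 : L * η * (13 / 20 + 2 * p + 4) ≤ 3 / 4 := by nlinarith [mul_pos hL hη]
    have h2 := mul_le_mul_of_nonneg_right h1 (mul_nonneg hη.le hN)
    calc _ = L * η * (13 / 20 + 2 * p + 4) * (η * N) := by ring
      _ ≤ _ := by linarith
  have : 1 / L * B * ((1 + ω) * (L ^ 2 * W / b + S)) = 1 / L * B * ((1 + ω) * (L ^ 2 * W / b))
      + 1 / L * B * ((1 + ω) * S) := by ring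
  linarith

end Scalar

/-! ### The values of the parameters -/

theorem prob_eq {m : ℕ} (hm : 0 < m) : prob m = (m : ℝ) ^ (-(1 / 3) : ℝ) / 4 := by
  have hm0 : (0 : ℝ) < m := by exact_mod_cast hm
  rw [prob, batch, div_right_comm, ← Real.rpow_sub_one hm0.ne']
  norm_num

theorem prob_pos {m : ℕ} (hm : 0 < m) : 0 < prob m := by
  have hm0 : (0 : ℝ) < m := by exact_mod_cast hm
  rw [prob_eq hm]; positivity

theorem prob_le {m : ℕ} (hm : 0 < m) : prob m ≤ 1 / 4 := by
  have hm1 : (1 : ℝ) ≤ m := by exact_mod_cast hm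
  have := Real.rpow_le_one_of_one_le_of_nonpos hm1 (show (-(1 / 3) : ℝ) ≤ 0 by norm_num)
  rw [prob_eq hm]; linarith

/-- The powers of `m` cancel in this combination. It balances snapshot gain against sampling
variance and makes the stepsize and `β` independent of `m`. -/
theorem prob_sq_mul_batch {m : ℕ} (hm : 0 < m) : prob m ^ 2 * batch m = 1 / 64 := by
  have hm0 : (0 : ℝ) < m := by exact_mod_cast hm
  have h : ((m : ℝ) ^ (-(1 / 3) : ℝ)) ^ 2 * (m : ℝ) ^ (2 / 3 : ℝ) = 1 := by
    rw [← Real.rpow_natCast, ← Real.rpow_mul hm0.le, ← Real.rpow_add hm0]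
    norm_num
  rw [prob_eq hm, batch]
  linear_combination h / 64

theorem prob_rpow_mul_batch_rpow {m : ℕ} (hm : 0 < m) :
    prob m ^ (2 / 3 : ℝ) * batch m ^ (1 / 3 : ℝ) = 1 / 4 := by
  have h : prob m ^ (2 / 3 : ℝ) = (prob m ^ 2) ^ (1 / 3 : ℝ) := by
    rw [← Real.rpow_natCast, ← Real.rpow_mul (prob_pos hm).le]; norm_num
  rw [h, ← Real.mul_rpow (by positivity) (batch_pos hm).le, prob_sq_mul_batch hm,
    show (1 / 64 : ℝ) = (1 / 4) ^ (3 : ℝ) by norm_num, ← Real.rpow_mul (by norm_num)]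
  norm_num

theorem prob_rpow_mul_batch_rpow' {m : ℕ} (hm : 0 < m) :
    prob m ^ (4 / 3 : ℝ) * batch m ^ (2 / 3 : ℝ) = 1 / 16 := by
  have h := congrArg (· ^ 2) (prob_rpow_mul_batch_rpow hm)
  simp only [mul_pow] at h
  rw [← Real.rpow_natCast (_ ^ _), ← Real.rpow_natCast (_ ^ _), ← Real.rpow_mul (prob_pos hm).le,
    ← Real.rpow_mul (batch_pos hm).le] at h
  norm_num at h ⊢
  exact h

/-- `min{1, √(n / (1 + ω)³)}`, the inverse of `max{1, τ}`. -/
noncomputable def stepRatio (n : ℕ) (ω : ℝ) : ℝ := min 1 (Real.sqrt (n / (1 + ω) ^ 3))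

section Ratio

variable {n : ℕ} {ω : ℝ} (hn : 0 < n) (hω : 0 ≤ ω)
include hn hω

theorem stepRatio_pos : 0 < stepRatio n ω := by
  have hn0 : (0 : ℝ) < n := by exact_mod_cast hn
  exact lt_min one_pos (Real.sqrt_pos.2 (by positivity))

omit hn hω in
theorem stepRatio_le_one : stepRatio n ω ≤ 1 := min_le_left _ _

theorem stepRatio_sq : stepRatio n ω ^ 2 = min 1 (n / (1 + ω) ^ 3) := by
  have hn0 : (0 : ℝ) < n := by exact_mod_cast hn
  have h0 : (0 : ℝ) ≤ n / (1 + ω) ^ 3 := by positivity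
  rw [stepRatio]
  rcases le_total 1 ((n : ℝ) / (1 + ω) ^ 3) with h | h
  · rw [min_eq_left h, min_eq_left (Real.one_le_sqrt.2 h), one_pow]
  · rw [min_eq_right h, min_eq_right (Real.sqrt_le_one.2 h), Real.sq_sqrt h0]

theorem stepRatio_sq_le : stepRatio n ω ^ 2 / n * (1 + ω) ^ 3 ≤ 1 := by
  have hn0 : (0 : ℝ) < n := by exact_mod_cast hn
  have h := (stepRatio_sq hn hω).trans_le (min_le_right _ _)
  rw [le_div_iff₀ (by positivity)] at h
  rw [div_mul_eq_mul_div, div_le_one hn0]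
  exact h

theorem max_tau : max 1 (tau n ω) = 1 / stepRatio n ω := by
  have hn0 : (0 : ℝ) < n := by exact_mod_cast hn
  have ht : tau n ω = 1 / Real.sqrt (n / (1 + ω) ^ 3) := by
    have h1 : (1 + ω) ^ (3 / 2 : ℝ) = Real.sqrt ((1 + ω) ^ 3) := by
      rw [Real.sqrt_eq_rpow, ← Real.rpow_natCast, ← Real.rpow_mul (by positivity)]
      norm_num
    rw [tau, h1, Real.sqrt_div hn0.le, one_div_div]
  have hs : 0 < Real.sqrt (n / (1 + ω) ^ 3) := Real.sqrt_pos.2 (by positivity)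
  rw [ht, stepRatio]
  rcases le_total 1 (Real.sqrt (n / (1 + ω) ^ 3)) with h | h
  · rw [min_eq_left h, max_eq_left ((div_le_one hs).2 h), div_one]
  · rw [min_eq_right h, max_eq_right ((one_le_div hs).2 h)]

theorem betaCoef_eq {m : ℕ} (hm : 0 < m) :
    betaCoef n m ω = (1 + ω) ^ 2 * (stepRatio n ω ^ 2 / n) / 16 := by
  rw [betaCoef, prob_rpow_mul_batch_rpow' hm, stepRatio_sq hn hω]
  ring

omit hn hω in
theorem maxStep_eq {m : ℕ} (hm : 0 < m) (L : ℝ) :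
    maxStep n m L ω = stepRatio n ω / (8 * L) := by
  rw [maxStep, prob_rpow_mul_batch_rpow hm, ← stepRatio]
  ring

omit hn in
theorem shiftStep_mul_sq :
    (shiftStep ω * (1 + ω)) ^ 2 = (1 + 2 * ω) / (2 * (1 + ω)) := by
  rw [shiftStep, mul_pow, Real.sq_sqrt (by positivity)]
  field_simp

end Ratio

/-! ### Convergence -/

section Convergence

variable {n m d : ℕ} {𝒟 : Type*} {loss : 𝒟 → Vec d → ℝ} (hdiff : ∀ z, Differentiable ℝ (loss z))
  {L ω : ℝ}
  (hL : ∀ z x y, ‖gradient (loss z) x - gradient (loss z) y‖ ≤ L * ‖x - y‖)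
  (hn : 0 < n) (hm : 0 < m) (hL0 : 0 < L) (hω : 0 ≤ ω)

/-- The weight of the shift errors in the potential. -/
noncomputable def shiftWeight (n : ℕ) (L ω : ℝ) : ℝ :=
  ω * (1 + ω) * (stepRatio n ω ^ 2 / n) / (20 * L)

theorem inner_le_of_young {u g : Vec d} {η p : ℝ} (hp : 0 < p) :
    -(2 * η * inner ℝ u g) ≤ p / 2 * ‖u‖ ^ 2 + 2 / p * (η ^ 2 * ‖g‖ ^ 2) := by
  have h1 : 0 ≤ p / 2 * ‖u + (2 / p * η) • g‖ ^ 2 := by positivity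
  rw [norm_add_sq_real, norm_smul, mul_pow, real_inner_smul_right, Real.norm_eq_abs, sq_abs] at h1
  have e : p / 2 * (‖u‖ ^ 2 + 2 * (2 / p * η * inner ℝ u g) + (2 / p * η) ^ 2 * ‖g‖ ^ 2)
      = p / 2 * ‖u‖ ^ 2 + 2 * η * inner ℝ u g + 2 / p * (η ^ 2 * ‖g‖ ^ 2) := by
    field_simp
  linarith

theorem shiftWeight_nonneg {n : ℕ} {L ω : ℝ} (hL : 0 ≤ L) (hω : 0 ≤ ω) : 0 ≤ shiftWeight n L ω := by
  unfold shiftWeight; positivity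

include hdiff hL hn hm hL0 hω

/-- The descent term stands on the left so that the inequality holds in `ℝ≥0∞` without subtraction
and can be integrated without integrability of the iterates. -/
theorem lintegral_potential_round_le {C : Fin n → Kernel (Vec d) (Vec d)}
    (hC : ∀ i, IsCompressor ω (C i)) {D : Fin n → Fin m → 𝒟} {fs : ℝ}
    (hfs : ∀ x, fs ≤ globalLoss loss D x) {P : Params} (hb : P.b = batch m) (hp : P.p = prob m)
    (hγ : P.γ = shiftStep ω) (hv : 0 ≤ P.σsq) (hη : 0 < P.η) (hηm : P.η ≤ maxStep n m L ω)
    {st : State n d} (hst : st.sBar = (1 / (n : ℝ)) • ∑ i, st.s i) :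
    ∫⁻ o, ENNReal.ofReal (potential loss D fs (2 * prob m * L) (shiftWeight n L ω)
        (nextState P st o)) ∂(roundLaw loss P C D st)
      + ENNReal.ofReal (P.η / 4) * ENNReal.ofReal (‖gradient (globalLoss loss D) st.x‖ ^ 2)
      ≤ ENNReal.ofReal (potential loss D fs (2 * prob m * L) (shiftWeight n L ω) st)
        + ENNReal.ofReal (d * P.σsq * (1 + ω) * (stepRatio n ω ^ 2 / n) / (10 * L)) := by
  have hn0 : (0 : ℝ) < n := by exact_mod_cast hn
  have hp0 := prob_pos hm
  have hp4 := prob_le hm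
  have hb0 := batch_pos hm
  have hμ0 := stepRatio_pos hn hω
  have hμ1 : stepRatio n ω ≤ 1 := stepRatio_le_one
  have ha0 : 0 ≤ 2 * prob m * L := by positivity
  have hκ0 : 0 ≤ shiftWeight n L ω := shiftWeight_nonneg hL0.le hω
  have hηL : L * P.η ≤ stepRatio n ω / 8 := by
    rw [maxStep_eq hm, le_div_iff₀ (by positivity)] at hηm
    linarith
  have hS0 : 0 ≤ (d : ℝ) * P.σsq := mul_nonneg d.cast_nonneg hv
  obtain ⟨N, hN⟩ : ∃ N, N = ‖gradient (globalLoss loss D) st.x‖ ^ 2 := ⟨_, rfl⟩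
  obtain ⟨W, hW⟩ : ∃ W, W = ‖st.x - st.w‖ ^ 2 := ⟨_, rfl⟩
  obtain ⟨Δ, hΔ⟩ : ∃ Δ, Δ = (1 / (n : ℝ)) * ∑ i,
    ‖gradient (localLoss loss (D i)) st.x - st.s i‖ ^ 2 := ⟨_, rfl⟩
  have hN0 : 0 ≤ N := by rw [hN]; exact sq_nonneg _
  have hW0 : 0 ≤ W := by rw [hW]; exact sq_nonneg _
  have hΔ0 : 0 ≤ Δ := by
    rw [hΔ]
    exact mul_nonneg (by positivity) (Finset.sum_nonneg fun i _ => sq_nonneg _)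
  have hρ : 0 < 1 / (2 * (1 + ω)) := by positivity
  have h1 := lintegral_potential_next_le hdiff hL hn hm hL0 hω hC hfs ha0 hκ0 hρ (P := P)
    (by rw [hb]; exact hb0) (by rw [hb]; exact batch_le hm) hv (by rw [hp]; exact hp0.le)
    (by rw [hp]; linarith) hst hN hW hΔ rfl
  have hpot : potential loss D fs (2 * prob m * L) (shiftWeight n L ω) st
      = globalLoss loss D st.x - fs + 2 * prob m * L * W + shiftWeight n L ω * Δ := by
    rw [hW, hΔ]; rfl
  have hNle := norm_gradient_sq_le (differentiable_globalLoss hdiff D) hL0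
    (lipschitz_gradient_globalLoss hdiff hL hn hm D) hfs st.x
  rw [← hN] at hNle
  have h2 := potential_decrease (F := globalLoss loss D st.x - fs) (η := P.η) (n := n) (γ := P.γ)
    (b := batch m) (p := prob m) (S := d * P.σsq)
    (y := stepRatio n ω ^ 2 / n) (I := inner ℝ (st.x - st.w) (gradient (globalLoss loss D) st.x))
    (a := 2 * prob m * L) (κ := shiftWeight n L ω) (ρ := 1 / (2 * (1 + ω)))
    (V := (1 + ω) * (L ^ 2 * W / P.b + d * P.σsq) + ω * Δ) hL0 hη hn0 hω
    (by positivity) (stepRatio_sq_le hn hω) (by linarith)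
    (by
      rw [← mul_pow, div_right_comm]
      have : (L * P.η) ^ 2 ≤ (stepRatio n ω / 8) ^ 2 := by gcongr
      rw [div_pow] at this
      norm_num at this
      gcongr)
    hp0 hp4 hb0 (prob_sq_mul_batch hm) (by rw [hγ]; exact Real.sqrt_nonneg _)
    (by rw [hγ]; exact shiftStep_mul_sq hω) rfl rfl rfl hN0 hW0 hΔ0 hS0
    (by rw [hW, hN]; exact inner_le_of_young hp0) (by rw [hb])
  rw [← hpot, ← hp] at h2
  have hκΔ : 0 ≤ shiftWeight n L ω * Δ := mul_nonneg hκ0 hΔ0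
  have haW : 0 ≤ 2 * prob m * L * W := mul_nonneg ha0 hW0
  have h3 : 0 ≤ globalLoss loss D st.x - fs := sub_nonneg.2 (hfs _)
  have hE : 0 ≤ d * P.σsq * (1 + ω) * (stepRatio n ω ^ 2 / n) / (10 * L) := by positivity
  -- This excludes truncation by `ENNReal.ofReal`: the potential minus the descent term is
  -- nonnegative, by the gradient bound for smooth functions bounded below.
  have h4 : P.η / 4 * N ≤ potential loss D fs (2 * prob m * L) (shiftWeight n L ω) st := by
    have h5 : P.η / 4 * N ≤ P.η / 4 * (2 * L * (globalLoss loss D st.x - fs)) := by gcongr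
    have h6 : P.η / 4 * (2 * L * (globalLoss loss D st.x - fs))
        ≤ globalLoss loss D st.x - fs := by
      have : P.η / 4 * (2 * L) ≤ 1 := by linarith
      calc _ = P.η / 4 * (2 * L) * (globalLoss loss D st.x - fs) := by ring
        _ ≤ 1 * (globalLoss loss D st.x - fs) := by gcongr
        _ = _ := one_mul _
    rw [hpot]; linarith
  rw [← hN, ← ENNReal.ofReal_mul (by positivity)]
  rw [← hp] at h1 h4 ⊢
  refine (add_le_add_left (h1.trans (ENNReal.ofReal_le_ofReal h2)) _).trans ?_
  rw [← ENNReal.ofReal_add (by linarith) (by positivity), ← ENNReal.ofReal_add (by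
    exact (by positivity : 0 ≤ P.η / 4 * N).trans h4) hE]
  exact ENNReal.ofReal_le_ofReal (by linarith)

theorem lintegral_potential_transcript_le {C : Fin n → ℕ → Kernel (Vec d) (Vec d)}
    (hC : ∀ i t, IsCompressor ω (C i t)) {D : Fin n → Fin m → 𝒟} {fs : ℝ}
    (hfs : ∀ x, fs ≤ globalLoss loss D x) {P : Params} (hb : P.b = batch m) (hp : P.p = prob m)
    (hγ : P.γ = shiftStep ω) (hv : 0 ≤ P.σsq) (hη : 0 < P.η) (hηm : P.η ≤ maxStep n m L ω)
    (x0 : Vec d) (T : ℕ) :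
    ∫⁻ h, ENNReal.ofReal (potential loss D fs (2 * prob m * L) (shiftWeight n L ω)
        (stateAfter P x0 T h)) ∂(transcriptLaw loss P C x0 D T)
      + ∑ t ∈ Finset.range T, ENNReal.ofReal (P.η / 4) *
        ∫⁻ h, ENNReal.ofReal (‖gradient (globalLoss loss D) (stateAfter P x0 t h).x‖ ^ 2)
          ∂(transcriptLaw loss P C x0 D t)
      ≤ ENNReal.ofReal (potential loss D fs (2 * prob m * L) (shiftWeight n L ω) (initState n x0))
        + T * ENNReal.ofReal (d * P.σsq * (1 + ω) * (stepRatio n ω ^ 2 / n) / (10 * L)) := by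
  have hcont := continuous_gradient_of_lipschitz hL
  have hCm : ∀ i t, IsMarkovKernel (C i t) := fun i t => (hC i t).1
  have hprob := fun t => isProbabilityMeasure_transcriptLaw hdiff hcont (C := C) P x0 D t
  have hpm : ∀ t, Measurable fun h : Fin t → RoundOut n d =>
      ENNReal.ofReal (potential loss D fs (2 * prob m * L) (shiftWeight n L ω)
        (stateAfter P x0 t h)) := fun t => by
    obtain ⟨hx, hw, hs, -⟩ := measurable_stateAfter (n := n) P x0 t
    have hf := (differentiable_globalLoss hdiff D).continuous.measurable.comp hx
    have hsum : Measurable fun h : Fin t → RoundOut n d => ∑ i,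
        ‖gradient (localLoss loss (D i)) (stateAfter P x0 t h).x - (stateAfter P x0 t h).s i‖ ^ 2 :=
      Finset.measurable_fun_sum _ fun i _ => by
        have h1 := (continuous_gradient_localLoss hdiff hcont (D i)).measurable.comp hx
        have h2 := hs i
        exact (h1.sub h2).norm.pow_const 2
    have hxw : Measurable fun h : Fin t → RoundOut n d =>
        ‖(stateAfter P x0 t h).x - (stateAfter P x0 t h).w‖ ^ 2 := (hx.sub hw).norm.pow_const 2
    exact (((hf.sub_const fs).add (hxw.const_mul _)).add
      ((hsum.const_mul _).const_mul _)).ennreal_ofReal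
  have hgm : ∀ t, Measurable fun h : Fin t → RoundOut n d => ENNReal.ofReal
      (‖gradient (globalLoss loss D) (stateAfter P x0 t h).x‖ ^ 2) := fun t =>
    (((continuous_gradient_globalLoss hdiff hcont D).measurable.comp
      (measurable_stateAfter (n := n) P x0 t).1).norm.pow_const 2).ennreal_ofReal
  induction T with
  | zero =>
    simp only [Finset.range_zero, Finset.sum_empty, add_zero, Nat.cast_zero, zero_mul, stateAfter]
    rw [lintegral_const, (hprob 0).measure_univ, mul_one]
  | succ T ih =>
    rw [lintegral_transcriptLaw_succ hdiff hcont P x0 D T (hpm (T + 1)), Finset.sum_range_succ,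
      add_comm (∑ t ∈ Finset.range T, _), ← add_assoc, ← lintegral_const_mul _ (hgm T),
      ← lintegral_add_right _ ((hgm T).const_mul _)]
    have h1 : ∀ h, ∫⁻ o, ENNReal.ofReal (potential loss D fs (2 * prob m * L) (shiftWeight n L ω)
          (stateAfter P x0 (T + 1) (Fin.snoc (α := fun _ => RoundOut n d) h o)))
          ∂(roundLaw loss P (fun i => C i T) D (stateAfter P x0 T h))
        + ENNReal.ofReal (P.η / 4) *
          ENNReal.ofReal (‖gradient (globalLoss loss D) (stateAfter P x0 T h).x‖ ^ 2)
        ≤ ENNReal.ofReal (potential loss D fs (2 * prob m * L) (shiftWeight n L ω)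
            (stateAfter P x0 T h))
          + ENNReal.ofReal (d * P.σsq * (1 + ω) * (stepRatio n ω ^ 2 / n) / (10 * L)) := fun h => by
      simp only [stateAfter, Fin.init_snoc, Fin.snoc_last]
      exact lintegral_potential_round_le hdiff hL hn hm hL0 hω (fun i => hC i T) hfs hb hp hγ hv hη
        hηm (stateAfter_sBar P x0 T h)
    refine (add_le_add_left (lintegral_mono h1) _).trans ?_
    rw [lintegral_add_left (hpm T), lintegral_const, (hprob T).measure_univ, mul_one,
      add_right_comm]
    refine (add_le_add_left ih _).trans ?_
    rw [add_assoc]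
    push_cast
    rw [add_mul, one_mul]

theorem sum_integral_gradient_le {C : Fin n → ℕ → Kernel (Vec d) (Vec d)}
    (hC : ∀ i t, IsCompressor ω (C i t)) {D : Fin n → Fin m → 𝒟} {fs : ℝ}
    (hfs : ∀ x, fs ≤ globalLoss loss D x) {P : Params} (hb : P.b = batch m) (hp : P.p = prob m)
    (hγ : P.γ = shiftStep ω) (hv : 0 ≤ P.σsq) (hη : 0 < P.η) (hηm : P.η ≤ maxStep n m L ω)
    (x0 : Vec d) (T : ℕ) :
    P.η / 4 * ∑ t ∈ Finset.range T,
        ∫ h, ‖gradient (globalLoss loss D) (stateAfter P x0 t h).x‖ ^ 2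
          ∂(transcriptLaw loss P C x0 D t)
      ≤ potential loss D fs (2 * prob m * L) (shiftWeight n L ω) (initState n x0)
        + T * (d * P.σsq * (1 + ω) * (stepRatio n ω ^ 2 / n) / (10 * L)) := by
  have hcont := continuous_gradient_of_lipschitz hL
  have h := (le_add_self).trans (lintegral_potential_transcript_le hdiff hL hn hm hL0 hω hC hfs hb
    hp hγ hv hη hηm x0 T)
  have hpot := potential_nonneg (D := D) hfs (a := 2 * prob m * L) (κ := shiftWeight n L ω)
    (by have := prob_pos hm; positivity) (shiftWeight_nonneg hL0.le hω) (initState n x0)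
  have hE : 0 ≤ d * P.σsq * (1 + ω) * (stepRatio n ω ^ 2 / n) / (10 * L) := by positivity
  rw [← ENNReal.ofReal_natCast, ← ENNReal.ofReal_mul (by positivity),
    ← ENNReal.ofReal_add hpot (by positivity)] at h
  refine (ENNReal.ofReal_le_ofReal_iff (by positivity)).1 (le_trans ?_ h)
  rw [ENNReal.ofReal_mul (by positivity), ENNReal.ofReal_sum_of_nonneg fun t _ => by positivity,
    Finset.mul_sum]
  gcongr with t
  have hgm : Measurable fun h : Fin t → RoundOut n d =>
      ‖gradient (globalLoss loss D) (stateAfter P x0 t h).x‖ ^ 2 :=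
    ((continuous_gradient_globalLoss hdiff hcont D).measurable.comp
      (measurable_stateAfter (n := n) P x0 t).1).norm.pow_const 2
  rw [integral_eq_lintegral_of_nonneg_ae (Filter.Eventually.of_forall fun h => sq_nonneg _)
    hgm.aestronglyMeasurable]
  -- No finiteness is needed: were the lower integral infinite, the real integral would be `0`.
  exact ENNReal.ofReal_toReal_le

end Convergence

/-- `A` is the number of rounds before the factor `1/μ` and rounding, `U` the target rate, and `c μ²
T Q / (10 L)` the noise gain per round. The quotient `Φ L / (μT)` and the product `μTQ` are both of
order `U` once `μT` is comparable to `A`. -/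
theorem average_le_of_rounds {Φ L A U Q μ η ηm c S : ℝ} {T : ℕ} (hΦ : 0 < Φ) (hL : 0 < L)
    (hA : 0 < A) (hμ : 0 < μ) (hμ1 : μ ≤ 1) (hη : 0 < η) (hηm : η ≤ ηm) (hημ : ηm = μ / (8 * L))
    (hc : 0 < c) (hAU : A * U = Φ * L) (hAQ : A ^ 2 * Q = Φ * L) (hT : T = ⌈A * (1 / μ)⌉₊)
    (hS : η / 4 * S ≤ Φ + T * (c * μ ^ 2 * T * Q / (10 * L))) (hS1 : T = 1 → S ≤ 2 * L * Φ) :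
    1 / (T : ℝ) * S ≤ (40 + 7 * c) * (ηm / η) * U := by
  have hU : 0 < U := (mul_pos_iff_of_pos_left hA).1 (by rw [hAU]; positivity)
  have hQ : A * Q = U := mul_left_cancel₀ hA.ne' (by rw [hAU, ← hAQ]; ring)
  have hQ0 : 0 < Q := (mul_pos_iff_of_pos_left hA).1 (by rw [hQ]; exact hU)
  have hηm0 : 0 < ηm := hη.trans_le hηm
  have hr : 1 ≤ ηm / η := (one_le_div hη).2 hηm
  have hAμ : 0 < A * (1 / μ) := by positivity
  have hT0 : 0 < T := by rw [hT]; exact Nat.ceil_pos.2 hAμ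
  have hT0' : (0 : ℝ) < T := by exact_mod_cast hT0
  rcases le_or_gt μ A with h | h
  · have hTge : A ≤ μ * T := by
      have := Nat.le_ceil (A * (1 / μ))
      rw [← hT, mul_one_div, div_le_iff₀ hμ] at this
      linarith
    have hTle : μ * T ≤ 2 * A := by
      have := (Nat.ceil_lt_add_one hAμ.le).le
      rw [← hT, mul_one_div, div_add_one hμ.ne', le_div_iff₀ hμ] at this
      linarith
    -- Substituting `ηm = μ/(8L)` turns `4/η` into `32 L/μ` times `ηm/η`, and `32/10 = 16/5`. With
    -- `μT ≤ 2A` the total is `32 + 32c/5 ≤ 40 + 7c`.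
    have h1 : 1 / (T : ℝ) * S ≤ ηm / η * (32 * (Φ * L / (μ * T)) + 16 / 5 * c * (μ * T * Q)) := by
      have h2 : S ≤ 4 / η * (Φ + T * (c * μ ^ 2 * T * Q / (10 * L))) := by
        rw [div_mul_eq_mul_div, le_div_iff₀ hη]; linarith
      calc _ ≤ 1 / (T : ℝ) * (4 / η * (Φ + T * (c * μ ^ 2 * T * Q / (10 * L)))) := by gcongr
        _ = _ := by rw [hημ]; field_simp; ring
    have h3 : Φ * L / (μ * T) ≤ U := by
      rw [div_le_iff₀ (by positivity), ← hAU, mul_comm]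
      gcongr
    have h4 : μ * T * Q ≤ 2 * U := by
      calc _ ≤ 2 * A * Q := by gcongr
        _ = _ := by rw [mul_assoc, hQ]
    refine h1.trans ?_
    have h5 : 32 * (Φ * L / (μ * T)) + 16 / 5 * c * (μ * T * Q) ≤ (40 + 7 * c) * U := by
      have := mul_le_mul_of_nonneg_left h4 (show 0 ≤ 16 / 5 * c by positivity)
      nlinarith [mul_pos hc hU]
    calc _ ≤ ηm / η * ((40 + 7 * c) * U) := by gcongr
      _ = _ := by ring
  · have hT1 : T = 1 := by
      refine le_antisymm ?_ hT0
      rw [hT]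
      refine Nat.ceil_le.2 ?_
      rw [mul_one_div, div_le_iff₀ hμ]
      push_cast
      linarith
    have h1 := hS1 hT1
    rw [hT1, Nat.cast_one, div_one, one_mul]
    have h2 : 2 * L * Φ ≤ 2 * U := by nlinarith
    have h3 : 2 * 1 * U ≤ (40 + 7 * c) * (ηm / η) * U := by gcongr; linarith
    linarith

/-! ### The utility bound for the prescribed number of rounds -/

section Utility

variable {n m d : ℕ} {𝒟 : Type*} {loss : 𝒟 → Vec d → ℝ} {L G ω ε δ Φ η c : ℝ}

/-- The target accuracy, the number of rounds before rounding, and the noise level per round. -/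
theorem rate_identities (hn : 0 < n) (hm : 0 < m) (hd : 0 < d) (hL : 0 < L) (hG : 0 < G)
    (hω : 0 ≤ ω) (hε : 0 < ε) (hδ : 0 < δ) (hδ1 : δ < 1) (hΦ : 0 < Φ) {A U Q : ℝ}
    (hA : A = Real.sqrt Φ *
      (Real.sqrt (n * L) * m * ε / (G * Real.sqrt ((1 + ω) * d * Real.log (1 / δ)))))
    (hU : U = Real.sqrt Φ *
      (G * Real.sqrt ((1 + ω) * L * d * Real.log (1 / δ)) / (Real.sqrt n * m * ε)))
    (hQ : Q = (1 + ω) * d * G ^ 2 * Real.log (1 / δ) / (n * m ^ 2 * ε ^ 2)) :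
    0 < A ∧ A * U = Φ * L ∧ A ^ 2 * Q = Φ * L := by
  have hn0 : (0 : ℝ) < n := by exact_mod_cast hn
  have hm0 : (0 : ℝ) < m := by exact_mod_cast hm
  have hd0 : (0 : ℝ) < d := by exact_mod_cast hd
  have hl : 0 < Real.log (1 / δ) := Real.log_pos (by rw [lt_div_iff₀ hδ]; linarith)
  generalize Real.log (1 / δ) = l at *
  have hR : 0 < (1 + ω) * d * l := by positivity
  have e1 : Real.sqrt ((1 + ω) * L * d * l) = Real.sqrt L * Real.sqrt ((1 + ω) * d * l) := by
    rw [← Real.sqrt_mul hL.le]; congr 1; ring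
  have e2 : Real.sqrt (n * L) = Real.sqrt n * Real.sqrt L := Real.sqrt_mul hn0.le _
  have sR := Real.sq_sqrt hR.le
  have sn := Real.sq_sqrt hn0.le
  have sL := Real.sq_sqrt hL.le
  have sΦ := Real.sq_sqrt hΦ.le
  have pR := Real.sqrt_pos.2 hR
  have pn := Real.sqrt_pos.2 hn0
  have pL := Real.sqrt_pos.2 hL
  have pΦ := Real.sqrt_pos.2 hΦ
  rw [e2] at hA
  rw [e1] at hU
  have hQ' : Q = ((1 + ω) * d * l) * G ^ 2 / (n * m ^ 2 * ε ^ 2) := by rw [hQ]; ring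
  generalize (1 + ω) * d * l = R at *
  refine ⟨by rw [hA]; positivity, ?_, ?_⟩
  · rw [hA, hU, ← sL, ← sΦ]
    simp only [Real.sqrt_sq pL.le, Real.sqrt_sq pΦ.le]
    field_simp
  · rw [hA, hQ', ← sL, ← sΦ, ← sR, ← sn]
    simp only [Real.sqrt_sq pL.le, Real.sqrt_sq pΦ.le, Real.sqrt_sq pR.le, Real.sqrt_sq pn.le]
    field_simp

/-- The snapshot term vanishes initially and the references are zero. It remains to compare the
shift weights, `ω(1+ω)/20 ≤ (1+ω)²/16`; the `16` comes from `p^(4/3) b^(2/3) = 1/16`. -/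
theorem potential_initState_le (hn : 0 < n) (hm : 0 < m) (hL : 0 < L) (hω : 0 ≤ ω)
    (D : Fin n → Fin m → 𝒟) (a : ℝ) (x0 : Vec d) :
    potential loss D (⨅ x, globalLoss loss D x) a (shiftWeight n L ω) (initState n x0)
      ≤ initPotential loss L ω D x0 := by
  have hn0 : (0 : ℝ) < n := by exact_mod_cast hn
  simp only [potential, initPotential, initState, sub_self, norm_zero, sub_zero]
  rw [betaCoef_eq hn hω hm]
  have h1 : shiftWeight n L ω ≤ (1 + ω) ^ 2 * (stepRatio n ω ^ 2 / n) / 16 / L := by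
    have h2 : ω * (1 + ω) / 20 ≤ (1 + ω) ^ 2 / 16 := by nlinarith
    calc shiftWeight n L ω = ω * (1 + ω) / 20 * (stepRatio n ω ^ 2 / n) / L := by
          rw [shiftWeight]; ring
      _ ≤ (1 + ω) ^ 2 / 16 * (stepRatio n ω ^ 2 / n) / L := by gcongr
      _ = _ := by ring
  have h3 : 0 ≤ (1 / (n : ℝ)) * ∑ i, ‖gradient (localLoss loss (D i)) x0‖ ^ 2 :=
    mul_nonneg (by positivity) (Finset.sum_nonneg fun i _ => sq_nonneg _)
  have h4 := mul_le_mul_of_nonneg_right h1 h3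
  have e : (1 + ω) ^ 2 * (stepRatio n ω ^ 2 / n) / 16 / L
      * ((1 / (n : ℝ)) * ∑ i, ‖gradient (localLoss loss (D i)) x0‖ ^ 2)
      = (1 + ω) ^ 2 * (stepRatio n ω ^ 2 / n) / 16 / (L * n)
        * ∑ i, ‖gradient (localLoss loss (D i)) x0‖ ^ 2 := by
    rw [← div_div]; ring
  rw [e] at h4
  linarith

theorem rounds_eq (hn : 0 < n) (hω : 0 ≤ ω) : rounds n m d L G ω ε δ Φ = ⌈Real.sqrt Φ *
    (Real.sqrt (n * L) * m * ε / (G * Real.sqrt ((1 + ω) * d * Real.log (1 / δ))))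
      * (1 / stepRatio n ω)⌉₊ := by
  rw [rounds, max_tau hn hω]

theorem utility_le (hn : 0 < n) (hm : 0 < m) (hd : 0 < d) (hL0 : 0 < L) (hG : 0 < G)
    (hω : 0 ≤ ω) (hε : 0 < ε) (hδ : 0 < δ) (hδ1 : δ < 1) (hΦ : 0 < Φ) (hη : 0 < η)
    (hηm : η ≤ maxStep n m L ω) (hc : 0 < c) (hdiff : ∀ z, Differentiable ℝ (loss z))
    (hL : ∀ z x y, ‖gradient (loss z) x - gradient (loss z) y‖ ≤ L * ‖x - y‖)
    {C : Fin n → ℕ → Kernel (Vec d) (Vec d)} (hC : ∀ i t, IsCompressor ω (C i t)) (x0 : Vec d)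
    {D : Fin n → Fin m → 𝒟} (hbdd : BddBelow (Set.range (globalLoss loss D)))
    (hpot : initPotential loss L ω D x0 ≤ Φ) :
    utility loss (svrgParams m G ω ε δ c η (rounds n m d L G ω ε δ Φ)) C x0 D
        (rounds n m d L G ω ε δ Φ)
      ≤ (40 + 7 * c) * (maxStep n m L ω / η) * (Real.sqrt Φ *
        (G * Real.sqrt ((1 + ω) * L * d * Real.log (1 / δ)) / (Real.sqrt n * m * ε))) := by
  have hn0 : (0 : ℝ) < n := by exact_mod_cast hn
  have hm0 : (0 : ℝ) < m := by exact_mod_cast hm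
  have hl : 0 < Real.log (1 / δ) := Real.log_pos (by rw [lt_div_iff₀ hδ]; linarith)
  have hfs : ∀ x, (⨅ x, globalLoss loss D x) ≤ globalLoss loss D x := fun x => ciInf_le hbdd x
  have hpot0 := (potential_initState_le hn hm hL0 hω D (2 * prob m * L) x0).trans hpot
  obtain ⟨hA, hAU, hAQ⟩ := rate_identities hn hm hd hL0 hG hω hε hδ hδ1 hΦ rfl rfl rfl
  obtain ⟨T, hT⟩ : ∃ T, T = rounds n m d L G ω ε δ Φ := ⟨_, rfl⟩
  have hTc := hT
  rw [rounds_eq hn hω] at hTc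
  rw [← hT]
  have hsum := sum_integral_gradient_le hdiff hL hn hm hL0 hω hC hfs
    (P := svrgParams m G ω ε δ c η T) rfl rfl rfl
    (show 0 ≤ c * (G ^ 2 * T * Real.log (1 / δ) / (m ^ 2 * ε ^ 2)) by positivity) hη hηm x0 T
  unfold utility
  refine average_le_of_rounds hΦ hL0 hA (stepRatio_pos hn hω) stepRatio_le_one hη hηm
    (maxStep_eq hm L) hc hAU hAQ hTc ?_ ?_
  · refine hsum.trans (add_le_add hpot0 (le_of_eq ?_))
    simp only [svrgParams]
    field_simp
  -- With a single round the average is the squared gradient at the deterministic point `x0`,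
  -- bounded through `f(x0) - f* ≤ Φ` without any noise.
  · intro hT1
    have hCm : ∀ i t, IsMarkovKernel (C i t) := fun i t => (hC i t).1
    have hprob := isProbabilityMeasure_transcriptLaw hdiff (continuous_gradient_of_lipschitz hL)
      (C := C) (svrgParams m G ω ε δ c η T) x0 D 0
    rw [hT1] at hprob ⊢
    simp only [Finset.range_one, Finset.sum_singleton, stateAfter, initState]
    rw [integral_const, probReal_univ, one_smul]
    refine (norm_gradient_sq_le (differentiable_globalLoss hdiff D) hL0
      (lipschitz_gradient_globalLoss hdiff hL hn hm D) hfs x0).trans ?_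
    refine mul_le_mul_of_nonneg_left (le_trans ?_ hpot) (by positivity)
    have : 0 ≤ betaCoef n m ω / (L * n) * ∑ i, ‖gradient (localLoss loss (D i)) x0‖ ^ 2 := by
      rw [betaCoef_eq hn hω hm]
      exact mul_nonneg (by positivity) (Finset.sum_nonneg fun i _ => sq_nonneg _)
    unfold initPotential
    linarith

end Utility

end Soteria

/-! ### Choice of the constants and conclusion -/

theorem corollary2 (Λ : ℝ) (hΛ : 0 < Λ) :
    ∃ c c' K : ℝ, 0 < c ∧ 0 < c' ∧ 0 < K ∧
      ∀ (n m d : ℕ), 0 < n → 0 < m → 0 < d →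
      ∀ (L G ω ε δ Φ η : ℝ), 0 < L → 0 < G → 0 ≤ ω → 0 < ε → 0 < δ → δ < 1 → 0 < Φ →
      0 < η → η ≤ Soteria.maxStep n m L ω →
      ε ≤ Λ * Real.log (1 / δ) →
      ε < c' * Soteria.batch m ^ 2 * Soteria.rounds n m d L G ω ε δ Φ / m ^ 2 →
      ∀ (𝒟 : Type*) (loss : 𝒟 → Soteria.Vec d → ℝ),
      (∀ z, Differentiable ℝ (loss z)) →
      (∀ z x y, ‖gradient (loss z) x - gradient (loss z) y‖ ≤ L * ‖x - y‖) →
      (∀ z x, ‖gradient (loss z) x‖ ≤ G) →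
      ∀ (C : Fin n → ℕ → ProbabilityTheory.Kernel (Soteria.Vec d) (Soteria.Vec d)),
      (∀ i t, Soteria.IsCompressor ω (C i t)) →
      ∀ (x0 : Soteria.Vec d),
        (∀ (D : Fin n → Fin m → 𝒟) (i : Fin n),
          Soteria.IsLDP ε δ (fun A : Fin m → 𝒟 =>
            Soteria.transcriptLaw loss
              (Soteria.svrgParams m G ω ε δ c η (Soteria.rounds n m d L G ω ε δ Φ)) C x0
              (Function.update D i A) (Soteria.rounds n m d L G ω ε δ Φ))) ∧
        (∀ D : Fin n → Fin m → 𝒟,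
          BddBelow (Set.range (Soteria.globalLoss loss D)) →
          Soteria.initPotential loss L ω D x0 ≤ Φ →
          Soteria.utility loss
              (Soteria.svrgParams m G ω ε δ c η (Soteria.rounds n m d L G ω ε δ Φ)) C x0 D
              (Soteria.rounds n m d L G ω ε δ Φ)
            ≤ K * (Soteria.maxStep n m L ω / η) * Real.sqrt Φ *
              (G * Real.sqrt ((1 + ω) * L * d * Real.log (1 / δ)) / (Real.sqrt n * m * ε))) := by
  obtain ⟨c, hc⟩ : ∃ c : ℝ, c = 122 * (6 + 7 * Λ) ^ 2 := ⟨_, rfl⟩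
  have hc0 : 0 < c := by rw [hc]; positivity
  refine ⟨c, c / (4 * (6 + 7 * Λ)), 40 + 7 * c, hc0, by positivity, by positivity, ?_⟩
  intro n m d hn hm hd L G ω ε δ Φ η hL0 hG0 hω hε hδ hδ1 hΦ hη hηm hεΛ hεT 𝒟 loss hdiff hL hG C
    hC x0
  have hCm : ∀ i t, IsMarkovKernel (C i t) := fun i t => (hC i t).1
  refine ⟨fun D i => ?_, fun D hbdd hpot => ?_⟩
  -- At least one round takes place, so the privacy variance, which is proportional to `T`, is
  -- positive.
  · have hT : 0 < Soteria.rounds n m d L G ω ε δ Φ := by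
      obtain ⟨hA, -, -⟩ :=
        Soteria.rate_identities hn hm hd hL0 hG0 hω hε hδ hδ1 hΦ rfl rfl rfl
      rw [Soteria.rounds_eq hn hω]
      exact Nat.ceil_pos.2 (mul_pos hA (one_div_pos.2 (Soteria.stepRatio_pos hn hω)))
    exact Soteria.isLDP_svrgParams hm hdiff (Soteria.continuous_gradient_of_lipschitz hL) hG0 hG hΛ
      hε hδ hδ1 hT hεΛ hc hεT x0 D i
  · refine (Soteria.utility_le hn hm hd hL0 hG0 hω hε hδ hδ1 hΦ hη hηm hc0 hdiff hL hC x0 hbdd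
      hpot).trans (le_of_eq ?_)
    ring
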